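/- **Theorem (Characterization of confinement zone and escape zone).** Let $p$ be a real polynomial of even degree $n\ge 2$, and for $t\ge 0$ let $p(x,t)=(p*g_t)(x)$ be its heat evolution, where $g_t(x)=\frac1{\sqrt{2\pi t}}e^{-x^2/(2t)}$ for $t>0$ and $p(x,0)=p(x)$. Let $\mathcal{FP}_k$ be the intersection of the closures in $\mathbb R^2$ of $\{(x,t): t\ge 0,\ \partial_x^kp(x,t)>0\}$ and $\{(x,t): t\ge 0,\ \partial_x^kp(x,t)<0\}$. A *Yuille–Poggio curve from* $(h,0)$ on $[0,T]$ is a continuous function $x:[0,T]\to\mathbb R$ with $x(0)=h$, such that $\partial_x^2p(x(t),t)=0$ for at most finitely many $t\in(0,T)$ and $$x'(t)=-\frac{\partial_x^3p(x(t),t)}{2\,\partial_x^2p(x(t),t)}$$ at all other $t\in(0,T)$; it contains the points $(x(t),t)$, $0\le t\le T$. A real number $c$ is in the *escape zone* if there is a Yuille–Poggio curve from $(c,0)$ on some $[0,T]$ with $T>0$, and no Yuille–Poggio curve from $(c,0)$ has a common point with a Yuille–Poggio curve from any $(c',0)$ with $c'\ne c$. The *confinement zone* $\Omega$ is the complement in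 $\mathbb R$ of the escape zone. Then $\mathcal{FP}_2\cap\mathcal{FP}_3$ consists of $k\le \frac n2-1$ points $(x_1,t_1),\dots,(x_k,t_k)$, and for each $i$ there are real numbers $X_i^{LL}\le X_i^{RR}$ with the following properties, and $$\Omega=\bigcup_{i=1}^{k}\,[X_i^{LL},X_i^{RR}].$$ * There is a left branch of $\mathcal{FP}_2$ at $(x_i,t_i)$: a function $\gamma_L$ of $t<t_i$ with $\gamma_L(t)\to x_i$ as $t\uparrow t_i$ such that, for some $\delta>0$ and all $t<t_i$ close to $t_i$, $\gamma_L(t)$ is the least $x\in(x_i-\delta,x_i+\delta)$ with $(x,t)\in\mathcal{FP}_2$. For all $t<t_i$ close to $t_i$ there are exactly two numbers $x_i^{LL}(t)<x_i^{LR}(t)$ such that a Yuille–Poggio curve from $(x_i^{LL}(t),0)$, resp. $(x_i^{LR}(t),0)$, contains $(\gamma_L(t),t)$; and $X_i^{LL}=\lim_{t\uparrow t_i}x_i^{LL}(t)$. * There is a right branch of $\mathcal{FP}_2$ at $(x_i,t_i)$: a function $\gamma_R$ of $t<t_i$, defined likewise with "greatest" in place of "least". For all $t<t_i$ close to $t_i$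 there are exactly two numbers $x_i^{RL}(t)<x_i^{RR}(t)$ such that a Yuille–Poggio curve from $(x_i^{RL}(t),0)$, resp. $(x_i^{RR}(t),0)$, contains $(\gamma_R(t),t)$; and $X_i^{RR}=\lim_{t\uparrow t_i}x_i^{RR}(t)$. -/

import Mathlib

open Set Filter Topology Polynomial

namespace YuillePoggio

noncomputable section

/-- The heat evolution `p(x,t) = (p * g_t)(x)` of the polynomial `p`, where `g_t` is the centred
Gaussian density of variance `t`. It is written as the integral of `p` against the Gaussian law
with mean `x` and variance `t`; for `t = 0` this law is the Dirac mass at `x`, so `p(x,0) = p(x)`.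
Only `t ≥ 0` is ever used. -/
def heatEvolution (p : ℝ[X]) (x t : ℝ) : ℝ :=
  ∫ y, p.eval y ∂(ProbabilityTheory.gaussianReal x t.toNNReal)

/-- The partial derivative `∂ᵏp/∂xᵏ (x,t)` of the heat evolution. -/
def dx (p : ℝ[X]) (k : ℕ) (x t : ℝ) : ℝ :=
  iteratedDeriv k (fun y => heatEvolution p y t) x

/-- The set `FP_k⁺(p)` of all `(x,t)` with `t ≥ 0` and `∂ᵏp/∂xᵏ (x,t) > 0`. -/
def fingerprintPos (p : ℝ[X]) (k : ℕ) : Set (ℝ × ℝ) :=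
  {z | 0 ≤ z.2 ∧ 0 < dx p k z.1 z.2}

/-- The set `FP_k⁻(p)` of all `(x,t)` with `t ≥ 0` and `∂ᵏp/∂xᵏ (x,t) < 0`. -/
def fingerprintNeg (p : ℝ[X]) (k : ℕ) : Set (ℝ × ℝ) :=
  {z | 0 ≤ z.2 ∧ dx p k z.1 z.2 < 0}

/-- The `k`-th fingerprint `FP_k(p)`, the intersection of the closures of `FP_k⁺` and `FP_k⁻`. -/
def fingerprint (p : ℝ[X]) (k : ℕ) : Set (ℝ × ℝ) :=
  closure (fingerprintPos p k) ∩ closure (fingerprintNeg p k)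

/-- `x : [0,T] → ℝ` is (an arc of) the Yuille–Poggio curve starting at `(h,0)`: it is continuous,
it starts at `h`, and it solves `x' = - p_xxx / (2 p_xx)` at every time of `(0,T)` at which the
right-hand side is defined, which is at all but finitely many times. -/
structure IsYPCurve (p : ℝ[X]) (h T : ℝ) (x : ℝ → ℝ) : Prop where
  nonneg : 0 ≤ T
  init : x 0 = h
  continuousOn : ContinuousOn x (Icc 0 T)
  finite_singular : {t ∈ Ioo 0 T | dx p 2 (x t) t = 0}.Finite
  ode : ∀ t ∈ Ioo 0 T, dx p 2 (x t) t ≠ 0 →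
    HasDerivAt x (-(dx p 3 (x t) t) / (2 * dx p 2 (x t) t)) t

/-- The Yuille–Poggio curve from `(h,0)` passes through, or ends at, the point `z = (x,t)`. -/
def Reaches (p : ℝ[X]) (h : ℝ) (z : ℝ × ℝ) : Prop :=
  ∃ x : ℝ → ℝ, IsYPCurve p h z.2 x ∧ x z.2 = z.1

/-- The `t = 0` ends of the Yuille–Poggio curves that contain the point `z`. -/
def feet (p : ℝ[X]) (z : ℝ × ℝ) : Set ℝ := {h | Reaches p h z}

/-- The escape zone: those `c` for which there is a (nondegenerate) Yuille–Poggio curve from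
`(c,0)`, and this curve meets no Yuille–Poggio curve from another point `(c',0)`. -/
def escapeZone (p : ℝ[X]) : Set ℝ :=
  {c | (∃ T > 0, ∃ x, IsYPCurve p c T x) ∧
    ∀ c', c' ≠ c → ∀ z, ¬ (Reaches p c z ∧ Reaches p c' z)}

/-- The confinement zone `Ω(p)`. -/
def confinementZone (p : ℝ[X]) : Set ℝ := (escapeZone p)ᶜ

/-- `γ`, as a function of `t < z.2` near `z.2`, is the left branch of `FP_2` that ends at `z`:
it tends to `z` and runs through the leftmost points of `FP_2` near `z`. -/
def IsLeftBranch (p : ℝ[X]) (z : ℝ × ℝ) (γ : ℝ → ℝ) : Prop :=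
  Tendsto γ (𝓝[<] z.2) (𝓝 z.1) ∧
    ∃ δ > 0, ∀ᶠ t in 𝓝[<] z.2,
      IsLeast {x | x ∈ Ioo (z.1 - δ) (z.1 + δ) ∧ (x, t) ∈ fingerprint p 2} (γ t)

/-- `γ`, as a function of `t < z.2` near `z.2`, is the right branch of `FP_2` that ends at `z`:
it tends to `z` and runs through the rightmost points of `FP_2` near `z`. -/
def IsRightBranch (p : ℝ[X]) (z : ℝ × ℝ) (γ : ℝ → ℝ) : Prop :=
  Tendsto γ (𝓝[<] z.2) (𝓝 z.1) ∧
    ∃ δ > 0, ∀ᶠ t in 𝓝[<] z.2,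
      IsGreatest {x | x ∈ Ioo (z.1 - δ) (z.1 + δ) ∧ (x, t) ∈ fingerprint p 2} (γ t)

/-- `X = X^{LL}`: there is a left branch of `FP_2` at `z`; through each of its points close to `z`
there pass Yuille–Poggio curves from exactly two points `(x^{LL},0)`, `(x^{LR},0)`, with
`x^{LL} < x^{LR}`; and `x^{LL}` tends to `X` as the point tends to `z` along the branch. -/
def IsLeftEnd (p : ℝ[X]) (z : ℝ × ℝ) (X : ℝ) : Prop :=
  ∃ γ xLL xLR : ℝ → ℝ, IsLeftBranch p z γ ∧
    (∀ᶠ t in 𝓝[<] z.2, xLL t < xLR t ∧ feet p (γ t, t) = {xLL t, xLR t}) ∧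
    Tendsto xLL (𝓝[<] z.2) (𝓝 X)

/-- `X = X^{RR}`: there is a right branch of `FP_2` at `z`; through each of its points close to `z`
there pass Yuille–Poggio curves from exactly two points `(x^{RL},0)`, `(x^{RR},0)`, with
`x^{RL} < x^{RR}`; and `x^{RR}` tends to `X` as the point tends to `z` along the branch. -/
def IsRightEnd (p : ℝ[X]) (z : ℝ × ℝ) (X : ℝ) : Prop :=
  ∃ γ xRL xRR : ℝ → ℝ, IsRightBranch p z γ ∧
    (∀ᶠ t in 𝓝[<] z.2, xRL t < xRR t ∧ feet p (γ t, t) = {xRL t, xRR t}) ∧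
    Tendsto xRR (𝓝[<] z.2) (𝓝 X)

end

end YuillePoggio

/-!
A Yuille–Poggio curve of `p` solves `x' = - p_xxx / (2 p_xx)`. Put `q = p'`. By the heat equation
`q_t = q_xx / 2`, the evolution of `q` is constant along the curve, and conversely every continuous
curve on which the evolution of `q` is constant is a Yuille–Poggio curve, because the implicit
function theorem gives the differential equation at all points where `q_x = p_xx` does not vanish
(`reaches_iff`). So the theorem is about the zero curves of the solutions `q - l` of the heat
equation, with `l` a constant, and of the solution `p_xx` itself.

On polynomials the heat flow is the semigroup `heat`, which is defined for all real times; it agrees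
with the Gaussian integral at times `t ≥ 0` (`heatEvolution_eq_ev`). Near a point `(x₀, t₀)` where a
solution `P` has a zero of multiplicity `m`, its zeros look as follows (`exists_isBox`). Before `t₀`
there are exactly `m` zeros, all simple, since `P` is on the parabolic scale a Hermite polynomial
and its `m`-th derivative does not vanish. After `t₀` there is no zero if `m` is even, and one,
simple zero if `m` is odd. Consequently zero curves never split forward in time
(`IsRootCurve.eq_of_eq_left`), they continue forward unless they stop at a zero of even multiplicity
(`exists_forward`), they always continue backward (`exists_backward`), and at least two of them run
into a multiple zero (`exists_two_backward`). Every multiple zero reduces the number of zeros,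
counted with multiplicity, by at least two, so `p_xx`, of degree `n - 2`, has at most `n / 2 - 1`
multiple zeros (`two_mul_card_crit_le`). The set `FP₂ ∩ FP₃` consists of exactly those multiple
zeros of `p_xx` that lie at positive times (`fingerprint_inter`).

At each point of a curve `η` of simple zeros of `p_xx` two level curves of `q` merge. The derivative
of `q` along `η` is `q_xx / 2 ≠ 0`, so later level curves have other levels than earlier ones; the
pair that merges at a later point of `η` therefore encloses the earlier part of `η` (`nested`), and
the feet of the pairs move outward. Along the left branch at a multiple zero the left feet are thus
monotone. They are bounded, because a level curve that passes the multiple zero on its left stays to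
their left. Only finitely many points of the branch have the level of a multiple zero of `p_xx`, and
at the others there are exactly two feet (`joins_iff_of_simple`). This gives the left end
(`exists_isLeftEnd`), and the reflection `x ↦ -x` gives the right end.

Let `c` belong to a confinement interval at `(x₀, t₀)`. If the level curve from `(c, 0)` never met
another one, it would exist up to the time `t₀` and pass neither to the left nor to the right of
`x₀`, hence through `(x₀, t₀)`, where two level curves merge (`mem_confinementZone_of_mem_Icc`).
Conversely, if the level curve from `c` merges with that from `c'`, then the level curves from all
but finitely many points in between stop before that, at zeros of `p_xx` of odd multiplicity. From
such a zero a curve of zeros of `p_xx` goes on. Since `p_xx` has even degree, it has no zeros at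
large times (`eventually_ne_zero_of_even`), so this curve runs into a multiple zero, and by `nested`
its feet enclose the given point (`exists_crit_of_merge`). Thus points arbitrarily close to `c` lie
in the finite union of the closed confinement intervals, and so does `c` (`confinementZone_subset`).
-/

namespace YuillePoggio

/-! ### The heat semigroup on polynomials -/

/-- The heat evolution of the monomial `X ^ k`. -/
noncomputable def heatMonomial (t : ℝ) : ℕ → ℝ[X]
  | 0 => 1
  | k + 1 => X * heatMonomial t k + C t * derivative (heatMonomial t k)

/-- The heat semigroup `exp (t ∂² / 2)` on real polynomials, for all real times `t`. -/
noncomputable def heat (t : ℝ) : ℝ[X] →ₗ[ℝ] ℝ[X] :=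
  Polynomial.lsum fun k => LinearMap.toSpanSingleton ℝ ℝ[X] (heatMonomial t k)

theorem heat_C_mul_X_pow (t a : ℝ) (k : ℕ) : heat t (C a * X ^ k) = C a * heatMonomial t k := by
  rw [heat, Polynomial.lsum_apply, C_mul_X_pow_eq_monomial, sum_monomial_index _ _ (by simp)]
  simp [Polynomial.smul_eq_C_mul]

theorem heat_C_mul (t a : ℝ) (P : ℝ[X]) : heat t (C a * P) = C a * heat t P := by
  rw [← Polynomial.smul_eq_C_mul, map_smul, Polynomial.smul_eq_C_mul]

theorem heat_C (t a : ℝ) : heat t (C a) = C a := by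
  simpa [heatMonomial] using heat_C_mul_X_pow t a 0

/-- The commutator relation between the heat semigroup and multiplication by `X`, from which all
other properties of the semigroup follow by `heat_induction`. -/
theorem heat_X_mul (t : ℝ) (P : ℝ[X]) :
    heat t (X * P) = X * heat t P + C t * derivative (heat t P) := by
  induction P using Polynomial.induction_on' with
  | add p q hp hq => rw [mul_add, map_add, hp, hq]; simp; ring
  | monomial k a =>
    rw [← C_mul_X_pow_eq_monomial, show X * (C a * X ^ k) = C a * X ^ (k + 1) by ring,
      heat_C_mul_X_pow, heat_C_mul_X_pow, heatMonomial]
    simp; ring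

/-- Induction on polynomials adapted to `heat_X_mul`: the step to `X * P` may use the claim for `P`
and for its derivative. -/
theorem heat_induction {Q : ℝ[X] → Prop} (hC : ∀ a, Q (C a))
    (hadd : ∀ P R, Q P → Q R → Q (P + R))
    (hX : ∀ P, Q P → Q (derivative P) → Q (X * P)) (P : ℝ[X]) : Q P := by
  suffices h : ∀ n, ∀ P : ℝ[X], P.natDegree ≤ n → Q P from h _ P le_rfl
  intro n
  induction n with
  | zero =>
    intro P hP
    rw [eq_C_of_natDegree_le_zero hP]; exact hC _
  | succ n ih =>
    intro P hP
    have h1 : P.divX.natDegree ≤ n := by rw [natDegree_divX_eq_natDegree_tsub_one]; omega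
    rw [← X_mul_divX_add P]
    exact hadd _ _ (hX _ (ih _ h1)
      (ih _ ((natDegree_derivative_le _).trans (by omega)))) (hC _)

theorem derivative_heat (t : ℝ) (P : ℝ[X]) :
    derivative (heat t P) = heat t (derivative P) := by
  induction P using heat_induction with
  | hC a => simp [heat_C]
  | hadd P R hP hR => simp [hP, hR]
  | hX P hP hP' =>
    rw [heat_X_mul, derivative_mul (f := X), derivative_X, one_mul, map_add, map_add, heat_X_mul,
      ← hP]
    simp; ring

theorem iterate_derivative_heat (t : ℝ) (P : ℝ[X]) (k : ℕ) :
    derivative^[k] (heat t P) = heat t (derivative^[k] P) := by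
  induction k with
  | zero => rfl
  | succ k ih =>
    rw [Function.iterate_succ_apply', ih, derivative_heat, Function.iterate_succ_apply']

theorem heat_heat (s t : ℝ) (P : ℝ[X]) : heat t (heat s P) = heat (s + t) P := by
  induction P using heat_induction with
  | hC a => simp [heat_C]
  | hadd P R hP hR => simp [hP, hR]
  | hX P hP hP' =>
    rw [heat_X_mul, heat_X_mul, map_add, heat_X_mul, hP, heat_C_mul, ← derivative_heat, hP]
    simp; ring

theorem heat_zero_time (P : ℝ[X]) : heat 0 P = P := by
  induction P using heat_induction with
  | hC a => simp [heat_C]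
  | hadd P R hP hR => simp [hP, hR]
  | hX P hP hP' => simp [heat_X_mul, hP]

theorem heat_comp_X_add_C (t a : ℝ) (P : ℝ[X]) :
    heat t (P.comp (X + C a)) = (heat t P).comp (X + C a) := by
  induction P using heat_induction with
  | hC b => simp [heat_C]
  | hadd P R hP hR => simp [hP, hR]
  | hX P hP hP' =>
    rw [heat_X_mul, mul_comp, X_comp, add_mul, map_add, heat_X_mul, heat_C_mul, hP, derivative_comp]
    simp; ring

theorem heat_comp_C_mul_X (s σ : ℝ) (P : ℝ[X]) :
    heat s (P.comp (C σ * X)) = (heat (σ ^ 2 * s) P).comp (C σ * X) := by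
  induction P using heat_induction with
  | hC b => simp [heat_C]
  | hadd P R hP hR => simp [hP, hR]
  | hX P hP hP' =>
    rw [heat_X_mul, mul_comp, X_comp, mul_assoc, heat_C_mul, heat_X_mul, hP, derivative_comp]
    simp; ring

/-- The heat evolution of the polynomial `P`, as a function of position and (arbitrary real)
time. -/
noncomputable def ev (P : ℝ[X]) (x t : ℝ) : ℝ := (heat t P).eval x

theorem ev_add (P R : ℝ[X]) (x t : ℝ) : ev (P + R) x t = ev P x t + ev R x t := by simp [ev]

theorem ev_C (a x t : ℝ) : ev (C a) x t = a := by simp [ev, heat_C]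

theorem ev_sub_C (P : ℝ[X]) (a x t : ℝ) : ev (P - C a) x t = ev P x t - a := by
  simp [ev, heat_C]

theorem ev_neg (P : ℝ[X]) (x t : ℝ) : ev (-P) x t = -ev P x t := by simp [ev]

theorem ev_X_mul (P : ℝ[X]) (x t : ℝ) :
    ev (X * P) x t = x * ev P x t + t * ev (derivative P) x t := by
  simp [ev, heat_X_mul, derivative_heat]

theorem ev_zero_time (P : ℝ[X]) (x : ℝ) : ev P x 0 = P.eval x := by simp [ev, heat_zero_time]

theorem ev_comp_C_mul_X (P : ℝ[X]) (σ x s : ℝ) :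
    ev (P.comp (C σ * X)) x s = ev P (σ * x) (σ ^ 2 * s) := by
  simp [ev, heat_comp_C_mul_X]

theorem ev_comp_neg_X (P : ℝ[X]) (x t : ℝ) : ev (P.comp (-X)) x t = ev P (-x) t := by
  have := ev_comp_C_mul_X P (-1) x t
  simpa using this

/-- The evolution seen from `(x₀, t₀)`: translation in space and time turns it into the evolution
of another polynomial. -/
theorem ev_shift (P : ℝ[X]) (x₀ t₀ x t : ℝ) :
    ev ((heat t₀ P).comp (X + C x₀)) x t = ev P (x + x₀) (t + t₀) := by
  simp [ev, heat_comp_X_add_C, heat_heat, add_comm]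

theorem continuous_ev (P : ℝ[X]) : Continuous fun z : ℝ × ℝ => ev P z.1 z.2 := by
  induction P using heat_induction with
  | hC b => simpa [ev_C] using continuous_const
  | hadd P R hP hR => simp only [ev_add]; exact hP.add hR
  | hX P hP hP' =>
    simp only [ev_X_mul]; fun_prop

/-- The chain rule along a curve `x`, with the heat equation `∂ₜ = ∂ₓ² / 2` built in. -/
theorem hasDerivAt_ev (P : ℝ[X]) {x : ℝ → ℝ} {x' t : ℝ} (hx : HasDerivAt x x' t) :
    HasDerivAt (fun s => ev P (x s) s)
      (ev (derivative P) (x t) t * x' + ev (derivative (derivative P)) (x t) t / 2) t := by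
  induction P using heat_induction with
  | hC b => simpa [ev, heat_C] using hasDerivAt_const t b
  | hadd P R hP hR =>
    simp only [ev_add, derivative_add]
    exact (hP.add hR).congr_deriv (by ring)
  | hX P hP hP' =>
    simp only [ev_X_mul]
    refine ((hx.mul hP).add ((hasDerivAt_id t).mul hP')).congr_deriv ?_
    simp [ev_add, ev_X_mul]; ring

theorem hasDerivAt_ev_left (P : ℝ[X]) (x t : ℝ) :
    HasDerivAt (fun y => ev P y t) (ev (derivative P) x t) x := by
  have := (heat t P).hasDerivAt x
  rwa [derivative_heat] at this

theorem hasDerivAt_ev_right (P : ℝ[X]) (x t : ℝ) :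
    HasDerivAt (fun s => ev P x s) (ev (derivative (derivative P)) x t / 2) t := by
  simpa using hasDerivAt_ev P (hasDerivAt_const t x)

theorem heat_ne_zero {P : ℝ[X]} (hP : P ≠ 0) (t : ℝ) : heat t P ≠ 0 := by
  intro h
  apply hP
  have := heat_heat t (-t) P
  rw [h] at this
  simpa [heat_zero_time] using this.symm

theorem natDegree_heat_le (t : ℝ) (P : ℝ[X]) : (heat t P).natDegree ≤ P.natDegree := by
  suffices h : ∀ n, ∀ P : ℝ[X], P.natDegree ≤ n → (heat t P).natDegree ≤ n from h _ P le_rfl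
  intro n
  induction n with
  | zero =>
    intro P hP
    rw [eq_C_of_natDegree_le_zero hP, heat_C]; simp
  | succ n ih =>
    intro P hP
    have h1 := ih (derivative P) ((natDegree_derivative_le _).trans (by omega))
    rw [← derivative_heat, natDegree_derivative] at h1
    omega

theorem coeff_heat_natDegree (t : ℝ) (P : ℝ[X]) :
    (heat t P).coeff P.natDegree = P.leadingCoeff := by
  have h := congrArg (fun R => coeff R 0) (iterate_derivative_heat t P P.natDegree)
  have hc : derivative^[P.natDegree] P = C ((derivative^[P.natDegree] P).coeff 0) :=
    eq_C_of_natDegree_le_zero ((natDegree_iterate_derivative _ _).trans (by omega))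
  rw [hc, heat_C] at h
  simp only [coeff_iterate_derivative, coeff_C_zero, zero_add, nsmul_eq_mul] at h
  refine mul_left_cancel₀ ?_ h
  simp [Nat.descFactorial_self, Nat.factorial_ne_zero]

theorem natDegree_heat (t : ℝ) (P : ℝ[X]) : (heat t P).natDegree = P.natDegree := by
  apply le_antisymm (natDegree_heat_le t P)
  conv_lhs => rw [← heat_zero_time P, ← add_neg_cancel t, ← heat_heat]
  exact natDegree_heat_le _ _

theorem leadingCoeff_heat (t : ℝ) (P : ℝ[X]) : (heat t P).leadingCoeff = P.leadingCoeff := by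
  rw [leadingCoeff, natDegree_heat, coeff_heat_natDegree]

/-- On a bounded time interval the real roots of the heat evolution stay bounded. -/
theorem exists_root_bound {P : ℝ[X]} (hP : P ≠ 0) (a b : ℝ) :
    ∃ R > 0, ∀ t ∈ Icc a b, ∀ x, ev P x t = 0 → |x| < R := by
  have hcont : ∀ k, Continuous fun t => (heat t P).coeff k := by
    intro k
    have h : ∀ t, (heat t P).coeff k = ev (derivative^[k] P) 0 t / (k.factorial : ℝ) := by
      intro t
      rw [ev, ← iterate_derivative_heat, ← coeff_zero_eq_eval_zero, coeff_iterate_derivative]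
      simp only [zero_add, Nat.descFactorial_self, nsmul_eq_mul]
      field_simp
    simp only [h]
    exact ((continuous_ev (derivative^[k] P)).comp
      (by fun_prop : Continuous fun t : ℝ => ((0 : ℝ), t))).div_const _
  -- the Cauchy bound of `heat t P` is controlled, since its leading coefficient does not move
  have hb : ∀ k, ∃ M, ∀ t ∈ Icc a b, ‖(heat t P).coeff k‖ ≤ M := fun k =>
    isCompact_Icc.exists_bound_of_continuousOn (hcont k).continuousOn
  choose M hM using hb
  set B : ℝ := ∑ k ∈ Finset.range P.natDegree, |M k| with hB
  have hl : 0 < ‖P.leadingCoeff‖ := by simpa using hP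
  refine ⟨B / ‖P.leadingCoeff‖ + 1, by positivity, fun t ht x hx => ?_⟩
  have h1 := IsRoot.norm_lt_cauchyBound (heat_ne_zero hP t) hx
  rw [← Real.norm_eq_abs]
  rw [← coe_nnnorm]
  refine (NNReal.coe_lt_coe.2 h1).trans_le ?_
  rw [cauchyBound, natDegree_heat, leadingCoeff_heat]
  push_cast
  gcongr
  have : (Finset.sup (Finset.range P.natDegree) fun x => ‖(heat t P).coeff x‖₊) ≤ B.toNNReal := by
    refine Finset.sup_le fun k hk => ?_
    rw [← NNReal.coe_le_coe, coe_nnnorm, Real.coe_toNNReal _ (by positivity)]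
    exact ((hM k t ht).trans (le_abs_self _)).trans
      (Finset.single_le_sum (f := fun k => |M k|) (fun _ _ => abs_nonneg _) hk)
  rw [← NNReal.coe_le_coe, Real.coe_toNNReal _ (by positivity)] at this
  exact this

/-! ### Comparison with the Gaussian integral -/

open MeasureTheory ProbabilityTheory in
theorem integrable_eval_gaussianReal (P : ℝ[X]) (x : ℝ) (v : NNReal) :
    Integrable (fun y => P.eval y) (gaussianReal x v) := by
  induction P using Polynomial.induction_on' with
  | add p q hp hq => simp only [eval_add]; exact hp.add hq
  | monomial k a =>
    simp only [eval_monomial]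
    refine Integrable.const_mul ?_ _
    have := (memLp_id_gaussianReal (μ := x) (v := v) (k : NNReal)).integrable_norm_pow'
    rw [← integrable_norm_iff (by fun_prop)]
    simpa using this

open MeasureTheory ProbabilityTheory in
/-- Stein's identity: integration by parts against a Gaussian law. -/
theorem integral_mul_eval_gaussianReal (P : ℝ[X]) (x : ℝ) (v : NNReal) :
    ∫ y, y * P.eval y ∂(gaussianReal x v) =
      x * (∫ y, P.eval y ∂(gaussianReal x v)) +
        v * ∫ y, (derivative P).eval y ∂(gaussianReal x v) := by
  rcases eq_or_ne v 0 with rfl | hv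
  · simp [gaussianReal_zero_var]
  have hv' : (v : ℝ) ≠ 0 := by exact_mod_cast hv
  have hint : ∀ R : ℝ[X], Integrable fun y => gaussianPDFReal x v y * R.eval y := by
    intro R
    have h := integrable_eval_gaussianReal R x v
    rw [gaussianReal_of_var_ne_zero _ hv, gaussianPDF_def] at h
    rw [integrable_withDensity_iff_integrable_smul₀' (by fun_prop) (by simp)] at h
    refine h.congr (ae_of_all _ fun y => ?_)
    simp [ENNReal.toReal_ofReal (gaussianPDFReal_nonneg x v y)]
  simp only [integral_gaussianReal_eq_integral_smul hv, smul_eq_mul]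
  have hφ : ∀ y, HasDerivAt (gaussianPDFReal x v)
      (-((y - x) / v) * gaussianPDFReal x v y) y := by
    intro y
    rw [gaussianPDFReal_def]
    have h : HasDerivAt (fun y : ℝ => -(y - x) ^ 2 / (2 * v)) (-((y - x) / v)) y := by
      refine ((((hasDerivAt_id y).sub_const x).pow 2).neg.div_const (2 * (v : ℝ))).congr_deriv ?_
      simp; field_simp
    refine (h.exp.const_mul _).congr_deriv ?_
    ring
  have key := integral_mul_deriv_eq_deriv_mul_of_integrable (A := ℝ)
    (u := gaussianPDFReal x v) (v := fun y => P.eval y)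
    (u' := fun y => -((y - x) / v) * gaussianPDFReal x v y)
    (v' := fun y => (derivative P).eval y)
    (fun y _ => hφ y) (fun y _ => P.hasDerivAt y) (hint _)
    (by
      have := (hint ((X - C x) * P)).const_mul (-(1 / (v : ℝ)))
      refine this.congr (ae_of_all _ fun y => ?_)
      simp; ring)
    (hint P)
  have e1 : ∫ y, -((y - x) / v) * gaussianPDFReal x v y * P.eval y =
      -(1 / (v : ℝ)) * ((∫ y, gaussianPDFReal x v y * (y * P.eval y)) -
        x * ∫ y, gaussianPDFReal x v y * P.eval y) := by
    rw [← integral_const_mul, ← integral_sub, ← integral_const_mul]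
    · congr 1; ext y; ring
    · exact (hint (X * P)).congr (ae_of_all _ fun y => by simp)
    · exact (hint P).const_mul x
  rw [e1] at key
  rw [key]
  field_simp
  ring

theorem heatEvolution_eq_ev (P : ℝ[X]) (x : ℝ) {t : ℝ} (ht : 0 ≤ t) :
    heatEvolution P x t = ev P x t := by
  induction P using heat_induction with
  | hC b => simp [heatEvolution, ev_C]
  | hadd P R hP hR =>
    rw [ev_add, ← hP, ← hR]
    simp only [heatEvolution, eval_add]
    exact MeasureTheory.integral_add (integrable_eval_gaussianReal _ _ _)
      (integrable_eval_gaussianReal _ _ _)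
  | hX P hP hP' =>
    rw [ev_X_mul, ← hP, ← hP']
    simp only [heatEvolution, eval_mul, eval_X]
    rw [integral_mul_eval_gaussianReal, Real.coe_toNNReal _ ht]

/-- At nonnegative times the derivatives of the heat evolution are the evolutions of the derivatives
of the polynomial. -/
theorem dx_eq_ev (P : ℝ[X]) (k : ℕ) (x : ℝ) {t : ℝ} (ht : 0 ≤ t) :
    dx P k x t = ev (derivative^[k] P) x t := by
  have h : (fun y => heatEvolution P y t) = fun y => ev P y t :=
    funext fun y => heatEvolution_eq_ev P y ht
  rw [dx, h]
  induction k generalizing x with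
  | zero => simp
  | succ k ih =>
    rw [iteratedDeriv_succ, funext ih, Function.iterate_succ_apply']
    exact (hasDerivAt_ev_left _ x t).deriv

/-! ### Sign changes just before a multiple zero -/

/-- Between a negative and a positive value a differentiable function has a zero at which its
derivative is nonnegative: the last one. -/
theorem exists_zero_deriv_nonneg {f f' : ℝ → ℝ} {a b : ℝ} (hab : a < b)
    (hf : ∀ x, HasDerivAt f (f' x) x) (ha : f a < 0) (hb : 0 < f b) :
    ∃ c ∈ Ioo a b, f c = 0 ∧ 0 ≤ f' c := by
  have hcont : Continuous f := continuous_iff_continuousAt.2 fun x => (hf x).continuousAt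
  obtain ⟨c, ⟨hcI, hc0⟩, hcmax⟩ := (isCompact_Icc.inter_right
    (isClosed_le hcont continuous_const) : IsCompact (Icc a b ∩ {x | f x ≤ 0})).exists_isGreatest
    ⟨a, left_mem_Icc.2 hab.le, ha.le⟩
  have hcb : c < b := lt_of_le_of_ne hcI.2 fun h => by subst h; exact absurd hc0 (not_le.2 hb)
  have hpos : ∀ x ∈ Ioc c b, 0 < f x := by
    intro x hx
    by_contra h
    exact absurd (hcmax ⟨⟨hcI.1.trans hx.1.le, hx.2⟩, not_lt.1 h⟩) (not_le.2 hx.1)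
  have hev : ∀ᶠ x in 𝓝[>] c, x ∈ Ioc c b := Ioc_mem_nhdsGT hcb
  have hc : f c = 0 := by
    apply le_antisymm hc0
    refine ge_of_tendsto (hcont.continuousAt.mono_left (nhdsWithin_le_nhds (s := Ioi c))) ?_
    filter_upwards [hev] with x hx using (hpos x hx).le
  refine ⟨c, ⟨lt_of_le_of_ne hcI.1 fun h => ?_, hcb⟩, hc, ?_⟩
  · subst h; exact ha.ne hc
  · have h := (hasDerivAt_iff_tendsto_slope.1 (hf c)).mono_left
      (nhdsWithin_mono c (fun x (hx : x ∈ Ioi c) => ne_of_gt hx))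
    refine ge_of_tendsto h ?_
    filter_upwards [hev] with x hx
    rw [slope_def_field, hc, sub_zero]
    exact div_nonneg (hpos x hx).le (sub_nonneg.2 hx.1.le)

/-- `f` has alternating signs at the points `ξ 0 < ξ 1 < ⋯ < ξ m`, starting with the sign
of `s`. -/
def Alternates (f : ℝ → ℝ) (m : ℕ) (s : ℝ) (ξ : ℕ → ℝ) : Prop :=
  (∀ i < m, ξ i < ξ (i + 1)) ∧ ∀ i ≤ m, 0 < s * (-1) ^ i * f (ξ i)

theorem lt_of_forall_lt_succ {m : ℕ} {ξ : ℕ → ℝ} (h : ∀ i < m, ξ i < ξ (i + 1)) {i j : ℕ}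
    (hij : i < j) (hj : j ≤ m) : ξ i < ξ j := by
  induction j, hij using Nat.le_induction with
  | base => exact h i (by omega)
  | succ j hij ih => exact (ih (by omega)).trans (h j (by omega))

theorem Alternates.exists_zero {f f' : ℝ → ℝ} {m : ℕ} {s : ℝ} {ξ : ℕ → ℝ}
    (h : Alternates f m s ξ) (hf : ∀ x, HasDerivAt f (f' x) x) {i : ℕ} (hi : i < m) :
    ∃ c ∈ Ioo (ξ i) (ξ (i + 1)), f c = 0 ∧ s * (-1) ^ i * f' c ≤ 0 := by
  have h1 := h.2 i hi.le
  have h2 := h.2 (i + 1) hi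
  obtain ⟨c, hc, h0, h'⟩ := exists_zero_deriv_nonneg (f := fun x => -(s * (-1) ^ i) * f x)
    (f' := fun x => -(s * (-1) ^ i) * f' x) (h.1 i hi) (fun x => (hf x).const_mul _)
    (by linarith) (by rw [pow_succ] at h2; linarith)
  refine ⟨c, hc, ?_, by linarith⟩
  refine (mul_eq_zero.1 h0).resolve_left fun h3 => ?_
  rw [neg_eq_zero.1 h3] at h1
  simp at h1

/-- Hermite polynomials have simple zeros only. -/
theorem ev_X_pow_ne_zero_or (m : ℕ) (x : ℝ) :
    ev (X ^ m) x (-1) ≠ 0 ∨ ev (derivative (X ^ m)) x (-1) ≠ 0 := by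
  induction m with
  | zero => left; have := ev_C 1 x (-1); simp at this; simp [this]
  | succ m ih =>
    by_contra! h
    have h1 : ev (X ^ m) x (-1) = 0 := by
      have := h.2
      rw [derivative_X_pow] at this
      simp only [ev, heat_C_mul, eval_mul, eval_C, Nat.add_sub_cancel] at this
      exact (mul_eq_zero.1 this).resolve_left (by positivity)
    have h2 := h.1
    rw [pow_succ', ev_X_mul, h1] at h2
    rcases ih with h3 | h3
    · exact h3 h1
    · apply h3; linarith

theorem ev_X_pow_neg (m : ℕ) (x t : ℝ) : ev (X ^ m) (-x) t = (-1) ^ m * ev (X ^ m) x t := by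
  rw [← ev_comp_neg_X, X_pow_comp, neg_pow]
  have : ((-1 : ℝ[X]) ^ m) = C ((-1) ^ m) := by simp
  rw [this, ev, heat_C_mul]; simp [ev]

/-- The Hermite polynomials `heat (-1) (X ^ m)` have `m` sign changes. At a zero of one of them the
next one has the sign opposite to that of the derivative. -/
theorem exists_alternates_X_pow (m : ℕ) :
    ∃ ξ, Alternates (fun x => ev (X ^ m) x (-1)) m ((-1) ^ m) ξ := by
  induction m with
  | zero =>
    refine ⟨fun _ => 0, by simp, fun i hi => ?_⟩
    have := ev_C 1 0 (-1)
    simp at this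
    simp [Nat.le_zero.1 hi, this]
  | succ m ih =>
    obtain ⟨ξ, hξ⟩ := ih
    have h1 : ∀ i, ∃ c, i < m → c ∈ Ioo (ξ i) (ξ (i + 1)) ∧
        0 < (-1) ^ m * (-1) ^ i * ev (X ^ (m + 1)) c (-1) := by
      intro i
      by_cases hi : i < m
      · obtain ⟨c, hc, h0, h'⟩ := hξ.exists_zero (fun x => hasDerivAt_ev_left (X ^ m) x (-1)) hi
        refine ⟨c, fun _ => ⟨hc, ?_⟩⟩
        have hne := (ev_X_pow_ne_zero_or m c).resolve_left (not_not.2 h0)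
        rw [pow_succ', ev_X_mul, h0]
        have h2 : (-1 : ℝ) ^ m * (-1) ^ i * ev (derivative (X ^ m)) c (-1) ≠ 0 := by
          simp [hne]
        have := lt_of_le_of_ne h' h2
        linarith
      · exact ⟨0, fun h => absurd h hi⟩
    choose η hη using h1
    have hpos : ∀ᶠ R : ℝ in atTop, 0 < ev (X ^ (m + 1)) R (-1) := by
      refine (Polynomial.tendsto_atTop_of_leadingCoeff_nonneg _ ?_ ?_).eventually_gt_atTop 0
      · rw [← natDegree_pos_iff_degree_pos, natDegree_heat]; simp
      · rw [leadingCoeff_heat]; simp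
    have hbig : ∀ᶠ R : ℝ in atTop, ∀ i ∈ Finset.range m, |η i| < R :=
      (Filter.eventually_all_finset _).2 fun i _ => eventually_gt_atTop _
    obtain ⟨R, hR, hRη, hR0⟩ := (hpos.and (hbig.and (eventually_gt_atTop 0))).exists
    have hmono : ∀ i, i + 1 < m → η i < η (i + 1) := fun i hi =>
      (hη i (by omega)).1.2.trans (hη (i + 1) hi).1.1
    -- the zeros of one Hermite polynomial separate the signs of the next, and a large `R` supplies
    -- the two outermost points
    refine ⟨fun i => if i = 0 then -R else if i = m + 1 then R else η (i - 1), ?_, ?_⟩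
    · intro i hi
      rcases Nat.eq_zero_or_pos i with rfl | hi0
      · rcases Nat.eq_zero_or_pos m with rfl | hm
        · simp; linarith
        · have : ¬ (0 + 1 = m + 1) := by omega
          simp only [if_true, this, if_false]
          simpa using (abs_lt.1 (hRη 0 (by simpa using hm))).1
      · obtain ⟨j, rfl⟩ : ∃ j, i = j + 1 := ⟨i - 1, by omega⟩
        have h2 : ¬ (j + 1 = m + 1) := by omega
        rcases eq_or_ne (j + 1 + 1) (m + 1) with h3 | h3
        · simp only [h2, h3, if_true, if_false, Nat.succ_ne_zero, Nat.add_sub_cancel]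
          exact (abs_lt.1 (hRη j (by simp; omega))).2
        · simp only [h2, h3, if_false, Nat.succ_ne_zero, Nat.add_sub_cancel]
          exact hmono j (by omega)
    · intro i hi
      rcases Nat.eq_zero_or_pos i with rfl | hi0
      · simp only [if_true, ev_X_pow_neg]
        rw [pow_zero, mul_one, ← mul_assoc, ← mul_pow]; simpa using hR
      · obtain ⟨j, rfl⟩ : ∃ j, i = j + 1 := ⟨i - 1, by omega⟩
        rcases eq_or_ne (j + 1) (m + 1) with h3 | h3
        · simp only [h3, if_true, if_false, Nat.succ_ne_zero]
          rw [← mul_pow]; simpa using hR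
        · simp only [h3, if_false, Nat.succ_ne_zero, Nat.add_sub_cancel]
          have := (hη j (by omega)).2
          rw [pow_succ, pow_succ]; linarith

theorem continuous_ev_X_pow_mul_comp (m : ℕ) (R : ℝ[X]) (ξ : ℝ) :
    Continuous fun σ : ℝ => ev (X ^ m * R.comp (C σ * X)) ξ (-1) := by
  induction R using Polynomial.induction_on' with
  | add p q hp hq => simp only [add_comp, mul_add, ev_add]; exact hp.add hq
  | monomial k a =>
    have : ∀ σ : ℝ, ev (X ^ m * (monomial k a).comp (C σ * X)) ξ (-1) =
        (a * σ ^ k) * ev (X ^ (m + k)) ξ (-1) := by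
      intro σ
      rw [← C_mul_X_pow_eq_monomial]
      have : (X : ℝ[X]) ^ m * (C a * X ^ k).comp (C σ * X) = C (a * σ ^ k) * X ^ (m + k) := by
        simp; ring
      rw [this, ev, heat_C_mul]; simp [ev]
    simp only [this]; fun_prop

/-- Parabolic rescaling of the evolution near a zero of order `m`; as `σ → 0`, the factor
`R.comp (C σ * X)` tends to a constant. -/
theorem ev_comp_scaled (m : ℕ) (R : ℝ[X]) (σ ξ : ℝ) :
    ev (X ^ m * R) (σ * ξ) (-σ ^ 2) = σ ^ m * ev (X ^ m * R.comp (C σ * X)) ξ (-1) := by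
  have h := ev_comp_C_mul_X (X ^ m * R) σ ξ (-1)
  rw [show σ ^ 2 * (-1) = -σ ^ 2 by ring] at h
  rw [← h]
  have : (X ^ m * R).comp (C σ * X) = C (σ ^ m) * (X ^ m * R.comp (C σ * X)) := by
    simp; ring
  rw [this, ev, heat_C_mul]; simp [ev]

/-- The multiplicity of `x` as a zero of the heat evolution of `P` at time `t`. -/
noncomputable def mult (P : ℝ[X]) (x t : ℝ) : ℕ := (heat t P).rootMultiplicity x

theorem mult_pos_iff {P : ℝ[X]} (hP : P ≠ 0) {x t : ℝ} : 0 < mult P x t ↔ ev P x t = 0 :=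
  rootMultiplicity_pos (heat_ne_zero hP t)

theorem mult_derivative {P : ℝ[X]} {x t : ℝ} (h : ev P x t = 0) :
    mult (derivative P) x t = mult P x t - 1 := by
  rw [mult, ← derivative_heat, derivative_rootMultiplicity_of_root h, mult]

/-- In coordinates centred at `(x₀, t₀)` the evolution starts from `X ^ m * R` with `R 0 ≠ 0`, where
`m` is the multiplicity of `x₀`. -/
theorem exists_shift_eq {P : ℝ[X]} (hP : P ≠ 0) (x₀ t₀ : ℝ) :
    ∃ R : ℝ[X], R.eval 0 ≠ 0 ∧ (heat t₀ P).comp (X + C x₀) = X ^ mult P x₀ t₀ * R := by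
  obtain ⟨Q, hQ, hnd⟩ := exists_eq_pow_rootMultiplicity_mul_and_not_dvd _ (heat_ne_zero hP t₀) x₀
  refine ⟨Q.comp (X + C x₀), ?_, ?_⟩
  · rw [dvd_iff_isRoot] at hnd
    simpa using hnd
  · conv_lhs => rw [hQ]
    simp [mult]

/-- Just before the time `t₀`, the evolution has `m` sign changes near a zero of multiplicity `m`:
on the parabolic scale it looks like the `m`-th Hermite polynomial. -/
theorem eventually_exists_alternates {P : ℝ[X]} (hP : P ≠ 0) (x₀ t₀ : ℝ) {δ : ℝ} (hδ : 0 < δ) :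
    ∀ᶠ t in 𝓝[<] t₀, ∃ s ξ, Alternates (fun x => ev P x t) (mult P x₀ t₀) s ξ ∧
      ∀ i ≤ mult P x₀ t₀, |ξ i - x₀| < δ := by
  set m := mult P x₀ t₀ with hm
  obtain ⟨R, hR0, hR⟩ := exists_shift_eq hP x₀ t₀
  rw [← hm] at hR
  obtain ⟨ξ, hξ1, hξ2⟩ := exists_alternates_X_pow m
  have key : ∀ᶠ σ : ℝ in 𝓝[>] 0, ∀ i ∈ Finset.range (m + 1),
      0 < R.eval 0 * (-1) ^ m * (-1) ^ i * ev (X ^ m * R.comp (C σ * X)) (ξ i) (-1) ∧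
        |σ * ξ i| < δ := by
    refine nhdsWithin_le_nhds ((Filter.eventually_all_finset _).2 fun i hi => ?_)
    refine Filter.Eventually.and ?_ ?_
    · have hc := (continuous_ev_X_pow_mul_comp m R (ξ i)).tendsto 0
      have h0 : ev (X ^ m * R.comp (C 0 * X)) (ξ i) (-1) = R.eval 0 * ev (X ^ m) (ξ i) (-1) := by
        have : X ^ m * R.comp (C 0 * X) = C (R.eval 0) * X ^ m := by simp
        rw [this, ev, heat_C_mul]; simp [ev]
      rw [h0] at hc
      refine (hc.const_mul (R.eval 0 * (-1) ^ m * (-1) ^ i)).eventually_const_lt ?_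
      have h1 := hξ2 i (by simpa [Nat.lt_succ_iff] using hi)
      have h2 : 0 < R.eval 0 ^ 2 := by positivity
      nlinarith [mul_pos h2 h1]
    · have : Tendsto (fun σ : ℝ => |σ * ξ i|) (𝓝 0) (𝓝 |0 * ξ i|) :=
        (by fun_prop : Continuous fun σ : ℝ => |σ * ξ i|).tendsto 0
      exact this.eventually_lt_const (by simpa using hδ)
  have htend : Tendsto (fun t => √(t₀ - t)) (𝓝[<] t₀) (𝓝[>] 0) := by
    refine tendsto_nhdsWithin_iff.2 ⟨?_, ?_⟩
    · have : Tendsto (fun t => √(t₀ - t)) (𝓝 t₀) (𝓝 √(t₀ - t₀)) :=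
        (by fun_prop : Continuous fun t => √(t₀ - t)).tendsto t₀
      rw [sub_self, Real.sqrt_zero] at this
      exact this.mono_left nhdsWithin_le_nhds
    · filter_upwards [self_mem_nhdsWithin] with t ht
      exact Real.sqrt_pos.2 (sub_pos.2 ht)
  filter_upwards [htend.eventually key, self_mem_nhdsWithin] with t ht htt
  set σ := √(t₀ - t) with hσ
  have hσ0 : 0 < σ := Real.sqrt_pos.2 (sub_pos.2 htt)
  have hσ2 : σ ^ 2 = t₀ - t := Real.sq_sqrt (sub_nonneg.2 (le_of_lt htt))
  refine ⟨R.eval 0 * (-1) ^ m, fun i => σ * ξ i + x₀, ⟨fun i hi => ?_, fun i hi => ?_⟩,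
    fun i hi => ?_⟩
  · have := mul_lt_mul_of_pos_left (hξ1 i hi) hσ0
    simpa using this
  · have h1 := ev_shift P x₀ t₀ (σ * ξ i) (-σ ^ 2)
    rw [hR, ev_comp_scaled, show -σ ^ 2 + t₀ = t by linarith] at h1
    simp only [← h1]
    have := mul_pos (pow_pos hσ0 m) (ht i (by simpa [Nat.lt_succ_iff] using hi)).1
    linarith
  · simpa using (ht i (by simpa [Nat.lt_succ_iff] using hi)).2

/-! ### Counting zeros in an interval -/

/-- The zeros of `Q` in the open interval `(a, b)`, without multiplicity. -/
noncomputable def rootsIn (Q : ℝ[X]) (a b : ℝ) : Finset ℝ :=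
  open Classical in Q.roots.toFinset.filter (· ∈ Ioo a b)

theorem mem_rootsIn {Q : ℝ[X]} (hQ : Q ≠ 0) {a b x : ℝ} :
    x ∈ rootsIn Q a b ↔ Q.eval x = 0 ∧ x ∈ Ioo a b := by
  simp [rootsIn, hQ]

/-- Rolle's theorem, counted: between consecutive zeros of `Q` there is a zero of the derivative
that is not a zero of `Q`. -/
theorem card_rootsIn_le_sdiff {Q : ℝ[X]} (hQ : Q ≠ 0) (a b : ℝ) :
    (rootsIn Q a b).card ≤ (rootsIn (derivative Q) a b \ rootsIn Q a b).card + 1 := by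
  rcases eq_or_ne (derivative Q) 0 with h0 | h0
  · have : rootsIn Q a b = ∅ := by
      rw [eq_C_of_derivative_eq_zero h0]; simp [rootsIn]
    simp [this]
  · refine Finset.card_le_sdiff_of_interleaved fun x hx y hy hxy _ => ?_
    rw [mem_rootsIn hQ] at hx hy
    obtain ⟨z, hz, hz'⟩ := exists_deriv_eq_zero hxy Q.continuousOn (hx.1.trans hy.1.symm)
    rw [Polynomial.deriv] at hz'
    exact ⟨z, (mem_rootsIn h0).2 ⟨hz', hx.2.1.trans hz.1, hz.2.trans hy.2.2⟩, hz⟩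

/-- If the `m`-th derivative does not vanish in an interval, there are at most `m` zeros in it. -/
theorem card_rootsIn_le {Q : ℝ[X]} {a b : ℝ} {m : ℕ} (hab : a < b)
    (h : ∀ x ∈ Ioo a b, (derivative^[m] Q).eval x ≠ 0) : (rootsIn Q a b).card ≤ m := by
  induction m generalizing Q with
  | zero =>
    simp only [nonpos_iff_eq_zero, Finset.card_eq_zero, Finset.eq_empty_iff_forall_notMem]
    intro x hx
    by_cases hQ : Q = 0
    · simp [rootsIn, hQ] at hx
    · rw [mem_rootsIn hQ] at hx
      exact h x hx.2 hx.1
  | succ m ih =>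
    have hQ : Q ≠ 0 := by
      rintro rfl
      obtain ⟨x, hx⟩ := nonempty_Ioo.2 hab
      exact h x hx (by simp)
    have h1 := ih (Q := derivative Q) h
    have h2 := card_rootsIn_le_sdiff hQ a b
    have h3 := Finset.card_le_card
      (Finset.sdiff_subset (s := rootsIn (derivative Q) a b) (t := rootsIn Q a b))
    omega

/-- If the bound `m` of `card_rootsIn_le` is attained, all the zeros are simple. -/
theorem eval_derivative_ne_zero_of_card_rootsIn {Q : ℝ[X]} {a b : ℝ} {m : ℕ} (hab : a < b)
    (h : ∀ x ∈ Ioo a b, (derivative^[m] Q).eval x ≠ 0) (hm : m ≤ (rootsIn Q a b).card)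
    {x : ℝ} (hx : x ∈ Ioo a b) (h0 : Q.eval x = 0) : (derivative Q).eval x ≠ 0 := by
  intro h1
  obtain ⟨k, rfl⟩ : ∃ k, m = k + 1 := by
    refine Nat.exists_eq_succ_of_ne_zero ?_
    rintro rfl
    exact h x hx h0
  obtain ⟨y, hy⟩ := nonempty_Ioo.2 hab
  have hQ : Q ≠ 0 := by rintro rfl; exact h y hy (by simp)
  have hQ' : derivative Q ≠ 0 := by
    intro hc; apply h y hy; rw [Function.iterate_succ_apply, hc]; simp
  have h2 := card_rootsIn_le (Q := derivative Q) hab h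
  have h3 := card_rootsIn_le_sdiff hQ a b
  have h4 : (rootsIn (derivative Q) a b \ rootsIn Q a b).card
      < (rootsIn (derivative Q) a b).card := by
    refine Finset.card_lt_card ⟨Finset.sdiff_subset, fun hc => ?_⟩
    have := hc ((mem_rootsIn hQ').2 ⟨h1, hx⟩)
    exact (Finset.mem_sdiff.1 this).2 ((mem_rootsIn hQ).2 ⟨h0, hx⟩)
  omega

theorem Alternates.le_card_rootsIn {Q : ℝ[X]} (hQ : Q ≠ 0) {a b s : ℝ} {m : ℕ} {ξ : ℕ → ℝ}
    (h : Alternates (fun x => Q.eval x) m s ξ) (hξ : ∀ i ≤ m, ξ i ∈ Ioo a b) :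
    m ≤ (rootsIn Q a b).card := by
  have h1 : ∀ i, ∃ c, i < m → c ∈ Ioo (ξ i) (ξ (i + 1)) ∧ Q.eval c = 0 := by
    intro i
    by_cases hi : i < m
    · obtain ⟨c, hc, h0, -⟩ := h.exists_zero (fun x => Q.hasDerivAt x) hi
      exact ⟨c, fun _ => ⟨hc, h0⟩⟩
    · exact ⟨0, fun h => absurd h hi⟩
  choose η hη using h1
  have hlt : ∀ i j, i < j → j < m → η i < η j := by
    intro i j hij hj
    have h2 : ξ (i + 1) ≤ ξ j := by
      rcases eq_or_lt_of_le (Nat.succ_le_of_lt hij) with h3 | h3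
      · exact le_of_eq (congrArg ξ h3)
      · exact (lt_of_forall_lt_succ h.1 h3 hj.le).le
    exact (hη i (hij.trans hj)).1.2.trans_le (h2.trans (hη j hj).1.1.le)
  have := Finset.card_le_card_of_injOn (s := Finset.range m) (t := rootsIn Q a b) η ?_ ?_
  · simpa using this
  · intro i hi
    have hi' : i < m := by simpa using hi
    refine (mem_rootsIn hQ).2 ⟨(hη i hi').2, ?_, ?_⟩
    · exact (hξ i hi'.le).1.trans (hη i hi').1.1
    · exact (hη i hi').1.2.trans (hξ (i + 1) hi').2
  · intro i hi j hj hij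
    have hi' : i < m := by simpa using hi
    have hj' : j < m := by simpa using hj
    rcases lt_trichotomy i j with h2 | h2 | h2
    · exact absurd hij (hlt i j h2 hj').ne
    · exact h2
    · exact absurd hij (hlt j i h2 hi').ne'

/-! ### The sign just after a zero -/

theorem derivative_X_pow_succ_mul (m : ℕ) (R : ℝ[X]) :
    derivative (X ^ (m + 1) * R) = X ^ m * (C ((m : ℝ) + 1) * R + X * derivative R) := by
  rw [derivative_mul, derivative_X_pow]; simp; ring

theorem eval_iterate_derivative_X_pow_mul_ne_zero (m : ℕ) {R : ℝ[X]} (hR : R.eval 0 ≠ 0) :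
    (derivative^[m] (X ^ m * R)).eval 0 ≠ 0 := by
  induction m generalizing R with
  | zero => simpa using hR
  | succ m ih =>
    rw [Function.iterate_succ_apply, derivative_X_pow_succ_mul]
    apply ih
    have : (m : ℝ) + 1 ≠ 0 := by positivity
    simp [hR, this]

/-- After a zero of even order `m` the evolution is positive near the zero, and after one of odd
order its derivative is. The two claims alternate in an induction on `m`: the derivative lowers the
order by one, and if `∂ₓ²` is positive then the heat equation makes the evolution increase from its
nonnegative initial values. -/
theorem forward_pos (m : ℕ) {R : ℝ[X]} (hR : 0 < R.eval 0) :
    (Even m → ∀ᶠ z : ℝ × ℝ in 𝓝 (0, 0), 0 < z.2 → 0 < ev (X ^ m * R) z.1 z.2) ∧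
    (Odd m → ∀ᶠ z : ℝ × ℝ in 𝓝 (0, 0), 0 < z.2 →
      0 < ev (derivative (X ^ m * R)) z.1 z.2) := by
  induction m generalizing R with
  | zero =>
    refine ⟨fun _ => ?_, fun h => absurd h (by decide)⟩
    have h0 : 0 < ev (X ^ 0 * R) ((0, 0) : ℝ × ℝ).1 ((0, 0) : ℝ × ℝ).2 := by
      simpa [ev_zero_time] using hR
    filter_upwards [((continuous_ev (X ^ 0 * R)).tendsto (0, 0)).eventually_const_lt h0] with z hz _
      using hz
  | succ m ih =>
    have hR1 : 0 < (C ((m : ℝ) + 1) * R + X * derivative R).eval 0 := by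
      simp; positivity
    obtain ⟨ihe, iho⟩ := ih hR1
    rw [← derivative_X_pow_succ_mul] at ihe iho
    refine ⟨fun hm => ?_, fun hm => ihe (by simpa [parity_simps] using hm)⟩
    have h1 := iho (by simpa [parity_simps] using hm)
    have h2 : ∀ᶠ z : ℝ × ℝ in 𝓝 (0, 0), 0 < R.eval z.1 :=
      ((R.continuous.comp continuous_fst).tendsto ((0 : ℝ), (0 : ℝ))).eventually_const_lt hR
    obtain ⟨r, hr, hball⟩ := Metric.eventually_nhds_iff.1 (h1.and h2)
    refine Metric.eventually_nhds_iff.2 ⟨r, hr, fun z hz hz2 => ?_⟩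
    have hz' : |z.1| < r ∧ |z.2| < r := by
      simpa [Prod.dist_eq, Real.dist_eq] using hz
    have hmono : StrictMonoOn (fun s => ev (X ^ (m + 1) * R) z.1 s) (Icc 0 z.2) := by
      refine strictMonoOn_of_deriv_pos (convex_Icc _ _) ?_ ?_
      · exact fun s _ => (hasDerivAt_ev_right _ z.1 s).continuousAt.continuousWithinAt
      · intro s hs
        rw [interior_Icc] at hs
        rw [(hasDerivAt_ev_right _ z.1 s).deriv]
        have : |s| < r := by
          rw [abs_of_pos hs.1]; exact hs.2.trans (lt_of_abs_lt hz'.2)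
        have := (hball (y := (z.1, s)) (by
          simpa [Prod.dist_eq, Real.dist_eq] using ⟨hz'.1, this⟩)).1 hs.1
        simpa using this
    have h3 := hmono (left_mem_Icc.2 hz2.le) (right_mem_Icc.2 hz2.le) hz2
    refine lt_of_le_of_lt ?_ h3
    simp only [ev_zero_time, eval_mul, eval_pow, eval_X]
    exact mul_nonneg (hm.pow_nonneg _) (hball hz).2.le

theorem tendsto_shift (x₀ t₀ : ℝ) :
    Tendsto (fun z : ℝ × ℝ => (z.1 - x₀, z.2 - t₀)) (𝓝 (x₀, t₀)) (𝓝 (0, 0)) := by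
  have := (by fun_prop : Continuous fun z : ℝ × ℝ => (z.1 - x₀, z.2 - t₀)).tendsto (x₀, t₀)
  simpa using this

/-- Near and just after a point where the evolution vanishes to even order, it has a strict
sign. -/
theorem forward_even {P : ℝ[X]} (hP : P ≠ 0) {x₀ t₀ : ℝ} (hm : Even (mult P x₀ t₀)) :
    ∃ s : ℝ, ∀ᶠ z : ℝ × ℝ in 𝓝 (x₀, t₀), (t₀ < z.2 → 0 < s * ev P z.1 z.2) ∧
      (t₀ = z.2 → 0 ≤ s * ev P z.1 z.2) := by
  obtain ⟨R, hR0, hR⟩ := exists_shift_eq hP x₀ t₀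
  refine ⟨R.eval 0, ?_⟩
  have hpos : 0 < (C (R.eval 0) * R).eval 0 := by
    simpa using mul_self_pos.2 hR0
  have hR1 : ∀ x t, R.eval 0 * ev P x t =
      ev (X ^ mult P x₀ t₀ * (C (R.eval 0) * R)) (x - x₀) (t - t₀) := by
    intro x t
    have := ev_shift P x₀ t₀ (x - x₀) (t - t₀)
    rw [hR, sub_add_cancel, sub_add_cancel] at this
    rw [← this, mul_left_comm, ev, ev, heat_C_mul, eval_mul, eval_C]
  have h1 := (tendsto_shift x₀ t₀).eventually ((forward_pos (mult P x₀ t₀) hpos).1 hm)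
  have h2 : ∀ᶠ z : ℝ × ℝ in 𝓝 (0, 0), 0 < (C (R.eval 0) * R).eval z.1 :=
      (((C (R.eval 0) * R).continuous.comp continuous_fst).tendsto
        ((0 : ℝ), (0 : ℝ))).eventually_const_lt hpos
  filter_upwards [h1, (tendsto_shift x₀ t₀).eventually h2] with z hz1 hz2
  refine ⟨fun h => ?_, fun h => ?_⟩
  · rw [hR1]; exact hz1 (sub_pos.2 h)
  · rw [hR1, ← h, sub_self, ev_zero_time, eval_mul, eval_pow, eval_X]
    exact mul_nonneg (hm.pow_nonneg _) hz2.le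

/-- Near and just after a zero of odd order, the evolution is strictly monotone in space. -/
theorem forward_odd {P : ℝ[X]} (hP : P ≠ 0) {x₀ t₀ : ℝ} (hm : Odd (mult P x₀ t₀)) :
    ∀ᶠ z : ℝ × ℝ in 𝓝 (x₀, t₀), t₀ < z.2 → ev (derivative P) z.1 z.2 ≠ 0 := by
  have h0 : ev P x₀ t₀ = 0 := (mult_pos_iff hP).1 hm.pos
  have hP' : derivative P ≠ 0 := by
    intro h
    rw [eq_C_of_derivative_eq_zero h, ev_C] at h0
    apply hP; rw [eq_C_of_derivative_eq_zero h, h0, C_0]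
  have hm' : Even (mult (derivative P) x₀ t₀) := by
    rw [mult_derivative h0]
    obtain ⟨k, hk⟩ := hm
    exact ⟨k, by omega⟩
  obtain ⟨s, hs⟩ := forward_even hP' hm'
  filter_upwards [hs] with z hz h h'
  have := hz.1 h
  rw [h', mul_zero] at this
  exact this.false

theorem iterate_derivative_comp_X_add_C (Q : ℝ[X]) (a : ℝ) (k : ℕ) :
    derivative^[k] (Q.comp (X + C a)) = (derivative^[k] Q).comp (X + C a) := by
  induction k with
  | zero => rfl
  | succ k ih =>
    rw [Function.iterate_succ_apply', ih, derivative_comp, Function.iterate_succ_apply']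
    simp

/-! ### Zeros in a box around a zero -/

/-- A box `[x₀ - δ, x₀ + δ] × [t₀ - ε, t₀ + ε]` in which the zeros of the evolution of `P` are as
the multiplicity `m` of `(x₀, t₀)` dictates: no zeros on the vertical sides and no other zero at
time `t₀`; before `t₀` exactly `m` zeros, all simple; after `t₀` no zero for even `m`, and for odd
`m` a strictly monotone function with a change of sign. -/
structure IsBox (P : ℝ[X]) (x₀ t₀ δ ε : ℝ) : Prop where
  δ_pos : 0 < δ
  ε_pos : 0 < ε
  side_left : ∀ t, |t - t₀| ≤ ε → ev P (x₀ - δ) t ≠ 0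
  side_right : ∀ t, |t - t₀| ≤ ε → ev P (x₀ + δ) t ≠ 0
  center : ∀ x, |x - x₀| ≤ δ → ev P x t₀ = 0 → x = x₀
  back_card : ∀ t ∈ Ico (t₀ - ε) t₀, (rootsIn (heat t P) (x₀ - δ) (x₀ + δ)).card = mult P x₀ t₀
  back_simple : ∀ t ∈ Ico (t₀ - ε) t₀, ∀ x ∈ Ioo (x₀ - δ) (x₀ + δ), ev P x t = 0 →
    ev (derivative P) x t ≠ 0
  fwd_even : Even (mult P x₀ t₀) → ∀ t ∈ Ioc t₀ (t₀ + ε), ∀ x ∈ Icc (x₀ - δ) (x₀ + δ), ev P x t ≠ 0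
  fwd_odd : Odd (mult P x₀ t₀) → ∀ t ∈ Ioc t₀ (t₀ + ε), ∀ x ∈ Icc (x₀ - δ) (x₀ + δ),
    ev (derivative P) x t ≠ 0
  side_mul : Odd (mult P x₀ t₀) → ∀ t, |t - t₀| ≤ ε → ev P (x₀ - δ) t * ev P (x₀ + δ) t < 0

theorem IsBox.mono {P : ℝ[X]} {x₀ t₀ δ ε ε' : ℝ} (h : IsBox P x₀ t₀ δ ε) (h0 : 0 < ε')
    (hε : ε' ≤ ε) : IsBox P x₀ t₀ δ ε' where
  δ_pos := h.δ_pos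
  ε_pos := h0
  side_left t ht := h.side_left t (ht.trans hε)
  side_right t ht := h.side_right t (ht.trans hε)
  center := h.center
  back_card t ht := h.back_card t ⟨by linarith [ht.1], ht.2⟩
  back_simple t ht := h.back_simple t ⟨by linarith [ht.1], ht.2⟩
  fwd_even hm t ht := h.fwd_even hm t ⟨ht.1, by linarith [ht.2]⟩
  fwd_odd hm t ht := h.fwd_odd hm t ⟨ht.1, by linarith [ht.2]⟩
  side_mul hm t ht := h.side_mul hm t (ht.trans hε)

/-- Every point is the centre of arbitrarily small boxes. The number of zeros before `t₀` is at
least `m` by `eventually_exists_alternates` and at most `m` by `card_rootsIn_le`, which also makes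
them simple; what happens after `t₀` is `forward_even` and `forward_odd`. -/
theorem exists_isBox {P : ℝ[X]} (hP : P ≠ 0) (x₀ t₀ : ℝ) {δ₀ : ℝ} (hδ₀ : 0 < δ₀) :
    ∃ δ < δ₀, ∃ ε, IsBox P x₀ t₀ δ ε := by
  set m := mult P x₀ t₀ with hm
  obtain ⟨R, hR0, hR⟩ := exists_shift_eq hP x₀ t₀
  rw [← hm] at hR
  have hev : ∀ x, ev P x t₀ = (x - x₀) ^ m * R.eval (x - x₀) := by
    intro x
    have := ev_shift P x₀ t₀ (x - x₀) 0
    rw [hR, ev_zero_time, sub_add_cancel, zero_add] at this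
    simpa using this.symm
  have hD : ev (derivative^[m] P) x₀ t₀ ≠ 0 := by
    have h1 := eval_iterate_derivative_X_pow_mul_ne_zero m hR0
    rw [← hR, iterate_derivative_comp_X_add_C, iterate_derivative_heat] at h1
    simpa [ev] using h1
  have e1 : ∀ᶠ z : ℝ × ℝ in 𝓝 (x₀, t₀), ev (derivative^[m] P) z.1 z.2 ≠ 0 :=
    ((continuous_ev (derivative^[m] P)).tendsto (x₀, t₀)).eventually_ne hD
  have e2 : ∀ᶠ z : ℝ × ℝ in 𝓝 (x₀, t₀), Even m → t₀ < z.2 → ev P z.1 z.2 ≠ 0 := by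
    by_cases h : Even m
    · obtain ⟨s, hs⟩ := forward_even hP h
      filter_upwards [hs] with z hz _ h1 h2
      have := hz.1 h1
      rw [h2, mul_zero] at this
      exact this.false
    · simp [h]
  have e3 : ∀ᶠ z : ℝ × ℝ in 𝓝 (x₀, t₀), Odd m → t₀ < z.2 → ev (derivative P) z.1 z.2 ≠ 0 := by
    by_cases h : Odd m
    · filter_upwards [forward_odd hP h] with z hz _ using hz
    · simp [h]
  have e4 : ∀ᶠ z : ℝ × ℝ in 𝓝 (x₀, t₀), 0 < R.eval 0 * R.eval (z.1 - x₀) := by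
    have : Tendsto (fun z : ℝ × ℝ => R.eval 0 * R.eval (z.1 - x₀)) (𝓝 (x₀, t₀))
        (𝓝 (R.eval 0 * R.eval (x₀ - x₀))) :=
      (by fun_prop : Continuous fun z : ℝ × ℝ => R.eval 0 * R.eval (z.1 - x₀)).tendsto (x₀, t₀)
    refine this.eventually_const_lt ?_
    rw [sub_self]; exact mul_self_pos.2 hR0
  obtain ⟨r, hr, hball⟩ := Metric.eventually_nhds_iff.1 (e1.and (e2.and (e3.and e4)))
  replace hball : ∀ x t, |x - x₀| < r → |t - t₀| < r → _ := fun x t hx ht =>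
    hball (y := (x, t)) (by simpa [Prod.dist_eq, Real.dist_eq] using ⟨hx, ht⟩)
  set δ := min δ₀ r / 2 with hδ
  have hδ0 : 0 < δ := by positivity
  have hδ1 : δ < δ₀ := by have := min_le_left δ₀ r; linarith
  have hδr : δ < r := by have := min_le_right δ₀ r; linarith
  have hRδ : ∀ y, |y| ≤ δ → 0 < R.eval 0 * R.eval y := by
    intro y hy
    have := (hball (y + x₀) t₀ (by simpa using hy.trans_lt hδr) (by simpa using hr)).2.2.2
    simpa using this
  have hne : ∀ y, |y| ≤ δ → y ≠ 0 → ev P (x₀ + y) t₀ ≠ 0 := by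
    intro y hy h0
    rw [hev, add_sub_cancel_left]
    exact mul_ne_zero (pow_ne_zero _ h0)
      (fun h => by have := hRδ y hy; rw [h] at this; simp at this)
  have c1 : ∀ᶠ t in 𝓝 t₀, ev P (x₀ - δ) t ≠ 0 :=
    (hasDerivAt_ev_right P (x₀ - δ) t₀).continuousAt.eventually_ne
      (hne (-δ) (by rw [abs_neg, abs_of_pos hδ0]) (by linarith))
  have c2 : ∀ᶠ t in 𝓝 t₀, ev P (x₀ + δ) t ≠ 0 :=
    (hasDerivAt_ev_right P (x₀ + δ) t₀).continuousAt.eventually_ne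
      (hne δ (by rw [abs_of_pos hδ0]) (by linarith))
  have c3 : ∀ᶠ t in 𝓝 t₀, Odd m → ev P (x₀ - δ) t * ev P (x₀ + δ) t < 0 := by
    by_cases h : Odd m
    · have hc := (hasDerivAt_ev_right P (x₀ - δ) t₀).continuousAt.mul
        (hasDerivAt_ev_right P (x₀ + δ) t₀).continuousAt
      have h0 : ev P (x₀ - δ) t₀ * ev P (x₀ + δ) t₀ < 0 := by
        rw [hev, hev, add_sub_cancel_left, show x₀ - δ - x₀ = -δ by ring, h.neg_pow]
        have h1 := hRδ δ (by rw [abs_of_pos hδ0])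
        have h2 := hRδ (-δ) (by rw [abs_neg, abs_of_pos hδ0])
        have h3 : 0 < R.eval δ * R.eval (-δ) := by
          have : 0 < R.eval 0 * R.eval 0 := mul_self_pos.2 hR0
          have h4 := mul_pos h1 h2
          by_contra h5
          nlinarith
        have h4 := mul_pos (pow_pos (pow_pos hδ0 m) 2) h3
        nlinarith
      have := Filter.Tendsto.eventually_lt_const h0 hc
      filter_upwards [this] with t ht _ using ht
    · simp [h]
  have c4 := eventually_nhdsWithin_iff.1 (eventually_exists_alternates hP x₀ t₀ hδ0)
  obtain ⟨r', hr', hball'⟩ := Metric.eventually_nhds_iff.1 (c1.and (c2.and (c3.and c4)))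
  simp only [Real.dist_eq] at hball'
  set ε := min r r' / 2 with hε
  have hε0 : 0 < ε := by positivity
  have hεr : ε < r := by have := min_le_left r r'; linarith
  have hεr' : ε < r' := by have := min_le_right r r'; linarith
  have hx' : ∀ x ∈ Icc (x₀ - δ) (x₀ + δ), |x - x₀| < r := fun x hx =>
    (abs_le.2 ⟨by linarith [hx.1], by linarith [hx.2]⟩ : |x - x₀| ≤ δ).trans_lt hδr
  have hD' : ∀ t ∈ Ico (t₀ - ε) t₀, ∀ x ∈ Ioo (x₀ - δ) (x₀ + δ),
      (derivative^[m] (heat t P)).eval x ≠ 0 := by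
    intro t ht x hx
    rw [iterate_derivative_heat]
    refine (hball x t (hx' x (Ioo_subset_Icc_self hx)) ?_).1
    rw [abs_lt]; constructor <;> linarith [ht.1, ht.2]
  have hcard : ∀ t ∈ Ico (t₀ - ε) t₀, m ≤ (rootsIn (heat t P) (x₀ - δ) (x₀ + δ)).card := by
    intro t ht
    obtain ⟨s, ξ, hξ, hξ'⟩ := (hball' (y := t)
      (by rw [abs_lt]; constructor <;> linarith [ht.1, ht.2])).2.2.2 ht.2
    refine hξ.le_card_rootsIn (heat_ne_zero hP t) fun i hi => ?_
    have := abs_lt.1 (hξ' i hi)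
    constructor <;> linarith [this.1, this.2]
  have hlt : x₀ - δ < x₀ + δ := by linarith
  refine ⟨δ, hδ1, ε, hδ0, hε0, fun t ht => (hball' (ht.trans_lt hεr')).1,
    fun t ht => (hball' (ht.trans_lt hεr')).2.1, fun x hx h => ?_, fun t ht => ?_,
    fun t ht x hx h => ?_, fun h t ht x hx => ?_, fun h t ht x hx => ?_,
    fun h t ht => (hball' (ht.trans_lt hεr')).2.2.1 h⟩
  · by_contra hne'
    exact hne (x - x₀) hx (sub_ne_zero.2 hne') (by rwa [add_sub_cancel])
  · exact le_antisymm (card_rootsIn_le hlt (hD' t ht)) (hcard t ht)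
  · have := eval_derivative_ne_zero_of_card_rootsIn hlt (hD' t ht) (hcard t ht) hx h
    rwa [derivative_heat] at this
  · exact (hball x t (hx' x hx) (by rw [abs_lt]; constructor <;> linarith [ht.1, ht.2])).2.1 h ht.1
  · exact (hball x t (hx' x hx)
      (by rw [abs_lt]; constructor <;> linarith [ht.1, ht.2])).2.2.1 h ht.1

/-! ### Zeros at nearby times -/

/-- At times close to `t₀` all zeros are close to the zeros at time `t₀`. -/
theorem eventually_zeros_close {P : ℝ[X]} (hP : P ≠ 0) (t₀ : ℝ) {δ : ℝ → ℝ} (hδ : ∀ y, 0 < δ y) :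
    ∀ᶠ t in 𝓝 t₀, ∀ x, ev P x t = 0 → ∃ y, ev P y t₀ = 0 ∧ |x - y| < δ y := by
  obtain ⟨B, hB, hroot⟩ := exists_root_bound hP (t₀ - 1) (t₀ + 1)
  set U : Set ℝ := ⋃ y ∈ {y | ev P y t₀ = 0}, Metric.ball y (δ y) with hU
  have hUo : IsOpen U := isOpen_biUnion fun _ _ => Metric.isOpen_ball
  have hK : IsCompact (Icc (-B) B \ U) := isCompact_Icc.diff hUo
  have h2 : ∀ᶠ t in 𝓝 t₀, ∀ x ∈ Icc (-B) B \ U, ev P x t ≠ 0 :=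
    hK.eventually_forall_of_forall_eventually fun x hx =>
      (((continuous_ev P).comp continuous_swap).tendsto (t₀, x)).eventually_ne fun h =>
        hx.2 (mem_biUnion (x := x) h (Metric.mem_ball_self (hδ x)))
  filter_upwards [h2, Icc_mem_nhds (sub_one_lt t₀) (lt_add_one t₀)] with t ht htI x hx
  have hxB := abs_lt.1 (hroot t htI x hx)
  by_contra hcon
  refine ht x ⟨⟨hxB.1.le, hxB.2.le⟩, fun hxU => hcon ?_⟩ hx
  simpa [hU, Real.dist_eq] using hxU

/-! ### Induction along a real interval -/

/-- Induction along `[a, b]`: a property that holds at `a`, that passes from `t` to all slightly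
later times, and that passes to limits from the left, holds throughout. -/
theorem real_induction {a b : ℝ} {p : ℝ → Prop} (ha : p a)
    (hr : ∀ t ∈ Ico a b, p t → ∀ᶠ s in 𝓝[>] t, p s)
    (hl : ∀ t ∈ Ioc a b, (∀ s ∈ Ico a t, p s) → p t) : ∀ t ∈ Icc a b, p t := by
  intro t₁ ht₁
  set S : Set ℝ := {t | t ∈ Icc a b ∧ ∀ s ∈ Icc a t, p s} with hS
  have hab : a ≤ b := ht₁.1.trans ht₁.2
  have haS : a ∈ S := ⟨left_mem_Icc.2 hab, fun s hs => by
    rw [le_antisymm hs.2 hs.1]; exact ha⟩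
  have hbdd : BddAbove S := ⟨b, fun t ht => ht.1.2⟩
  set c := sSup S with hc
  have hac : a ≤ c := le_csSup hbdd haS
  have hcb : c ≤ b := csSup_le ⟨a, haS⟩ fun t ht => ht.1.2
  have hlt : ∀ s ∈ Ico a c, p s := by
    intro s hs
    obtain ⟨t, ht, hst⟩ := exists_lt_of_lt_csSup ⟨a, haS⟩ hs.2
    exact ht.2 s ⟨hs.1, hst.le⟩
  have hpc : p c := by
    rcases eq_or_lt_of_le hac with h | h
    · rw [← h]; exact ha
    · exact hl c ⟨h, hcb⟩ hlt
  have hle : ∀ s ∈ Icc a c, p s := by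
    intro s hs
    rcases eq_or_lt_of_le hs.2 with h | h
    · rw [h]; exact hpc
    · exact hlt s ⟨hs.1, h⟩
  rcases eq_or_lt_of_le hcb with h | h
  · exact hle t₁ ⟨ht₁.1, h ▸ ht₁.2⟩
  · exfalso
    obtain ⟨d, hd, hcd⟩ := (mem_nhdsGT_iff_exists_Ioo_subset' h).1 (hr c ⟨hac, h⟩ hpc)
    obtain ⟨e, he1, he2⟩ := exists_between (lt_min (show c < d from hd) h)
    have : e ∈ S := by
      refine ⟨⟨hac.trans he1.le, (he2.trans_le (min_le_right _ _)).le⟩, fun s hs => ?_⟩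
      rcases le_or_gt s c with h' | h'
      · exact hle s ⟨hs.1, h'⟩
      · exact hcd ⟨h', hs.2.trans_lt (he2.trans_le (min_le_left _ _))⟩
    exact absurd (le_csSup hbdd this) (not_le.2 he1)

/-- Induction along `[a, b]`, backwards from `b`. -/
theorem real_induction_down {a b : ℝ} {p : ℝ → Prop} (hb : p b)
    (hr : ∀ t ∈ Ioc a b, p t → ∀ᶠ s in 𝓝[<] t, p s)
    (hl : ∀ t ∈ Ico a b, (∀ s ∈ Ioc t b, p s) → p t) : ∀ t ∈ Icc a b, p t := by
  intro t ht
  have h := real_induction (a := -b) (b := -a) (p := fun t => p (-t)) (by simpa using hb)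
    (fun t ht h => tendsto_neg_nhdsGT.eventually
      (hr (-t) ⟨by linarith [ht.2], by linarith [ht.1]⟩ h))
    (fun t ht h => hl (-t) ⟨by linarith [ht.2], by linarith [ht.1]⟩ fun s hs => by
      simpa using h (-s) ⟨by linarith [hs.2], by linarith [hs.1]⟩)
    (-t) ⟨by linarith [ht.2], by linarith [ht.1]⟩
  simpa using h

/-! ### Counting multiple zeros -/

/-- `(x, t)` is a multiple zero of the evolution of `P`. -/
def IsCrit (P : ℝ[X]) (x t : ℝ) : Prop := ev P x t = 0 ∧ ev (derivative P) x t = 0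

theorem derivative_ne_zero_of_zero {P : ℝ[X]} (hP : P ≠ 0) {x t : ℝ} (h : ev P x t = 0) :
    derivative P ≠ 0 := by
  intro h0
  rw [eq_C_of_derivative_eq_zero h0, ev_C] at h
  apply hP; rw [eq_C_of_derivative_eq_zero h0, h, C_0]

theorem isCrit_iff {P : ℝ[X]} (hP : P ≠ 0) {x t : ℝ} : IsCrit P x t ↔ 2 ≤ mult P x t := by
  constructor
  · intro ⟨h1, h2⟩
    have h3 := (mult_pos_iff (derivative_ne_zero_of_zero hP h1)).2 h2
    rw [mult_derivative h1] at h3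
    omega
  · intro h
    have h1 : ev P x t = 0 := (mult_pos_iff hP).1 (by omega)
    refine ⟨h1, (mult_pos_iff (derivative_ne_zero_of_zero hP h1)).1 ?_⟩
    rw [mult_derivative h1]
    omega

theorem mult_eq_one {P : ℝ[X]} (hP : P ≠ 0) {x t : ℝ} (h1 : ev P x t = 0)
    (h2 : ev (derivative P) x t ≠ 0) : mult P x t = 1 := by
  have h3 := (mult_pos_iff hP).2 h1
  have h4 := mt (isCrit_iff hP).2 fun h => h2 h.2
  omega

/-- After `t₀` a box contains at most one zero. -/
theorem IsBox.eq_of_fwd {P : ℝ[X]} {x₀ t₀ δ ε t x y : ℝ} (h : IsBox P x₀ t₀ δ ε)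
    (ht : t ∈ Ioc t₀ (t₀ + ε)) (hx : x ∈ Ioo (x₀ - δ) (x₀ + δ)) (hy : y ∈ Ioo (x₀ - δ) (x₀ + δ))
    (hx0 : ev P x t = 0) (hy0 : ev P y t = 0) : x = y := by
  rcases Nat.even_or_odd (mult P x₀ t₀) with hm | hm
  · exact absurd hx0 (h.fwd_even hm t ht x (Ioo_subset_Icc_self hx))
  · by_contra hne
    wlog hxy : x < y generalizing x y
    · exact this hy hx hy0 hx0 (Ne.symm hne) (lt_of_le_of_ne (not_lt.1 hxy) (Ne.symm hne))
    obtain ⟨z, hz, hz'⟩ := exists_hasDerivAt_eq_zero hxy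
      (fun z _ => (hasDerivAt_ev_left P z t).continuousAt.continuousWithinAt) (hx0.trans hy0.symm)
      (fun z _ => hasDerivAt_ev_left P z t)
    exact h.fwd_odd hm t ht z ⟨(hx.1.trans hz.1).le, (hz.2.trans hy.2).le⟩ hz'

theorem IsBox.simple_fwd {P : ℝ[X]} {x₀ t₀ δ ε t x : ℝ} (h : IsBox P x₀ t₀ δ ε)
    (ht : t ∈ Ioc t₀ (t₀ + ε)) (hx : x ∈ Ioo (x₀ - δ) (x₀ + δ)) (hx0 : ev P x t = 0) :
    Odd (mult P x₀ t₀) ∧ ev (derivative P) x t ≠ 0 := by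
  rcases Nat.even_or_odd (mult P x₀ t₀) with hm | hm
  · exact absurd hx0 (h.fwd_even hm t ht x (Ioo_subset_Icc_self hx))
  · exact ⟨hm, h.fwd_odd hm t ht x (Ioo_subset_Icc_self hx)⟩

/-- Finitely many pairwise disjoint boxes of a common height contain all zeros at times close
to `t₀`. -/
theorem exists_box_cover {P : ℝ[X]} (hP : P ≠ 0) (t₀ : ℝ) :
    ∃ (δ : ℝ → ℝ) (ε : ℝ), 0 < ε ∧
      (∀ y ∈ (heat t₀ P).roots.toFinset, IsBox P y t₀ (δ y) ε) ∧
      (∀ y ∈ (heat t₀ P).roots.toFinset, ∀ z ∈ (heat t₀ P).roots.toFinset, y ≠ z →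
        Disjoint (Ioo (y - δ y) (y + δ y)) (Ioo (z - δ z) (z + δ z))) ∧
      ∀ t, |t - t₀| ≤ ε → ∀ x, ev P x t = 0 →
        ∃ y ∈ (heat t₀ P).roots.toFinset, x ∈ Ioo (y - δ y) (y + δ y) := by
  set S := (heat t₀ P).roots.toFinset with hS
  have hmem : ∀ y, y ∈ S ↔ ev P y t₀ = 0 := fun y => by
    simp [hS, heat_ne_zero hP, ev]
  obtain ⟨d, hd, hsep⟩ : ∃ d > 0, ∀ y ∈ S, ∀ z ∈ S, y ≠ z → d ≤ |y - z| := by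
    have : ∀ᶠ d : ℝ in 𝓝[>] 0, ∀ y ∈ S, ∀ z ∈ S, y ≠ z → d ≤ |y - z| := by
      refine (Filter.eventually_all_finset _).2 fun y _ => (Filter.eventually_all_finset _).2
        fun z _ => ?_
      by_cases h : y = z
      · simp [h]
      · have : 0 < |y - z| := abs_pos.2 (sub_ne_zero.2 h)
        filter_upwards [nhdsWithin_le_nhds (Iio_mem_nhds this)] with d hd _ using le_of_lt hd
    obtain ⟨d, hd1, hd2⟩ := (this.and self_mem_nhdsWithin).exists
    exact ⟨d, hd2, hd1⟩
  choose δ hδ ε hbox using fun y => exists_isBox hP y t₀ (half_pos hd)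
  have h1 := eventually_zeros_close hP t₀ (δ := δ) fun y => (hbox y).δ_pos
  obtain ⟨r, hr, hball⟩ := Metric.eventually_nhds_iff.1 h1
  have h2 : ∀ᶠ e : ℝ in 𝓝[>] 0, ∀ y ∈ S, e ≤ ε y :=
    (Filter.eventually_all_finset _).2 fun y _ => by
      filter_upwards [nhdsWithin_le_nhds (Iio_mem_nhds (hbox y).ε_pos)] with d hd using le_of_lt hd
  have h3 : ∀ᶠ e : ℝ in 𝓝[>] 0, e ∈ Ioo 0 r := Ioo_mem_nhdsGT hr
  obtain ⟨e, he1, he3, he2⟩ := (h2.and h3).exists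
  refine ⟨δ, e, he3, fun y hy => (hbox y).mono he3 (he1 y hy), fun y hy z hz hne => ?_, ?_⟩
  · rw [Set.disjoint_left]
    intro x hx hx'
    have := hsep y hy z hz hne
    have h3 := hδ y
    have h4 := hδ z
    rcases abs_cases (y - z) with ⟨h5, -⟩ | ⟨h5, -⟩ <;> linarith [hx.1, hx.2, hx'.1, hx'.2]
  · intro t ht x hx
    obtain ⟨y, hy, hxy⟩ := hball (y := t) (by rw [Real.dist_eq]; exact ht.trans_lt he2) x hx
    have := abs_lt.1 hxy
    exact ⟨y, (hmem y).2 hy, by linarith [this.1], by linarith [this.2]⟩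

theorem card_roots_eq_sum (P : ℝ[X]) (t : ℝ) :
    (heat t P).roots.card = ∑ y ∈ (heat t P).roots.toFinset, mult P y t := by
  rw [← Multiset.toFinset_sum_count_eq]
  simp [mult]

/-- The number of zeros, with multiplicity, does not jump up at `t₀`, and just after `t₀` it has
dropped by at least twice the number of multiple zeros at time `t₀`. -/
theorem card_roots_near {P : ℝ[X]} (hP : P ≠ 0) (t₀ : ℝ) :
    ∃ ε > 0, (∀ t ∈ Ico (t₀ - ε) t₀, (heat t₀ P).roots.card ≤ (heat t P).roots.card) ∧
      ∀ t ∈ Ioc t₀ (t₀ + ε), (∀ x, ¬ IsCrit P x t) ∧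
        ∀ F : Finset ℝ, (∀ x ∈ F, IsCrit P x t₀) →
          (heat t P).roots.card + 2 * F.card ≤ (heat t₀ P).roots.card := by
  obtain ⟨δ, ε, hε, hbox, hdisj, hcover⟩ := exists_box_cover hP t₀
  set S := (heat t₀ P).roots.toFinset with hS
  have hdis : ∀ t, (S : Set ℝ).PairwiseDisjoint
      fun y => rootsIn (heat t P) (y - δ y) (y + δ y) := by
    intro t y hy z hz hne
    rw [Function.onFun, Finset.disjoint_left]
    intro x hx hx'
    exact Set.disjoint_left.1 (hdisj y hy z hz hne) ((mem_rootsIn (heat_ne_zero hP t)).1 hx).2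
      ((mem_rootsIn (heat_ne_zero hP t)).1 hx').2
  refine ⟨ε, hε, fun t ht => ?_, fun t ht => ?_⟩
  · rw [card_roots_eq_sum, ← hS, ← Finset.sum_congr rfl fun y hy => (hbox y hy).back_card t ht,
      ← Finset.card_biUnion fun x hx y hy hne => hdis t hx hy hne]
    refine (Finset.card_le_card fun x hx => ?_).trans (Multiset.toFinset_card_le _)
    obtain ⟨y, hy, hxy⟩ := Finset.mem_biUnion.1 hx
    rw [Multiset.mem_toFinset, mem_roots (heat_ne_zero hP t)]
    exact ((mem_rootsIn (heat_ne_zero hP t)).1 hxy).1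
  · have habs : |t - t₀| ≤ ε := by rw [abs_of_pos (by linarith [ht.1])]; linarith [ht.2]
    have hsimple : ∀ x, ev P x t = 0 → ev (derivative P) x t ≠ 0 := by
      intro x hx
      obtain ⟨y, hy, hxy⟩ := hcover t habs x hx
      exact ((hbox y hy).simple_fwd ht hxy hx).2
    refine ⟨fun x hx => hsimple x hx.1 hx.2, fun F hF => ?_⟩
    have h1 : (heat t P).roots.card = (heat t P).roots.toFinset.card := by
      rw [card_roots_eq_sum, Finset.card_eq_sum_ones]
      refine Finset.sum_congr rfl fun x hx => ?_
      rw [Multiset.mem_toFinset, mem_roots (heat_ne_zero hP t)] at hx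
      exact mult_eq_one hP hx (hsimple x hx)
    have h2 : (heat t P).roots.toFinset.card ≤ ∑ y ∈ S, mult P y t₀ % 2 := by
      refine (Finset.card_le_card (t := S.biUnion
        fun y => rootsIn (heat t P) (y - δ y) (y + δ y)) fun x hx => ?_).trans ?_
      · rw [Multiset.mem_toFinset, mem_roots (heat_ne_zero hP t)] at hx
        obtain ⟨y, hy, hxy⟩ := hcover t habs x hx
        exact Finset.mem_biUnion.2 ⟨y, hy, (mem_rootsIn (heat_ne_zero hP t)).2 ⟨hx, hxy⟩⟩
      · refine Finset.card_biUnion_le.trans (Finset.sum_le_sum fun y hy => ?_)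
        rcases Finset.eq_empty_or_nonempty (rootsIn (heat t P) (y - δ y) (y + δ y)) with h | ⟨x, hx⟩
        · simp [h]
        · have hx' := (mem_rootsIn (heat_ne_zero hP t)).1 hx
          rw [Nat.odd_iff.1 ((hbox y hy).simple_fwd ht hx'.2 hx'.1).1, Finset.card_le_one]
          intro u hu v hv
          have hu' := (mem_rootsIn (heat_ne_zero hP t)).1 hu
          have hv' := (mem_rootsIn (heat_ne_zero hP t)).1 hv
          exact (hbox y hy).eq_of_fwd ht hu'.2 hv'.2 hu'.1 hv'.1
    have hFS : F ⊆ S := fun x hx => by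
      rw [hS, Multiset.mem_toFinset, mem_roots (heat_ne_zero hP t₀)]; exact (hF x hx).1
    have h3 : 2 * F.card = ∑ y ∈ S, if y ∈ F then 2 else 0 := by
      rw [← Finset.sum_filter, Finset.filter_mem_eq_inter, Finset.inter_eq_right.2 hFS]
      simp [mul_comm]
    rw [h1, h3, card_roots_eq_sum, ← hS]
    calc _ ≤ ∑ y ∈ S, mult P y t₀ % 2 + ∑ y ∈ S, (if y ∈ F then 2 else 0) := by gcongr
      _ = ∑ y ∈ S, (mult P y t₀ % 2 + if y ∈ F then 2 else 0) := by rw [Finset.sum_add_distrib]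
      _ ≤ _ := by
        refine Finset.sum_le_sum fun y hy => ?_
        split_ifs with h
        · have := (isCrit_iff hP).1 (hF y h)
          omega
        · omega

/-- Every multiple zero costs two of the at most `natDegree P` real zeros. -/
theorem two_mul_card_crit_le {P : ℝ[X]} (hP : P ≠ 0) (a : ℝ) (F : Finset (ℝ × ℝ))
    (hF : ∀ z ∈ F, IsCrit P z.1 z.2 ∧ a ≤ z.2) : 2 * F.card ≤ P.natDegree := by
  have hab : ∃ b, a ≤ b ∧ ∀ z ∈ F, z.2 < b := by
    have : ∀ᶠ b : ℝ in atTop, ∀ z ∈ F, z.2 < b :=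
      (Filter.eventually_all_finset _).2 fun z _ => eventually_gt_atTop _
    exact ((eventually_ge_atTop a).and this).exists
  obtain ⟨b, hab, hb⟩ := hab
  suffices h : ∀ t ∈ Icc a b, ∀ F : Finset (ℝ × ℝ), (∀ z ∈ F, IsCrit P z.1 z.2 ∧ z.2 ∈ Ico a t) →
      (heat t P).roots.card + 2 * F.card ≤ P.natDegree by
    have := h b (right_mem_Icc.2 hab) F fun z hz => ⟨(hF z hz).1, (hF z hz).2, hb z hz⟩
    omega
  refine real_induction ?_ ?_ ?_
  · intro F hF
    have : F = ∅ := Finset.eq_empty_of_forall_notMem fun z hz => by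
      have := (hF z hz).2; rw [Ico_self] at this; exact this
    rw [this, Finset.card_empty, mul_zero, add_zero, ← natDegree_heat a P]
    exact card_roots' _
  · intro t ht ih
    obtain ⟨ε, hε, -, hε'⟩ := card_roots_near hP t
    filter_upwards [Ioc_mem_nhdsGT (show t < t + ε by linarith)] with s hs F hF
    classical
    have h1 := ih (F.filter fun z => z.2 < t) fun z hz => by
      rw [Finset.mem_filter] at hz
      exact ⟨(hF z hz.1).1, (hF z hz.1).2.1, hz.2⟩
    have heq : ∀ z ∈ F.filter fun z => ¬ z.2 < t, z.2 = t := by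
      intro z hz
      rw [Finset.mem_filter] at hz
      by_contra hne
      have h2 : t < z.2 := lt_of_le_of_ne (not_lt.1 hz.2) (Ne.symm hne)
      exact (hε' z.2 ⟨h2, (hF z hz.1).2.2.le.trans hs.2⟩).1 z.1 (hF z hz.1).1
    have h2 := (hε' s hs).2 ((F.filter fun z => ¬ z.2 < t).image Prod.fst) fun x hx => by
      obtain ⟨z, hz, rfl⟩ := Finset.mem_image.1 hx
      have := (hF z (Finset.mem_filter.1 hz).1).1
      rwa [heq z hz] at this
    rw [Finset.card_image_of_injOn (fun z hz w hw h => Prod.ext h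
      ((heq z hz).trans (heq w hw).symm))] at h2
    have h3 := Finset.card_filter_add_card_filter_not (s := F) (fun z => z.2 < t)
    omega
  · intro t ht ih F hF
    obtain ⟨ε, hε, hε', -⟩ := card_roots_near hP t
    have h1 : ∀ᶠ s in 𝓝[<] t, ∀ z ∈ F, z.2 < s :=
      (Filter.eventually_all_finset _).2 fun z hz =>
        nhdsWithin_le_nhds (Ioi_mem_nhds (hF z hz).2.2)
    have h2 : ∀ᶠ s in 𝓝[<] t, s ∈ Ico (t - ε) t := Ico_mem_nhdsLT (by linarith)
    have h3 : ∀ᶠ s in 𝓝[<] t, s ∈ Ico a t := Ico_mem_nhdsLT ht.1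
    obtain ⟨s, hs1, hs2, hs3⟩ := (h1.and (h2.and h3)).exists
    have h2 := ih s hs3 F fun z hz => ⟨(hF z hz).1, (hF z hz).2.1, hs1 z hz⟩
    have h3 := hε' s hs2
    omega

theorem finite_crit {P : ℝ[X]} (hP : P ≠ 0) (a : ℝ) :
    {z : ℝ × ℝ | IsCrit P z.1 z.2 ∧ a ≤ z.2}.Finite := by
  by_contra h
  obtain ⟨F, hF, hc⟩ := Set.Infinite.exists_subset_card_eq h (P.natDegree + 1)
  have := two_mul_card_crit_le hP a F fun z hz => hF hz
  omega

/-! ### Curves of zeros -/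

/-- A continuous curve of zeros of the evolution of `P` over the time interval `[a, b]`. -/
structure IsRootCurve (P : ℝ[X]) (a b : ℝ) (x : ℝ → ℝ) : Prop where
  cont : ContinuousOn x (Icc a b)
  root : ∀ t ∈ Icc a b, ev P (x t) t = 0

theorem IsRootCurve.mono {P : ℝ[X]} {a b a' b' : ℝ} {x : ℝ → ℝ} (h : IsRootCurve P a b x)
    (ha : a ≤ a') (hb : b' ≤ b) : IsRootCurve P a' b' x :=
  ⟨h.cont.mono (Icc_subset_Icc ha hb), fun t ht => h.root t (Icc_subset_Icc ha hb ht)⟩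

theorem IsRootCurve.congr {P : ℝ[X]} {a b : ℝ} {x y : ℝ → ℝ} (h : IsRootCurve P a b x)
    (hxy : ∀ t ∈ Icc a b, y t = x t) : IsRootCurve P a b y :=
  ⟨h.cont.congr hxy, fun t ht => by rw [hxy t ht]; exact h.root t ht⟩

theorem isRootCurve_const {P : ℝ[X]} {x a : ℝ} (h : ev P x a = 0) :
    IsRootCurve P a a fun _ => x :=
  ⟨continuousOn_const, fun t ht => by rw [le_antisymm ht.2 ht.1]; exact h⟩

theorem IsRootCurve.concat {P : ℝ[X]} {a b c : ℝ} {x y : ℝ → ℝ} (hab : a ≤ b) (hbc : b ≤ c)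
    (hx : IsRootCurve P a b x) (hy : IsRootCurve P b c y) (h : x b = y b) :
    IsRootCurve P a c fun t => if t ≤ b then x t else y t := by
  have e1 : ∀ t ∈ Icc a b, (if t ≤ b then x t else y t) = x t := fun t ht => if_pos ht.2
  have e2 : ∀ t ∈ Icc b c, (if t ≤ b then x t else y t) = y t := by
    intro t ht
    rcases eq_or_lt_of_le ht.1 with rfl | h'
    · simpa using h
    · exact if_neg (not_le.2 h')
  have h1 := hx.congr e1
  have h2 := hy.congr e2
  refine ⟨?_, fun t ht => ?_⟩
  · rw [← Icc_union_Icc_eq_Icc hab hbc]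
    exact h1.cont.union_of_isClosed h2.cont isClosed_Icc isClosed_Icc
  · rcases le_total t b with h' | h'
    · exact h1.root t ⟨ht.1, h'⟩
    · exact h2.root t ⟨h', ht.2⟩

theorem pos_of_ne_zero_of_isPreconnected {S : Set ℝ} (hS : IsPreconnected S) {g : ℝ → ℝ}
    (hg : ContinuousOn g S) (h0 : ∀ t ∈ S, g t ≠ 0) {s t : ℝ} (hs : s ∈ S) (ht : t ∈ S)
    (hpos : 0 < g s) : 0 < g t := by
  by_contra h
  obtain ⟨r, hr, hr0⟩ := hS.intermediate_value ht hs hg ⟨not_lt.1 h, hpos.le⟩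
  exact h0 r hr hr0

theorem lt_of_ne_of_isPreconnected {S : Set ℝ} (hS : IsPreconnected S) {x y : ℝ → ℝ}
    (hx : ContinuousOn x S) (hy : ContinuousOn y S) (h0 : ∀ t ∈ S, x t ≠ y t) {s t : ℝ}
    (hs : s ∈ S) (ht : t ∈ S) (hlt : x s < y s) : x t < y t :=
  sub_pos.1 (pos_of_ne_zero_of_isPreconnected hS (hy.sub hx)
    (fun t ht => sub_ne_zero.2 (h0 t ht).symm) hs ht (sub_pos.2 hlt))

/-- A curve of zeros cannot leave a box through its vertical sides. -/
theorem IsBox.stays {P : ℝ[X]} {x₀ t₀ δ ε : ℝ} (hB : IsBox P x₀ t₀ δ ε) {S : Set ℝ}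
    (hS : IsPreconnected S) (hSε : ∀ t ∈ S, |t - t₀| ≤ ε) {x : ℝ → ℝ} (hx : ContinuousOn x S)
    (h0 : ∀ t ∈ S, ev P (x t) t = 0) {s t : ℝ} (hs : s ∈ S) (ht : t ∈ S)
    (hxs : x s ∈ Ioo (x₀ - δ) (x₀ + δ)) : x t ∈ Ioo (x₀ - δ) (x₀ + δ) :=
  ⟨lt_of_ne_of_isPreconnected hS continuousOn_const hx (fun r hr h => by
      have := h0 r hr
      rw [← h] at this
      exact hB.side_left r (hSε r hr) this) hs ht hxs.1,
    lt_of_ne_of_isPreconnected hS hx continuousOn_const (fun r hr h => by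
      have := h0 r hr
      rw [h] at this
      exact hB.side_right r (hSε r hr) this) hs ht hxs.2⟩

/-- Zeros in a box approach its centre as the time approaches `t₀`. -/
theorem IsBox.shrink {P : ℝ[X]} (hP : P ≠ 0) {x₀ t₀ δ ε : ℝ} (hB : IsBox P x₀ t₀ δ ε) {η : ℝ}
    (hη : 0 < η) :
    ∀ᶠ t in 𝓝 t₀, ∀ x ∈ Ioo (x₀ - δ) (x₀ + δ), ev P x t = 0 → |x - x₀| < η := by
  have h := eventually_zeros_close hP t₀
    (δ := fun y => if δ < |y - x₀| then |y - x₀| - δ else η) fun y => by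
      split_ifs with h
      · exact sub_pos.2 h
      · exact hη
  filter_upwards [h] with t ht x hx hx0
  obtain ⟨y, hy, hxy⟩ := ht x hx0
  have hx' : |x - x₀| < δ := abs_lt.2 ⟨by linarith [hx.1], by linarith [hx.2]⟩
  split_ifs at hxy with h1
  · have := abs_sub_le y x x₀
    rw [abs_sub_comm y x] at this
    linarith
  · rwa [hB.center y (not_lt.1 h1) hy] at hxy

theorem eventually_mem_box {x : ℝ → ℝ} {l : Filter ℝ} {x₀ δ : ℝ} (h : Tendsto x l (𝓝 x₀))
    (hδ : 0 < δ) : ∀ᶠ t in l, x t ∈ Ioo (x₀ - δ) (x₀ + δ) :=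
  h.eventually (Ioo_mem_nhds (by linarith) (by linarith))

theorem tendsto_right_of_continuousOn_Icc {x : ℝ → ℝ} {a b t : ℝ} (h : ContinuousOn x (Icc a b))
    (ht : t ∈ Ico a b) : Tendsto x (𝓝[>] t) (𝓝 (x t)) :=
  (h t ⟨ht.1, ht.2.le⟩).mono_left
    (nhdsWithin_le_of_mem (mem_of_superset (Ioo_mem_nhdsGT ht.2) fun _ hs =>
      ⟨ht.1.trans hs.1.le, hs.2.le⟩))

theorem tendsto_left_of_continuousOn_Icc {x : ℝ → ℝ} {a b t : ℝ} (h : ContinuousOn x (Icc a b))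
    (ht : t ∈ Ioc a b) : Tendsto x (𝓝[<] t) (𝓝 (x t)) :=
  (h t ⟨ht.1.le, ht.2⟩).mono_left
    (nhdsWithin_le_of_mem (mem_of_superset (Ioo_mem_nhdsLT ht.1) fun _ hs =>
      ⟨hs.1.le, hs.2.le.trans ht.2⟩))

/-- Curves of zeros never split forward in time. -/
theorem IsRootCurve.eq_of_eq_left {P : ℝ[X]} (hP : P ≠ 0) {a b : ℝ} {x y : ℝ → ℝ}
    (hx : IsRootCurve P a b x) (hy : IsRootCurve P a b y) (h : x a = y a) :
    ∀ t ∈ Icc a b, x t = y t := by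
  refine real_induction h (fun t ht hxy => ?_) fun t ht hxy => ?_
  · obtain ⟨δ, -, ε, hB⟩ := exists_isBox hP (x t) t one_pos
    have hy' := tendsto_right_of_continuousOn_Icc hy.cont ht
    rw [← hxy] at hy'
    filter_upwards [eventually_mem_box (tendsto_right_of_continuousOn_Icc hx.cont ht) hB.δ_pos,
      eventually_mem_box hy' hB.δ_pos, Ioo_mem_nhdsGT ht.2,
      Ioc_mem_nhdsGT (show t < t + ε by linarith [hB.ε_pos])] with s h1 h2 h3 h4
    have hs : s ∈ Icc a b := ⟨ht.1.trans h3.1.le, h3.2.le⟩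
    exact hB.eq_of_fwd h4 h1 h2 (hx.root s hs) (hy.root s hs)
  · refine tendsto_nhds_unique_of_eventuallyEq (tendsto_left_of_continuousOn_Icc hx.cont ht)
      (tendsto_left_of_continuousOn_Icc hy.cont ht) ?_
    filter_upwards [Ioo_mem_nhdsLT ht.1] with s hs using hxy s ⟨hs.1.le, hs.2⟩

/-- Before `t₀` a box around a simple zero contains at most one zero. -/
theorem IsBox.eq_of_back {P : ℝ[X]} (hP : P ≠ 0) {x₀ t₀ δ ε t x y : ℝ} (h : IsBox P x₀ t₀ δ ε)
    (hm : mult P x₀ t₀ = 1)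
    (ht : t ∈ Ico (t₀ - ε) t₀) (hx : x ∈ Ioo (x₀ - δ) (x₀ + δ)) (hy : y ∈ Ioo (x₀ - δ) (x₀ + δ))
    (hx0 : ev P x t = 0) (hy0 : ev P y t = 0) : x = y :=
  Finset.card_le_one.1 ((h.back_card t ht).trans hm).le x
    ((mem_rootsIn (heat_ne_zero hP t)).2 ⟨hx0, hx⟩) y
    ((mem_rootsIn (heat_ne_zero hP t)).2 ⟨hy0, hy⟩)

/-- Curves of simple zeros do not split backward in time. -/
theorem IsRootCurve.eq_of_eq_right {P : ℝ[X]} (hP : P ≠ 0) {a b : ℝ} {x y : ℝ → ℝ}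
    (hx : IsRootCurve P a b x) (hy : IsRootCurve P a b y) (h : x b = y b)
    (hs : ∀ t ∈ Ioc a b, ev (derivative P) (x t) t ≠ 0) :
    ∀ t ∈ Icc a b, x t = y t := by
  refine real_induction_down h (fun t ht hxy => ?_) fun t ht hxy => ?_
  · obtain ⟨δ, -, ε, hB⟩ := exists_isBox hP (x t) t one_pos
    have hy' := tendsto_left_of_continuousOn_Icc hy.cont ht
    rw [← hxy] at hy'
    have hm := mult_eq_one hP (hx.root t ⟨ht.1.le, ht.2⟩) (hs t ht)
    filter_upwards [eventually_mem_box (tendsto_left_of_continuousOn_Icc hx.cont ht) hB.δ_pos,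
      eventually_mem_box hy' hB.δ_pos, Ioo_mem_nhdsLT ht.1,
      Ico_mem_nhdsLT (show t - ε < t by linarith [hB.ε_pos])] with s h1 h2 h3 h4
    have hs : s ∈ Icc a b := ⟨h3.1.le, h3.2.le.trans ht.2⟩
    exact hB.eq_of_back hP hm h4 h1 h2 (hx.root s hs) (hy.root s hs)
  · refine tendsto_nhds_unique_of_eventuallyEq (tendsto_right_of_continuousOn_Icc hx.cont ht)
      (tendsto_right_of_continuousOn_Icc hy.cont ht) ?_
    filter_upwards [Ioo_mem_nhdsGT ht.2] with s hs using hxy s ⟨hs.1, hs.2.le⟩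

theorem abs_sub_le_of_mem_Icc_right {t₀ ε s : ℝ} (h : s ∈ Icc t₀ (t₀ + ε)) : |s - t₀| ≤ ε := by
  rw [abs_of_nonneg (by linarith [h.1])]; linarith [h.2]

theorem abs_sub_le_of_mem_Icc_left {t₀ ε s : ℝ} (h : s ∈ Icc (t₀ - ε) t₀) : |s - t₀| ≤ ε := by
  rw [abs_of_nonpos (by linarith [h.2])]; linarith [h.1]

theorem IsBox.exists_root_of_odd {P : ℝ[X]} {x₀ t₀ δ ε : ℝ} (hB : IsBox P x₀ t₀ δ ε)
    (hm : Odd (mult P x₀ t₀)) {t : ℝ} (ht : |t - t₀| ≤ ε) :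
    ∃ x ∈ Ioo (x₀ - δ) (x₀ + δ), ev P x t = 0 := by
  have h := hB.side_mul hm t ht
  have hle : x₀ - δ ≤ x₀ + δ := by linarith [hB.δ_pos]
  have hc : ContinuousOn (fun x => ev P x t) (Icc (x₀ - δ) (x₀ + δ)) := fun x _ =>
    (hasDerivAt_ev_left P x t).continuousAt.continuousWithinAt
  rcases mul_neg_iff.1 h with ⟨h1, h2⟩ | ⟨h1, h2⟩
  · obtain ⟨x, hx, hx0⟩ := intermediate_value_Ioo' hle hc ⟨h2, h1⟩
    exact ⟨x, hx, hx0⟩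
  · obtain ⟨x, hx, hx0⟩ := intermediate_value_Ioo hle hc ⟨h1, h2⟩
    exact ⟨x, hx, hx0⟩

/-- A zero of odd multiplicity continues forward in time. -/
theorem IsBox.exists_forward_curve {P : ℝ[X]} (hP : P ≠ 0) {x₀ t₀ δ ε : ℝ}
    (hB : IsBox P x₀ t₀ δ ε) (hm : Odd (mult P x₀ t₀)) :
    ∃ r, IsRootCurve P t₀ (t₀ + ε) r ∧ r t₀ = x₀ ∧
      ∀ t ∈ Icc t₀ (t₀ + ε), r t ∈ Ioo (x₀ - δ) (x₀ + δ) := by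
  have hε := hB.ε_pos
  have hδ := hB.δ_pos
  have h1 : ∀ t, ∃ x, t ∈ Icc t₀ (t₀ + ε) → x ∈ Ioo (x₀ - δ) (x₀ + δ) ∧ ev P x t = 0 := by
    intro t
    by_cases ht : t ∈ Icc t₀ (t₀ + ε)
    · obtain ⟨x, hx, hx0⟩ := hB.exists_root_of_odd hm (abs_sub_le_of_mem_Icc_right ht)
      exact ⟨x, fun _ => ⟨hx, hx0⟩⟩
    · exact ⟨0, fun h => absurd h ht⟩
  choose r hr using h1
  have huniq : ∀ t ∈ Icc t₀ (t₀ + ε), ∀ x ∈ Ioo (x₀ - δ) (x₀ + δ), ev P x t = 0 → x = r t := by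
    intro t ht x hx hx0
    rcases eq_or_lt_of_le ht.1 with rfl | h'
    · have hc : ∀ y ∈ Ioo (x₀ - δ) (x₀ + δ), ev P y t₀ = 0 → y = x₀ := fun y hy hy0 =>
        hB.center y (abs_le.2 ⟨by linarith [hy.1], by linarith [hy.2]⟩) hy0
      rw [hc x hx hx0, hc _ (hr _ ht).1 (hr _ ht).2]
    · exact hB.eq_of_fwd ⟨h', ht.2⟩ hx (hr t ht).1 hx0 (hr t ht).2
  have h0 : ev P x₀ t₀ = 0 := (mult_pos_iff hP).1 hm.pos
  have hr0 : r t₀ = x₀ :=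
    (huniq t₀ (left_mem_Icc.2 (by linarith)) x₀ ⟨by linarith, by linarith⟩ h0).symm
  refine ⟨r, ⟨fun s hs => ?_, fun t ht => (hr t ht).2⟩, hr0, fun t ht => (hr t ht).1⟩
  have hodd : Odd (mult P (r s) s) := by
    rcases eq_or_lt_of_le hs.1 with rfl | h'
    · rwa [hr0]
    · rw [mult_eq_one hP (hr s hs).2 (hB.simple_fwd ⟨h', hs.2⟩ (hr s hs).1 (hr s hs).2).2]
      exact odd_one
  rw [Metric.continuousWithinAt_iff]
  intro η hη
  obtain ⟨δ', hδ', ε', hB'⟩ := exists_isBox hP (r s) s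
    (lt_min hη (lt_min (sub_pos.2 (hr s hs).1.1) (sub_pos.2 (hr s hs).1.2)))
  have e1 := hδ'.trans_le (min_le_left _ _)
  have e2 := (hδ'.trans_le (min_le_right _ _)).trans_le (min_le_left _ _)
  have e3 := (hδ'.trans_le (min_le_right _ _)).trans_le (min_le_right _ _)
  refine ⟨ε', hB'.ε_pos, fun {t} ht hts => ?_⟩
  obtain ⟨x, hx, hx0⟩ := hB'.exists_root_of_odd hodd (t := t) hts.le
  rw [← huniq t ht x ⟨by linarith [hx.1], by linarith [hx.2]⟩ hx0, Real.dist_eq, abs_lt]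
  constructor <;> linarith [hx.1, hx.2]

/-- A curve of zeros on a half-open time interval has an endpoint. -/
theorem exists_end_limit {P : ℝ[X]} (hP : P ≠ 0) {a b : ℝ} (hab : a < b) {x : ℝ → ℝ}
    (hx : ContinuousOn x (Ico a b)) (h0 : ∀ t ∈ Ico a b, ev P (x t) t = 0) :
    ∃ L, Tendsto x (𝓝[<] b) (𝓝 L) ∧ ev P L b = 0 := by
  obtain ⟨δ, ε, hε, hbox, -, hcover⟩ := exists_box_cover hP b
  set c := max a (b - ε) with hc
  have hcb : c < b := max_lt hab (by linarith)
  have hsub : Ico c b ⊆ Ico a b := Ico_subset_Ico_left (le_max_left _ _)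
  have hle : ∀ t ∈ Ico c b, |t - b| ≤ ε := fun t ht =>
    abs_sub_le_of_mem_Icc_left ⟨(le_max_right _ _).trans ht.1, ht.2.le⟩
  have hcI : c ∈ Ico c b := left_mem_Ico.2 hcb
  obtain ⟨L, hL, hxL⟩ := hcover c (hle c hcI) (x c) (h0 c (hsub hcI))
  have hL0 : ev P L b = 0 := by
    simpa [heat_ne_zero hP, ev] using hL
  refine ⟨L, Metric.tendsto_nhds.2 fun η hη => ?_, hL0⟩
  filter_upwards [nhdsWithin_le_nhds ((hbox L hL).shrink hP hη), Ico_mem_nhdsLT hcb] with t ht htI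
  exact ht _ ((hbox L hL).stays (s := c) isPreconnected_Ico hle (hx.mono hsub)
    (fun t ht => h0 t (hsub ht)) hcI htI hxL) (h0 t (hsub htI))

/-- Forward continuation: from a zero at time `a` a curve of zeros runs up to time `T`, unless it
stops before at a zero of even multiplicity. -/
theorem exists_forward {P : ℝ[X]} (hP : P ≠ 0) {x₀ a T : ℝ} (haT : a ≤ T) (h0 : ev P x₀ a = 0) :
    (∃ x, IsRootCurve P a T x ∧ x a = x₀) ∨
      ∃ s ∈ Ico a T, ∃ x, IsRootCurve P a s x ∧ x a = x₀ ∧ Even (mult P (x s) s) := by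
  rw [or_iff_not_imp_right]
  intro hno
  push Not at hno
  refine real_induction (p := fun s => ∃ x, IsRootCurve P a s x ∧ x a = x₀)
    ⟨_, isRootCurve_const h0, rfl⟩ ?_ ?_ T (right_mem_Icc.2 haT)
  · rintro t ht ⟨x, hx, hxa⟩
    have hodd := Nat.not_even_iff_odd.1 (hno t ht x hx hxa)
    obtain ⟨δ, -, ε, hB⟩ := exists_isBox hP (x t) t one_pos
    obtain ⟨r, hr, hrt, -⟩ := hB.exists_forward_curve hP hodd
    filter_upwards [Ioc_mem_nhdsGT (show t < t + ε by linarith [hB.ε_pos])] with s hs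
    refine ⟨_, hx.concat ht.1 hs.1.le (hr.mono le_rfl hs.2) hrt.symm, ?_⟩
    simp [ht.1, hxa]
  · intro t ht ih
    -- the curves up to the times `s < t` extend one another; glue them and add the limit at `t`
    choose! x hx hxa using ih
    have hagree : ∀ s ∈ Ico a t, ∀ r ∈ Icc a s, x r r = x s r := by
      intro s hs r hr
      have hr' : r ∈ Ico a t := ⟨hr.1, hr.2.trans_lt hs.2⟩
      exact (hx r hr').eq_of_eq_left hP ((hx s hs).mono le_rfl hr.2)
        ((hxa r hr').trans (hxa s hs).symm) r (right_mem_Icc.2 hr.1)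
    have hroot : ∀ s ∈ Ico a t, ev P (x s s) s = 0 := fun s hs =>
      (hx s hs).root s (right_mem_Icc.2 hs.1)
    have hcont : ContinuousOn (fun s => x s s) (Ico a t) := by
      intro s hs
      obtain ⟨r, hsr, hrt⟩ := exists_between hs.2
      have hrI : r ∈ Ico a t := ⟨hs.1.trans hsr.le, hrt⟩
      have h1 : ContinuousWithinAt (fun s => x s s) (Icc a r) s :=
        ((hx r hrI).cont s ⟨hs.1, hsr.le⟩).congr (fun q hq => hagree r hrI q hq)
          (hagree r hrI s ⟨hs.1, hsr.le⟩)
      refine h1.mono_of_mem_nhdsWithin ?_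
      filter_upwards [self_mem_nhdsWithin, nhdsWithin_le_nhds (Iio_mem_nhds hsr)] with q h2 h3
        using ⟨h2.1, le_of_lt h3⟩
    obtain ⟨L, hL, hL0⟩ := exists_end_limit hP ht.1 hcont hroot
    have e1 : ∀ s ∈ Ico a t, (if s < t then x s s else L) = x s s := fun s hs => if_pos hs.2
    refine ⟨fun s => if s < t then x s s else L, ⟨?_, fun s hs => ?_⟩, ?_⟩
    · intro s hs
      rcases eq_or_lt_of_le hs.2 with rfl | h'
      · rw [← Ico_insert_right ht.1.le, continuousWithinAt_insert_self]
        have h2 : Tendsto (fun q => if q < s then x q q else L) (𝓝[<] s) (𝓝 L) := by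
          refine hL.congr' ?_
          filter_upwards [self_mem_nhdsWithin] with q hq using (if_pos hq).symm
        have h3 : ContinuousWithinAt (fun q => if q < s then x q q else L) (Iio s) s := by
          rw [ContinuousWithinAt, if_neg (lt_irrefl s)]; exact h2
        exact h3.mono fun q hq => hq.2
      · have h2 := (hcont s ⟨hs.1, h'⟩).congr e1 (e1 s ⟨hs.1, h'⟩)
        refine h2.mono_of_mem_nhdsWithin ?_
        filter_upwards [self_mem_nhdsWithin, nhdsWithin_le_nhds (Iio_mem_nhds h')] with q h3 h4
          using ⟨h3.1, h4⟩
    · split_ifs with h'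
      · exact hroot s ⟨hs.1, h'⟩
      · rwa [le_antisymm hs.2 (not_lt.1 h')]
    · have haI : a ∈ Ico a t := left_mem_Ico.2 ht.1
      simp [ht.1, hxa a haI]

/-- All zeros in a box before time `t₀` flow into its centre. -/
theorem IsBox.exists_curve_to_center {P : ℝ[X]} (hP : P ≠ 0) {x₀ t₀ δ ε : ℝ}
    (hB : IsBox P x₀ t₀ δ ε) {x₁ t₁ : ℝ} (ht : t₁ ∈ Ico (t₀ - ε) t₀)
    (hx : x₁ ∈ Ioo (x₀ - δ) (x₀ + δ)) (h0 : ev P x₁ t₁ = 0) :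
    ∃ x, IsRootCurve P t₁ t₀ x ∧ x t₁ = x₁ ∧ x t₀ = x₀ ∧
      ∀ t ∈ Icc t₁ t₀, x t ∈ Ioo (x₀ - δ) (x₀ + δ) := by
  have hstay : ∀ s ∈ Icc t₁ t₀, ∀ x, IsRootCurve P t₁ s x → x t₁ = x₁ →
      ∀ t ∈ Icc t₁ s, x t ∈ Ioo (x₀ - δ) (x₀ + δ) := by
    intro s hs x hx' hxt t ht'
    exact hB.stays isPreconnected_Icc (fun r hr => abs_sub_le_of_mem_Icc_left
      ⟨ht.1.trans hr.1, hr.2.trans hs.2⟩) hx'.cont hx'.root (left_mem_Icc.2 hs.1) ht'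
      (by rwa [hxt])
  rcases exists_forward hP ht.2.le h0 with ⟨x, hx', hxt⟩ | ⟨s, hs, x, hx', hxt, heven⟩
  · have hst := hstay t₀ (right_mem_Icc.2 ht.2.le) x hx' hxt
    have hend := hst t₀ (right_mem_Icc.2 ht.2.le)
    exact ⟨x, hx', hxt, hB.center _ (abs_le.2 ⟨by linarith [hend.1], by linarith [hend.2]⟩)
      (hx'.root t₀ (right_mem_Icc.2 ht.2.le)), hst⟩
  · exfalso
    have h1 := hx'.root s (right_mem_Icc.2 hs.1)
    have h2 := hB.back_simple s ⟨ht.1.trans hs.1, hs.2⟩ _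
      (hstay s ⟨hs.1, hs.2.le⟩ x hx' hxt s (right_mem_Icc.2 hs.1)) h1
    rw [mult_eq_one hP h1 h2] at heven
    exact absurd heven (by decide)

theorem IsBox.exists_root_back {P : ℝ[X]} (hP : P ≠ 0) {x₀ t₀ δ ε : ℝ}
    (hB : IsBox P x₀ t₀ δ ε) (h0 : ev P x₀ t₀ = 0) {t : ℝ} (ht : t ∈ Ico (t₀ - ε) t₀) :
    ∃ x ∈ Ioo (x₀ - δ) (x₀ + δ), ev P x t = 0 := by
  have h1 := hB.back_card t ht
  have h2 := (mult_pos_iff hP).2 h0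
  obtain ⟨x, hx⟩ := Finset.card_pos.1 (h1.symm ▸ h2)
  have := (mem_rootsIn (heat_ne_zero hP t)).1 hx
  exact ⟨x, this.2, this.1⟩

/-- Backward continuation: every zero is the end of a curve of zeros that starts at time `a`. -/
theorem exists_backward {P : ℝ[X]} (hP : P ≠ 0) {x₀ a T : ℝ} (haT : a ≤ T) (h0 : ev P x₀ T = 0) :
    ∃ x, IsRootCurve P a T x ∧ x T = x₀ := by
  refine real_induction (a := a) (b := T) (p := fun s => ∀ x₀, ev P x₀ s = 0 →
    ∃ x, IsRootCurve P a s x ∧ x s = x₀) (fun x₀ h => ⟨_, isRootCurve_const h, rfl⟩) ?_ ?_ T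
    (right_mem_Icc.2 haT) x₀ h0
  · intro t ht ih
    obtain ⟨δ, ε, hε, hbox, -, hcover⟩ := exists_box_cover hP t
    filter_upwards [Ioc_mem_nhdsGT (show t < t + ε by linarith)] with s hs y hy
    have hsI : s ∈ Icc t (t + ε) := ⟨hs.1.le, hs.2⟩
    obtain ⟨z, hz, hyz⟩ := hcover s (abs_sub_le_of_mem_Icc_right hsI) y hy
    have hodd := ((hbox z hz).simple_fwd hs hyz hy).1
    obtain ⟨r, hr, hrt, hrb⟩ := (hbox z hz).exists_forward_curve hP hodd
    obtain ⟨x, hx, hxt⟩ := ih z (by simpa [heat_ne_zero hP, ev] using hz)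
    refine ⟨_, hx.concat ht.1 hs.1.le (hr.mono le_rfl hs.2) (hxt.trans hrt.symm), ?_⟩
    rw [if_neg (not_le.2 hs.1)]
    exact (hbox z hz).eq_of_fwd hs (hrb s hsI) hyz (hr.root s hsI) hy
  · intro t ht ih y hy
    obtain ⟨δ, -, ε, hB⟩ := exists_isBox hP y t one_pos
    set c := max a (t - ε) with hc
    have hct : c < t := max_lt ht.1 (by linarith [hB.ε_pos])
    have hcI : c ∈ Ico (t - ε) t := ⟨le_max_right _ _, hct⟩
    obtain ⟨x₁, hx₁, hx₁0⟩ := hB.exists_root_back hP hy hcI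
    obtain ⟨r, hr, hrc, hrt, -⟩ := hB.exists_curve_to_center hP hcI hx₁ hx₁0
    obtain ⟨x, hx, hxc⟩ := ih c ⟨le_max_left _ _, hct⟩ x₁ hx₁0
    refine ⟨_, hx.concat (le_max_left _ _) hct.le hr (hxc.trans hrc.symm), ?_⟩
    rw [if_neg (not_le.2 hct)]
    exact hrt

/-- Two curves of zeros that are ordered at the end are ordered at all times. -/
theorem IsRootCurve.lt_of_lt_right {P : ℝ[X]} (hP : P ≠ 0) {a b : ℝ} {x y : ℝ → ℝ}
    (hx : IsRootCurve P a b x) (hy : IsRootCurve P a b y) (h : x b < y b) :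
    ∀ t ∈ Icc a b, x t < y t := by
  intro t ht
  refine lt_of_ne_of_isPreconnected isPreconnected_Icc hx.cont hy.cont (fun s hs hxy => ?_)
    (right_mem_Icc.2 (ht.1.trans ht.2)) ht h
  exact h.ne ((hx.mono hs.1 le_rfl).eq_of_eq_left hP (hy.mono hs.1 le_rfl) hxy b
    (right_mem_Icc.2 hs.2))

/-- Into a multiple zero there run at least two curves of zeros, which are disjoint before. -/
theorem exists_two_backward {P : ℝ[X]} (hP : P ≠ 0) {x₀ a T : ℝ} (haT : a < T)
    (h0 : IsCrit P x₀ T) :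
    ∃ x y, IsRootCurve P a T x ∧ IsRootCurve P a T y ∧ x T = x₀ ∧ y T = x₀ ∧
      ∀ t ∈ Ico a T, x t < y t := by
  obtain ⟨δ, -, ε, hB⟩ := exists_isBox hP x₀ T one_pos
  set c := max a (T - ε) with hc
  have hac : a ≤ c := le_max_left _ _
  have hcT : c < T := max_lt haT (by linarith [hB.ε_pos])
  have hcI : c ∈ Ico (T - ε) T := ⟨le_max_right _ _, hcT⟩
  have hcard := (isCrit_iff hP).1 h0
  rw [← hB.back_card c hcI] at hcard
  obtain ⟨x₁, hx₁, y₁, hy₁, hne⟩ := Finset.one_lt_card.1 hcard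
  wlog hlt : x₁ < y₁ generalizing x₁ y₁
  · exact this y₁ hy₁ x₁ hx₁ hne.symm (lt_of_le_of_ne (not_lt.1 hlt) hne.symm)
  rw [mem_rootsIn (heat_ne_zero hP c)] at hx₁ hy₁
  obtain ⟨r, hr, hrc, hrT, hrb⟩ := hB.exists_curve_to_center hP hcI hx₁.2 hx₁.1
  obtain ⟨s, hs, hsc, hsT, hsb⟩ := hB.exists_curve_to_center hP hcI hy₁.2 hy₁.1
  obtain ⟨x, hx, hxc⟩ := exists_backward hP hac hx₁.1
  obtain ⟨y, hy, hyc⟩ := exists_backward hP hac hy₁.1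
  refine ⟨_, _, hx.concat hac hcT.le hr (hxc.trans hrc.symm),
    hy.concat hac hcT.le hs (hyc.trans hsc.symm), by simp [not_le.2 hcT, hrT],
    by simp [not_le.2 hcT, hsT], fun t ht => ?_⟩
  rcases le_or_gt t c with h | h
  · simp only [h, if_true]
    exact hx.lt_of_lt_right hP hy (by rwa [hxc, hyc]) t ⟨ht.1, h⟩
  · simp only [not_le.2 h, if_false]
    refine lt_of_ne_of_isPreconnected (isPreconnected_Ico (a := c) (b := T))
      (hr.cont.mono Ico_subset_Icc_self) (hs.cont.mono Ico_subset_Icc_self) (fun q hq hrs => ?_)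
      (left_mem_Ico.2 hcT) ⟨h.le, ht.2⟩ (by rwa [hrc, hsc])
    have := (hr.mono le_rfl hq.2.le).eq_of_eq_right hP (hs.mono le_rfl hq.2.le) hrs
      (fun u hu => hB.back_simple u ⟨hcI.1.trans hu.1.le, hu.2.trans_lt hq.2⟩ _
        (hrb u ⟨hu.1.le, hu.2.trans hq.2.le⟩) (hr.root u ⟨hu.1.le, hu.2.trans hq.2.le⟩)) c
      (left_mem_Icc.2 hq.1)
    rw [hrc, hsc] at this
    exact hne this

/-! ### Curves of simple zeros are smooth -/

/-- The difference quotient of the evolution in space extends continuously, uniformly in time. -/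
theorem exists_quotient (P : ℝ[X]) (x₀ : ℝ) :
    ∃ K : ℝ × ℝ → ℝ, Continuous K ∧ (∀ y s, ev P y s - ev P x₀ s = (y - x₀) * K (y, s)) ∧
      ∀ s, K (x₀, s) = ev (derivative P) x₀ s := by
  induction P using heat_induction with
  | hC a => exact ⟨fun _ => 0, continuous_const, by simp [ev_C], by simp [ev]⟩
  | hadd P R hP hR =>
    obtain ⟨K, hK, h1, h2⟩ := hP
    obtain ⟨K', hK', h1', h2'⟩ := hR
    refine ⟨fun z => K z + K' z, hK.add hK', fun y s => ?_, fun s => ?_⟩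
    · rw [ev_add, ev_add, mul_add, ← h1, ← h1']; ring
    · simp only [h2, h2', derivative_add, ev_add]
  | hX P hP hP' =>
    obtain ⟨K, hK, h1, h2⟩ := hP
    obtain ⟨K', hK', h1', h2'⟩ := hP'
    have := continuous_ev P
    refine ⟨fun z => ev P z.1 z.2 + x₀ * K z + z.2 * K' z, by fun_prop, fun y s => ?_, fun s => ?_⟩
    · rw [ev_X_mul, ev_X_mul]
      linear_combination x₀ * h1 y s + s * h1' y s
    · simp only [h2, h2', derivative_mul, derivative_X, one_mul, ev_add, ev_X_mul]; ring

/-- The implicit function theorem for curves of simple zeros. -/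
theorem IsRootCurve.hasDerivAt {P : ℝ[X]} {a b : ℝ} {x : ℝ → ℝ} (hx : IsRootCurve P a b x)
    {t : ℝ} (ht : t ∈ Ioo a b) (h : ev (derivative P) (x t) t ≠ 0) :
    HasDerivAt x (-(ev (derivative (derivative P)) (x t) t) / (2 * ev (derivative P) (x t) t))
      t := by
  obtain ⟨K, hK, h1, h2⟩ := exists_quotient P (x t)
  have hnhds : Icc a b ∈ 𝓝 t := Icc_mem_nhds ht.1 ht.2
  have hxt : Tendsto x (𝓝 t) (𝓝 (x t)) := (hx.cont.continuousAt hnhds).tendsto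
  have hKt : Tendsto (fun s => K (x s, s)) (𝓝 t) (𝓝 (ev (derivative P) (x t) t)) := by
    rw [← h2]
    exact (hK.tendsto (x t, t)).comp (hxt.prodMk_nhds tendsto_id)
  rw [hasDerivAt_iff_tendsto_slope]
  have h3 := hasDerivAt_iff_tendsto_slope.1 (hasDerivAt_ev_right P (x t) t)
  have h4 := (h3.neg.div (hKt.mono_left nhdsWithin_le_nhds) h)
  have e : -(ev (derivative (derivative P)) (x t) t) / (2 * ev (derivative P) (x t) t) =
      -(ev (derivative (derivative P)) (x t) t / 2) / ev (derivative P) (x t) t := by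
    field_simp
  rw [e]
  refine h4.congr' ?_
  filter_upwards [nhdsWithin_le_nhds hnhds,
    nhdsWithin_le_nhds (hKt.eventually_ne h), self_mem_nhdsWithin] with s hs hKs hst
  have h5 := h1 (x s) s
  have h6 : s - t ≠ 0 := sub_ne_zero.2 hst
  rw [hx.root s hs] at h5
  simp only [Pi.div_apply, slope_def_field]
  rw [hx.root t ⟨ht.1.le, ht.2.le⟩]
  field_simp
  linarith

/-! ### Yuille–Poggio curves are level curves -/

/-- The evolution of `level q l` vanishes where that of `q` has the value `l`. -/
noncomputable def level (q : ℝ[X]) (l : ℝ) : ℝ[X] := q - C l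

theorem derivative_level (q : ℝ[X]) (l : ℝ) : derivative (level q l) = derivative q := by
  simp [level]

theorem ev_level (q : ℝ[X]) (l x t : ℝ) : ev (level q l) x t = ev q x t - l := ev_sub_C q l x t

theorem level_ne_zero {q : ℝ[X]} (hq : derivative q ≠ 0) (l : ℝ) : level q l ≠ 0 := by
  intro h
  rw [← derivative_level q l, h, derivative_zero] at hq
  exact hq rfl

theorem IsRootCurve.ev_eq {q : ℝ[X]} {l a b : ℝ} {x : ℝ → ℝ} (h : IsRootCurve (level q l) a b x)
    {t : ℝ} (ht : t ∈ Icc a b) : ev q (x t) t = l := by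
  have := h.root t ht
  rw [ev_level] at this
  linarith

theorem dx_two (p : ℝ[X]) (x : ℝ) {t : ℝ} (ht : 0 ≤ t) :
    dx p 2 x t = ev (derivative (derivative p)) x t := dx_eq_ev p 2 x ht

theorem dx_three (p : ℝ[X]) (x : ℝ) {t : ℝ} (ht : 0 ≤ t) :
    dx p 3 x t = ev (derivative (derivative (derivative p))) x t := dx_eq_ev p 3 x ht

/-- Along a Yuille–Poggio curve the evolution of `p'` is constant. -/
theorem IsYPCurve.isRootCurve {p : ℝ[X]} {h T : ℝ} {x : ℝ → ℝ} (hx : IsYPCurve p h T x) :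
    IsRootCurve (level (derivative p) ((derivative p).eval h)) 0 T x := by
  refine ⟨hx.continuousOn, fun t ht => ?_⟩
  have hcont : ContinuousOn (fun s => ev (derivative p) (x s) s) (Icc 0 T) :=
    (continuous_ev (derivative p)).comp_continuousOn (hx.continuousOn.prodMk continuousOn_id)
  have h1 := MeasureTheory.integral_eq_of_hasDerivAt_off_countable_of_le
    (fun s => ev (derivative p) (x s) s) (fun _ => 0) ht.1 hx.finite_singular.countable
    (hcont.mono (Icc_subset_Icc_right ht.2)) (fun s hs => by
      have hsT : s ∈ Ioo 0 T := ⟨hs.1.1, hs.1.2.trans_le ht.2⟩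
      have hne : dx p 2 (x s) s ≠ 0 := fun h0 => hs.2 ⟨hsT, h0⟩
      have h2 := hasDerivAt_ev (derivative p) (hx.ode s hsT hne)
      rw [dx_two p _ hsT.1.le] at hne
      rw [dx_two p _ hsT.1.le, dx_three p _ hsT.1.le] at h2
      refine h2.congr_deriv ?_
      field_simp
      ring) (by simp)
  rw [intervalIntegral.integral_zero, hx.init, ev_zero_time] at h1
  rw [ev_level]
  linarith

/-- Conversely, a curve on which the evolution of `p'` is constant is a Yuille–Poggio curve; the
finitely many multiple zeros account for its singular times. -/
theorem IsRootCurve.isYPCurve {p : ℝ[X]} (hp : derivative (derivative p) ≠ 0) {l T : ℝ}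
    {x : ℝ → ℝ} (hT : 0 ≤ T) (hx : IsRootCurve (level (derivative p) l) 0 T x) :
    IsYPCurve p (x 0) T x where
  nonneg := hT
  init := rfl
  continuousOn := hx.cont
  finite_singular := by
    refine Set.Finite.of_finite_image (f := fun t => (x t, t))
      ((finite_crit (level_ne_zero hp l) 0).subset ?_) fun t _ s _ h => (Prod.ext_iff.1 h).2
    rintro _ ⟨t, ⟨ht, h0⟩, rfl⟩
    refine ⟨⟨hx.root t (Ioo_subset_Icc_self ht), ?_⟩, ht.1.le⟩
    rwa [derivative_level, ← dx_two p _ ht.1.le]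
  ode := by
    intro t ht hne
    rw [dx_two p _ ht.1.le] at hne ⊢
    rw [dx_three p _ ht.1.le]
    have := hx.hasDerivAt ht (by rwa [derivative_level])
    rwa [derivative_level] at this

/-- A level curve of the evolution of `q` runs from `(h, 0)` to `(y, T)`. -/
def Joins (q : ℝ[X]) (h y T : ℝ) : Prop :=
  ∃ x, IsRootCurve (level q (q.eval h)) 0 T x ∧ x 0 = h ∧ x T = y

theorem IsRootCurve.joins {q : ℝ[X]} {l T : ℝ} (hT : 0 ≤ T) {x : ℝ → ℝ}
    (hx : IsRootCurve (level q l) 0 T x) : Joins q (x 0) (x T) T := by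
  have h := hx.ev_eq (left_mem_Icc.2 hT)
  rw [ev_zero_time] at h
  exact ⟨x, by rwa [h], rfl, rfl⟩

/-- Yuille–Poggio curves of `p` are the level curves of the evolution of `p'`. -/
theorem reaches_iff {p : ℝ[X]} (hp : derivative (derivative p) ≠ 0) {h : ℝ} {z : ℝ × ℝ} :
    Reaches p h z ↔ 0 ≤ z.2 ∧ Joins (derivative p) h z.1 z.2 := by
  constructor
  · rintro ⟨x, hx, hxz⟩
    exact ⟨hx.nonneg, x, hx.isRootCurve, hx.init, hxz⟩
  · rintro ⟨h0, x, hx, hx0, hxz⟩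
    refine ⟨x, ?_, hxz⟩
    have := hx.isYPCurve hp h0
    rwa [hx0] at this

/-! ### Fingerprints as zero sets -/

/-- At all nonnegative times the `k`-th fingerprint is contained in the zero set of `∂ₓᵏ p`. -/
theorem fingerprint_subset (p : ℝ[X]) (k : ℕ) {z : ℝ × ℝ} (hz : z ∈ fingerprint p k) :
    0 ≤ z.2 ∧ ev (derivative^[k] p) z.1 z.2 = 0 := by
  have hc := continuous_ev (derivative^[k] p)
  have h1 : z ∈ {z : ℝ × ℝ | 0 ≤ z.2 ∧ 0 ≤ ev (derivative^[k] p) z.1 z.2} := by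
    refine closure_minimal ?_ (IsClosed.and (isClosed_le continuous_const continuous_snd)
      (isClosed_le continuous_const hc)) hz.1
    intro w hw
    refine ⟨hw.1, ?_⟩
    rw [← dx_eq_ev p k w.1 hw.1]
    exact hw.2.le
  have h2 : z ∈ {z : ℝ × ℝ | ev (derivative^[k] p) z.1 z.2 ≤ 0} := by
    refine closure_minimal ?_ (isClosed_le hc continuous_const) hz.2
    intro w hw
    change ev (derivative^[k] p) w.1 w.2 ≤ 0
    rw [← dx_eq_ev p k w.1 hw.1]
    exact hw.2.le
  exact ⟨h1.1, le_antisymm h2 h1.2⟩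

/-- At positive times the `k`-th fingerprint is the zero set of `∂ₓᵏ p`. -/
theorem mem_fingerprint_iff {p : ℝ[X]} {k : ℕ} (hp : derivative^[k] p ≠ 0) {x t : ℝ} (ht : 0 < t) :
    (x, t) ∈ fingerprint p k ↔ ev (derivative^[k] p) x t = 0 := by
  refine ⟨fun h => (fingerprint_subset p k h).2, fun h => ?_⟩
  have hm := (mult_pos_iff hp).2 h
  have key : ∀ η > 0, ∃ w₁ w₂ : ℝ × ℝ, dist w₁ (x, t) < η ∧ dist w₂ (x, t) < η ∧
      w₁ ∈ fingerprintPos p k ∧ w₂ ∈ fingerprintNeg p k := by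
    intro η hη
    obtain ⟨s, ⟨σ, ξ, hξ, hξ'⟩, hs0, hsη⟩ := ((eventually_exists_alternates hp x t hη).and
      (Ioo_mem_nhdsLT (show max 0 (t - η) < t from max_lt ht (by linarith)))).exists
    have hs0' : 0 < s := (le_max_left _ _).trans_lt hs0
    have hd : ∀ i ≤ mult (derivative^[k] p) x t, dist (ξ i, s) (x, t) < η := by
      intro i hi
      rw [Prod.dist_eq, max_lt_iff, Real.dist_eq, Real.dist_eq, abs_sub_comm s]
      refine ⟨hξ' i hi, ?_⟩
      have := (le_max_right 0 (t - η)).trans_lt hs0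
      rw [abs_of_pos (by linarith)]; linarith
    have a0 := hξ.2 0 (Nat.zero_le _)
    have a1 := hξ.2 1 hm
    simp only [pow_zero, pow_one, mul_one, mul_neg, neg_mul, neg_pos] at a0 a1
    rcases pos_and_pos_or_neg_and_neg_of_mul_pos a0 with ⟨h1, h2⟩ | ⟨h1, h2⟩
    · refine ⟨(ξ 0, s), (ξ 1, s), hd 0 (Nat.zero_le _), hd 1 hm, ⟨hs0'.le, ?_⟩, ⟨hs0'.le, ?_⟩⟩
      · rw [dx_eq_ev p k _ hs0'.le]; exact h2
      · rw [dx_eq_ev p k _ hs0'.le]; nlinarith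
    · refine ⟨(ξ 1, s), (ξ 0, s), hd 1 hm, hd 0 (Nat.zero_le _), ⟨hs0'.le, ?_⟩, ⟨hs0'.le, ?_⟩⟩
      · rw [dx_eq_ev p k _ hs0'.le]; exact pos_of_mul_neg_right a1 h1.le
      · rw [dx_eq_ev p k _ hs0'.le]; exact h2
  constructor
  · refine Metric.mem_closure_iff.2 fun η hη => ?_
    obtain ⟨w₁, w₂, h1, h2, h3, h4⟩ := key η hη
    exact ⟨w₁, h3, by rwa [dist_comm]⟩
  · refine Metric.mem_closure_iff.2 fun η hη => ?_
    obtain ⟨w₁, w₂, h1, h2, h3, h4⟩ := key η hη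
    exact ⟨w₂, h4, by rwa [dist_comm]⟩

/-- At time `0` the `k`-th fingerprint consists of zeros of odd multiplicity only. -/
theorem odd_mult_of_mem_fingerprint {p : ℝ[X]} {k : ℕ} (hp : derivative^[k] p ≠ 0) {x : ℝ}
    (h : (x, 0) ∈ fingerprint p k) : Odd (mult (derivative^[k] p) x 0) := by
  by_contra hodd
  obtain ⟨s, hs⟩ := forward_even hp (Nat.not_odd_iff_even.1 hodd)
  have hs' : ∀ᶠ z : ℝ × ℝ in 𝓝 (x, 0), 0 ≤ z.2 → 0 ≤ s * dx p k z.1 z.2 := by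
    filter_upwards [hs] with z hz h0
    rw [dx_eq_ev p k _ h0]
    rcases eq_or_lt_of_le h0 with h1 | h1
    · exact hz.2 h1
    · exact (hz.1 h1).le
  obtain ⟨z, hz1, hz2⟩ := (mem_closure_iff_frequently.1 h.1).and_eventually hs' |>.exists
  obtain ⟨w, hw1, hw2⟩ := (mem_closure_iff_frequently.1 h.2).and_eventually hs' |>.exists
  have h1 := hz2 hz1.1
  have h2 := hw2 hw1.1
  have h3 : s = 0 := by
    apply le_antisymm
    · exact nonpos_of_mul_nonneg_left h2 hw1.2
    · exact nonneg_of_mul_nonneg_left h1 hz1.2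
  have h4 : Tendsto (fun t : ℝ => (x, t)) (𝓝[>] 0) (𝓝 (x, 0)) :=
    ((by fun_prop : Continuous fun t : ℝ => (x, t)).tendsto 0).mono_left nhdsWithin_le_nhds
  obtain ⟨t, ht1, ht2⟩ := ((h4.eventually hs).and self_mem_nhdsWithin).exists
  have := ht1.1 ht2
  rw [h3, zero_mul] at this
  exact this.false

/-- `FP₂ ∩ FP₃` consists of the multiple zeros of `∂ₓ² p` at positive times: at time `0` the
multiplicities of a zero of `∂ₓ² p` and of `∂ₓ³ p` cannot both be odd. -/
theorem fingerprint_inter {p : ℝ[X]} (hp : derivative (derivative p) ≠ 0) :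
    fingerprint p 2 ∩ fingerprint p 3 =
      {z | 0 < z.2 ∧ IsCrit (derivative (derivative p)) z.1 z.2} := by
  ext ⟨x, t⟩
  constructor
  · rintro ⟨h2, h3⟩
    have h2' := fingerprint_subset p 2 h2
    have h3' := fingerprint_subset p 3 h3
    refine ⟨lt_of_le_of_ne h2'.1 fun h0 => ?_, h2'.2, h3'.2⟩
    have h0' : t = 0 := h0.symm
    subst h0'
    have o2 : Odd (mult (derivative^[2] p) x 0) := odd_mult_of_mem_fingerprint (k := 2) hp h2
    have o3 : Odd (mult (derivative (derivative^[2] p)) x 0) :=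
      odd_mult_of_mem_fingerprint (k := 3) (derivative_ne_zero_of_zero hp h2'.2) h3
    have h2'' : ev (derivative^[2] p) x 0 = 0 := h2'.2
    rw [mult_derivative h2''] at o3
    obtain ⟨a, ha⟩ := o2
    obtain ⟨b, hb⟩ := o3
    omega
  · rintro ⟨h0, h1, h2⟩
    exact ⟨(mem_fingerprint_iff (k := 2) hp h0).2 h1,
      (mem_fingerprint_iff (k := 3) (derivative_ne_zero_of_zero hp h1) h0).2 h2⟩

/-! ### Level curves merge on the zeros of the derivative -/

/-- Level curves that are ordered at the end are ordered at all times. -/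
theorem levelCurve_lt {q : ℝ[X]} (hq : derivative q ≠ 0) {l l' a b : ℝ} {x y : ℝ → ℝ}
    (hx : IsRootCurve (level q l) a b x) (hy : IsRootCurve (level q l') a b y) (h : x b < y b) :
    ∀ t ∈ Icc a b, x t < y t := by
  rcases eq_or_ne l l' with rfl | hne
  · exact hx.lt_of_lt_right (level_ne_zero hq l) hy h
  · intro t ht
    refine lt_of_ne_of_isPreconnected isPreconnected_Icc hx.cont hy.cont (fun s hs hxy => hne ?_)
      (right_mem_Icc.2 (ht.1.trans ht.2)) ht h
    rw [← hx.ev_eq hs, ← hy.ev_eq hs, hxy]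

theorem Joins.eval_eq {q : ℝ[X]} {h y T : ℝ} (hT : 0 ≤ T) (hj : Joins q h y T) :
    q.eval h = ev q y T := by
  obtain ⟨x, hx, -, rfl⟩ := hj
  exact (hx.ev_eq (right_mem_Icc.2 hT)).symm

/-- Level curves preserve the strict order of their ends backward in time. -/
theorem Joins.lt {q : ℝ[X]} (hq : derivative q ≠ 0) {h h' y y' T : ℝ} (hT : 0 ≤ T)
    (hj : Joins q h y T) (hj' : Joins q h' y' T) (hy : y < y') : h < h' := by
  obtain ⟨x, hx, rfl, rfl⟩ := hj
  obtain ⟨x', hx', rfl, rfl⟩ := hj'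
  exact levelCurve_lt hq hx hx' hy 0 (left_mem_Icc.2 hT)

theorem Joins.le_of_lt {q : ℝ[X]} (hq : derivative q ≠ 0) {h h' y y' T : ℝ} (hT : 0 ≤ T)
    (hj : Joins q h y T) (hj' : Joins q h' y' T) (hh : h < h') : y ≤ y' := by
  by_contra hc
  exact absurd (hj'.lt hq hT hj (not_le.1 hc)) (not_lt.2 hh.le)

/-- Every point at a nonnegative time lies on a level curve. -/
theorem exists_joins {q : ℝ[X]} (hq : derivative q ≠ 0) (y : ℝ) {T : ℝ} (hT : 0 ≤ T) :
    ∃ h, Joins q h y T := by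
  obtain ⟨x, hx, rfl⟩ := exists_backward (level_ne_zero hq (ev q y T)) hT
    (show ev (level q (ev q y T)) y T = 0 by rw [ev_level, sub_self])
  exact ⟨x 0, hx.joins hT⟩

/-- Along a curve of simple zeros of `∂ₓ q` the value of `q` is injective, since its derivative
is `∂ₓ² q / 2`. -/
theorem IsRootCurve.injOn_ev {q : ℝ[X]} {s t : ℝ} {η : ℝ → ℝ}
    (hη : IsRootCurve (derivative q) s t η)
    (hs : ∀ r ∈ Ioo s t, ev (derivative (derivative q)) (η r) r ≠ 0) :
    InjOn (fun r => ev q (η r) r) (Icc s t) := by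
  intro a ha b hb hab
  by_contra hne
  wlog hlt : a < b generalizing a b
  · exact this hb ha hab.symm (Ne.symm hne) (lt_of_le_of_ne (not_lt.1 hlt) (Ne.symm hne))
  have hsub : Icc a b ⊆ Icc s t := Icc_subset_Icc ha.1 hb.2
  obtain ⟨r, hr, hr0⟩ := exists_hasDerivAt_eq_zero hlt
    (((continuous_ev q).comp_continuousOn ((hη.cont.prodMk continuousOn_id))).mono hsub) hab
    (fun r hr => hasDerivAt_ev q (hη.hasDerivAt (t := r) ⟨ha.1.trans_lt hr.1, hr.2.trans_le hb.2⟩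
      (hs r ⟨ha.1.trans_lt hr.1, hr.2.trans_le hb.2⟩)))
  rw [hη.root r (hsub (Ioo_subset_Icc_self hr)), zero_mul, zero_add] at hr0
  exact hs r ⟨ha.1.trans_lt hr.1, hr.2.trans_le hb.2⟩ (by linarith)

/-- The two level curves that merge at a simple zero of `∂ₓ q` enclose the curve of zeros of
`∂ₓ q` on which they merge. -/
theorem nested {q : ℝ[X]} (hq : derivative q ≠ 0) {l s t : ℝ} {η α β : ℝ → ℝ} (hst : s < t)
    (hη : IsRootCurve (derivative q) s t η)
    (hsimple : ev (derivative (derivative q)) (η t) t ≠ 0)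
    (hinj : InjOn (fun r => ev q (η r) r) (Icc s t))
    (hα : IsRootCurve (level q l) s t α) (hβ : IsRootCurve (level q l) s t β)
    (hαt : α t = η t) (hβt : β t = η t) (hαβ : ∀ r ∈ Ico s t, α r < β r) :
    ∀ r ∈ Ico s t, α r < η r ∧ η r < β r := by
  have htI : t ∈ Icc s t := right_mem_Icc.2 hst.le
  obtain ⟨δ, -, ε, hB⟩ := exists_isBox hq (η t) t one_pos
  have hm := mult_eq_one hq (hη.root t htI) hsimple
  have htI' : t ∈ Ioc s t := right_mem_Ioc.2 hst
  have h1 := tendsto_left_of_continuousOn_Icc hα.cont htI'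
  have h2 := tendsto_left_of_continuousOn_Icc hβ.cont htI'
  rw [hαt] at h1
  rw [hβt] at h2
  have h3 : ∀ᶠ r in 𝓝[<] t, r ∈ Ico s t := Ico_mem_nhdsLT hst
  have h4 : ∀ᶠ r in 𝓝[<] t, r ∈ Ico (t - ε) t := Ico_mem_nhdsLT (by linarith [hB.ε_pos])
  obtain ⟨r, hr1, hr2, hr3, hr4, hr5⟩ := ((eventually_mem_box h1 hB.δ_pos).and
    ((eventually_mem_box h2 hB.δ_pos).and ((eventually_mem_box
      (tendsto_left_of_continuousOn_Icc hη.cont htI') hB.δ_pos).and (h3.and h4)))).exists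
  have hrI : r ∈ Icc s t := Ico_subset_Icc_self hr4
  obtain ⟨z, hz, hz0⟩ := exists_hasDerivAt_eq_zero (hαβ r hr4)
    (fun z _ => (hasDerivAt_ev_left q z r).continuousAt.continuousWithinAt)
    ((hα.ev_eq hrI).trans (hβ.ev_eq hrI).symm) (fun z _ => hasDerivAt_ev_left q z r)
  have hzη := hB.eq_of_back hq hm hr5 ⟨hr1.1.trans hz.1, hz.2.trans hr2.2⟩ hr3 hz0 (hη.root r hrI)
  have hne : ∀ u ∈ Ico s t, ev q (η u) u ≠ l := by
    intro u hu h
    rw [← hα.ev_eq htI, hαt] at h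
    exact hu.2.ne (hinj (Ico_subset_Icc_self hu) htI h)
  intro u hu
  constructor
  · refine lt_of_ne_of_isPreconnected isPreconnected_Ico (hα.cont.mono Ico_subset_Icc_self)
      (hη.cont.mono Ico_subset_Icc_self) (fun v hv h => hne v hv ?_) hr4 hu (hzη ▸ hz.1)
    rw [← h, hα.ev_eq (Ico_subset_Icc_self hv)]
  · refine lt_of_ne_of_isPreconnected isPreconnected_Ico (hη.cont.mono Ico_subset_Icc_self)
      (hβ.cont.mono Ico_subset_Icc_self) (fun v hv h => hne v hv ?_) hr4 hu (hzη ▸ hz.2)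
    rw [h, hβ.ev_eq (Ico_subset_Icc_self hv)]

/-- At every zero of `∂ₓ q` at a positive time two level curves of `q` merge, because there the zero
of `q - l`, with `l` the value of `q`, is multiple. -/
theorem exists_two_level_curves {q : ℝ[X]} (hq : derivative q ≠ 0) {y T : ℝ} (hT : 0 < T)
    (h0 : ev (derivative q) y T = 0) :
    ∃ α β, IsRootCurve (level q (ev q y T)) 0 T α ∧ IsRootCurve (level q (ev q y T)) 0 T β ∧
      α T = y ∧ β T = y ∧ ∀ t ∈ Ico 0 T, α t < β t :=
  exists_two_backward (level_ne_zero hq _) hT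
    ⟨by rw [ev_level, sub_self], by rwa [derivative_level]⟩

/-- A level curve whose level differs from those of the multiple zeros of `∂ₓ q` runs through simple
zeros: before its end, it cannot pass through a zero of even multiplicity, nor through one of odd
multiplicity at least three. -/
theorem IsRootCurve.simple_of_level_ne {q : ℝ[X]} (hq : derivative q ≠ 0) {l T : ℝ} {x : ℝ → ℝ}
    (hx : IsRootCurve (level q l) 0 T x)
    (hl : ∀ y s, 0 < s → s < T → IsCrit (derivative q) y s → ev q y s ≠ l) :
    ∀ t ∈ Ioo 0 T, ev (derivative q) (x t) t ≠ 0 := by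
  intro t ht h0
  have hf := level_ne_zero hq l
  have htI : t ∈ Icc 0 T := Ioo_subset_Icc_self ht
  have hc : IsCrit (level q l) (x t) t := ⟨hx.root t htI, by rwa [derivative_level]⟩
  obtain ⟨δ, -, ε, hB⟩ := exists_isBox hf (x t) t one_pos
  have h1 : ∀ᶠ r in 𝓝[>] t, r ∈ Ioo t T := Ioo_mem_nhdsGT ht.2
  have h2 : ∀ᶠ r in 𝓝[>] t, r ∈ Ioc t (t + ε) := Ioc_mem_nhdsGT (by linarith [hB.ε_pos])
  obtain ⟨r, hr1, hr2, hr3⟩ := ((eventually_mem_box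
    (tendsto_right_of_continuousOn_Icc hx.cont ⟨ht.1.le, ht.2⟩) hB.δ_pos).and (h1.and h2)).exists
  have hodd := (hB.simple_fwd hr3 hr1 (hx.root r ⟨ht.1.le.trans hr2.1.le, hr2.2.le⟩)).1
  have h3 := (isCrit_iff hf).1 hc
  refine hl (x t) t ht.1 ht.2 ((isCrit_iff hq).2 ?_) (hx.ev_eq htI)
  rw [← derivative_level q l, mult_derivative hc.1]
  obtain ⟨k, hk⟩ := hodd
  omega

/-- The feet of a simple zero of `∂ₓ q` whose level is not that of a multiple one. -/
theorem joins_iff_of_simple {q : ℝ[X]} (hq : derivative q ≠ 0) {y T : ℝ} (hT : 0 < T)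
    (h1 : ev (derivative q) y T = 0) (h2 : ev (derivative (derivative q)) y T ≠ 0)
    (hl : ∀ x s, 0 < s → s < T → IsCrit (derivative q) x s → ev q x s ≠ ev q y T)
    {α β : ℝ → ℝ} (hα : IsRootCurve (level q (ev q y T)) 0 T α)
    (hβ : IsRootCurve (level q (ev q y T)) 0 T β) (hαT : α T = y) (hβT : β T = y)
    (hαβ : ∀ t ∈ Ico 0 T, α t < β t) (h : ℝ) : Joins q h y T ↔ h = α 0 ∨ h = β 0 := by
  constructor
  · intro hj
    obtain ⟨x, hx, hx0, hxT⟩ := id hj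
    rw [hj.eval_eq hT.le] at hx
    have hf := level_ne_zero hq (ev q y T)
    have h3 : ev (level q (ev q y T)) y T = 0 := by rw [ev_level, sub_self]
    have hm : mult (level q (ev q y T)) y T = 2 := by
      have h4 := mult_eq_one hq h1 h2
      rw [← derivative_level q (ev q y T), mult_derivative h3] at h4
      omega
    obtain ⟨δ, -, ε, hB⟩ := exists_isBox hf y T one_pos
    have hTI : T ∈ Ioc 0 T := right_mem_Ioc.2 hT
    have t1 := tendsto_left_of_continuousOn_Icc hα.cont hTI
    have t2 := tendsto_left_of_continuousOn_Icc hβ.cont hTI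
    have t3 := tendsto_left_of_continuousOn_Icc hx.cont hTI
    rw [hαT] at t1
    rw [hβT] at t2
    rw [hxT] at t3
    have t4 : ∀ᶠ r in 𝓝[<] T, r ∈ Ioo 0 T := Ioo_mem_nhdsLT hT
    have t5 : ∀ᶠ r in 𝓝[<] T, r ∈ Ico (T - ε) T := Ico_mem_nhdsLT (by linarith [hB.ε_pos])
    obtain ⟨r, r1, r2, r3, r4, r5⟩ := ((eventually_mem_box t1 hB.δ_pos).and
      ((eventually_mem_box t2 hB.δ_pos).and ((eventually_mem_box t3 hB.δ_pos).and
        (t4.and t5)))).exists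
    have rI : r ∈ Icc 0 T := Ioo_subset_Icc_self r4
    have hlt := hαβ r ⟨r4.1.le, r4.2⟩
    have hsub : ({α r, β r} : Finset ℝ) ⊆
        rootsIn (heat r (level q (ev q y T))) (y - δ) (y + δ) := by
      intro z hz
      rw [mem_rootsIn (heat_ne_zero hf r)]
      rcases Finset.mem_insert.1 hz with rfl | hz
      · exact ⟨hα.root r rI, r1⟩
      · rw [Finset.mem_singleton.1 hz]
        exact ⟨hβ.root r rI, r2⟩
    have heq := Finset.eq_of_subset_of_card_le hsub (by
      rw [hB.back_card r r5, hm, Finset.card_pair hlt.ne])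
    have hxr : x r ∈ ({α r, β r} : Finset ℝ) := by
      rw [heq, mem_rootsIn (heat_ne_zero hf r)]
      exact ⟨hx.root r rI, r3⟩
    have hback : ∀ γ, IsRootCurve (level q (ev q y T)) 0 T γ → x r = γ r → h = γ 0 := by
      intro γ hγ hxγ
      have := (hγ.mono le_rfl r4.2.le).eq_of_eq_right hf (hx.mono le_rfl r4.2.le) hxγ.symm
        (fun t ht => by
          rw [derivative_level]
          exact hγ.simple_of_level_ne hq hl t ⟨ht.1, ht.2.trans_lt r4.2⟩) 0 (left_mem_Icc.2 r4.1.le)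
      rw [this, hx0]
    rcases Finset.mem_insert.1 hxr with h' | h'
    · exact Or.inl (hback α hα h')
    · exact Or.inr (hback β hβ (Finset.mem_singleton.1 h'))
  · rintro (rfl | rfl)
    · simpa only [hαT] using hα.joins hT.le
    · simpa only [hβT] using hβ.joins hT.le

/-! ### The left end of a multiple zero -/

/-- The leftmost curve of zeros that runs into a given zero. -/
theorem exists_leftmost_curve {P : ℝ[X]} (hP : P ≠ 0) {x₀ a t₀ : ℝ} (hat : a < t₀)
    (h0 : ev P x₀ t₀ = 0) :
    ∃ γ c δ, a < c ∧ c < t₀ ∧ 0 < δ ∧ IsRootCurve P c t₀ γ ∧ γ t₀ = x₀ ∧ ∀ t ∈ Ico c t₀,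
      IsLeast {x | x ∈ Ioo (x₀ - δ) (x₀ + δ) ∧ ev P x t = 0} (γ t) ∧
        ev (derivative P) (γ t) t ≠ 0 := by
  obtain ⟨δ, -, ε, hB⟩ := exists_isBox hP x₀ t₀ one_pos
  obtain ⟨c, hc1, hct⟩ := exists_between (show max a (t₀ - ε) < t₀ from
    max_lt hat (by linarith [hB.ε_pos]))
  have hcI : c ∈ Ico (t₀ - ε) t₀ := ⟨(le_max_right _ _).trans hc1.le, hct⟩
  have hmem : ∀ {x t}, x ∈ rootsIn (heat t P) (x₀ - δ) (x₀ + δ) ↔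
      ev P x t = 0 ∧ x ∈ Ioo (x₀ - δ) (x₀ + δ) := fun {x t} => mem_rootsIn (heat_ne_zero hP t)
  have hne : (rootsIn (heat c P) (x₀ - δ) (x₀ + δ)).Nonempty := by
    obtain ⟨x, hx, hx0⟩ := hB.exists_root_back hP h0 hcI
    exact ⟨x, hmem.2 ⟨hx0, hx⟩⟩
  obtain ⟨y, hy, hymin⟩ := Finset.exists_min_image _ id hne
  rw [hmem] at hy
  obtain ⟨γ, hγ, hγc, hγt, hγb⟩ := hB.exists_curve_to_center hP hcI hy.2 hy.1
  refine ⟨γ, c, δ, (le_max_left _ _).trans_lt hc1, hct, hB.δ_pos, hγ, hγt, fun t ht => ?_⟩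
  have htI : t ∈ Icc c t₀ := Ico_subset_Icc_self ht
  refine ⟨⟨⟨hγb t htI, hγ.root t htI⟩, fun x hx => ?_⟩, hB.back_simple t ⟨hcI.1.trans ht.1, ht.2⟩ _
    (hγb t htI) (hγ.root t htI)⟩
  by_contra hlt
  obtain ⟨ξ, hξ, hξt⟩ := exists_backward hP ht.1 hx.2
  have hb : ξ c ∈ Ioo (x₀ - δ) (x₀ + δ) := hB.stays isPreconnected_Icc
    (fun r hr => abs_sub_le_of_mem_Icc_left ⟨hcI.1.trans hr.1, hr.2.trans ht.2.le⟩) hξ.cont hξ.root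
    (right_mem_Icc.2 ht.1) (left_mem_Icc.2 ht.1) (by rw [hξt]; exact hx.1)
  have h1 := hymin (ξ c) (hmem.2 ⟨hξ.root c (left_mem_Icc.2 ht.1), hb⟩)
  have h2 := hξ.lt_of_lt_right hP (hγ.mono le_rfl ht.2.le) (by rw [hξt]; exact not_le.1 hlt) c
    (left_mem_Icc.2 ht.1)
  rw [hγc] at h2
  exact absurd h1 (not_le.2 h2)

/-- Every multiple zero of `∂ₓ² p` has a left end: the outer feet of the level curves that merge
on the left branch are monotone and bounded. -/
theorem exists_isLeftEnd {p : ℝ[X]} (hp : derivative (derivative p) ≠ 0) {z : ℝ × ℝ}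
    (hz : 0 < z.2) (h0 : ev (derivative (derivative p)) z.1 z.2 = 0) : ∃ X, IsLeftEnd p z X := by
  obtain ⟨x₀, t₀⟩ := z
  dsimp only at hz h0
  set q := derivative p with hq
  obtain ⟨γ, c, δ, hc0, hct, hδ, hγ, hγt, hleast⟩ := exists_leftmost_curve hp hz h0
  -- `q` is injective along `γ`, so only finitely many points of `γ` share their level with one of
  -- the finitely many multiple zeros; all the others have exactly two feet
  have hinj : InjOn (fun r => ev q (γ r) r) (Icc c t₀) :=
    hγ.injOn_ev fun r hr => (hleast r ⟨hr.1.le, hr.2⟩).2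
  have hfin : {t | t ∈ Ico c t₀ ∧ ∃ w : ℝ × ℝ, (IsCrit (derivative q) w.1 w.2 ∧ 0 ≤ w.2) ∧
      ev q w.1 w.2 = ev q (γ t) t}.Finite := by
    refine Set.Finite.of_finite_image (f := fun r => ev q (γ r) r)
      (((finite_crit hp 0).image fun w => ev q w.1 w.2).subset ?_)
      (hinj.mono fun t ht => Ico_subset_Icc_self ht.1)
    rintro _ ⟨t, ⟨-, w, hw, hwt⟩, rfl⟩
    exact ⟨w, hw, hwt⟩
  have hgood : ∀ᶠ t in 𝓝[<] t₀, ∀ y s, 0 < s → s < t → IsCrit (derivative q) y s →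
      ev q y s ≠ ev q (γ t) t := by
    have h1 : ∀ᶠ t in 𝓝[<] t₀, t ∉ {t | t ∈ Ico c t₀ ∧ ∃ w : ℝ × ℝ,
        (IsCrit (derivative q) w.1 w.2 ∧ 0 ≤ w.2) ∧ ev q w.1 w.2 = ev q (γ t) t} :=
      nhdsWithin_le_nhds (hfin.isClosed.isOpen_compl.mem_nhds fun h => lt_irrefl _ h.1.2)
    filter_upwards [h1, Ico_mem_nhdsLT hct] with t ht1 ht2 y s hs hst hy hys
    exact ht1 ⟨ht2, (y, s), ⟨hy, hs.le⟩, hys⟩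
  -- a level curve that passes to the left of the multiple zero bounds the outer feet from below
  obtain ⟨w, hw⟩ := exists_joins hp (x₀ - 1) hz.le
  obtain ⟨ω, hω, hω0, hωt⟩ := hw
  have hbelow : ∀ᶠ t in 𝓝[<] t₀, ω t < γ t := by
    refine (tendsto_left_of_continuousOn_Icc hω.cont (right_mem_Ioc.2 hz)).eventually_lt
      (tendsto_left_of_continuousOn_Icc hγ.cont (right_mem_Ioc.2 hct)) ?_
    rw [hωt, hγt]; linarith
  obtain ⟨d, hd, hdt⟩ := (mem_nhdsLT_iff_exists_Ioo_subset' hct).1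
    ((hgood.and hbelow).and (Ico_mem_nhdsLT hct))
  replace hd : d < t₀ := hd
  have hpos : ∀ t ∈ Ioo d t₀, 0 < t := fun t ht => hc0.trans_le (hdt ht).2.1
  have hroot : ∀ t ∈ Ioo d t₀, ev (derivative q) (γ t) t = 0 := fun t ht =>
    hγ.root t (Ico_subset_Icc_self (hdt ht).2)
  have htwo : ∀ t ∈ Ioo d t₀, _ := fun t ht =>
    exists_two_level_curves (q := q) hp (hpos t ht) (hroot t ht)
  choose! α β hα hβ hαt hβt hαβ using htwo
  have hanti : ∀ t ∈ Ioo d t₀, ∀ t' ∈ Ioo d t₀, t < t' → α t' 0 < α t 0 := by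
    intro t ht t' ht' htt
    have hcc : c ≤ t := (hdt ht).2.1
    have h1 := nested hp htt (hγ.mono hcc ht'.2.le) (hleast t' (hdt ht').2).2
      (hinj.mono (Icc_subset_Icc hcc ht'.2.le)) ((hα t' ht').mono (hpos t ht).le le_rfl)
      ((hβ t' ht').mono (hpos t ht).le le_rfl) (hαt t' ht') (hβt t' ht')
      (fun r hr => hαβ t' ht' r ⟨(hpos t ht).le.trans hr.1, hr.2⟩) t (left_mem_Ico.2 htt)
    exact levelCurve_lt hp ((hα t' ht').mono le_rfl htt.le) (hα t ht)
      (by rw [hαt t ht]; exact h1.1) 0 (left_mem_Icc.2 (hpos t ht).le)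
  have hbdd : BddBelow ((fun t => α t 0) '' Ioo d t₀) := by
    refine ⟨w, ?_⟩
    rintro _ ⟨t, ht, rfl⟩
    rw [← hω0]
    exact (levelCurve_lt hp (hω.mono le_rfl ht.2.le) (hα t ht)
      (by rw [hαt t ht]; exact (hdt ht).1.2) 0 (left_mem_Icc.2 (hpos t ht).le)).le
  have hlim := AntitoneOn.tendsto_nhdsWithin_Ioo_left (f := fun t => α t 0) (nonempty_Ioo.2 hd)
    (fun t ht t' ht' htt => by
      rcases eq_or_lt_of_le htt with rfl | h
      · exact le_rfl
      · exact (hanti t ht t' ht' h).le) hbdd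
  refine ⟨_, γ, fun t => α t 0, fun t => β t 0, ⟨?_, δ, hδ, ?_⟩, ?_, hlim⟩
  · have := tendsto_left_of_continuousOn_Icc hγ.cont (right_mem_Ioc.2 hct)
    rwa [hγt] at this
  · filter_upwards [Ioo_mem_nhdsLT hd] with t ht
    have := (hleast t (hdt ht).2).1
    simp only [mem_fingerprint_iff (p := p) (k := 2) hp (hpos t ht)]
    exact this
  · filter_upwards [Ioo_mem_nhdsLT hd] with t ht
    refine ⟨hαβ t ht 0 ⟨le_rfl, hpos t ht⟩, ?_⟩
    ext h
    rw [feet, mem_ofPred_eq, reaches_iff hp]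
    simp only [(hpos t ht).le, true_and, mem_insert_iff, mem_singleton_iff]
    exact joins_iff_of_simple hp (hpos t ht) (hroot t ht) (hleast t (hdt ht).2).2 (hdt ht).1.1
      (hα t ht) (hβ t ht) (hαt t ht) (hβt t ht) (hαβ t ht) h

/-! ### Extinction of zeros for even degree -/

/-- A polynomial of even degree with positive leading coefficient becomes positive under the heat
flow: once `∂ₓ²` is bounded below by a positive constant, the evolution grows at a uniform rate. -/
theorem eventually_pos_of_even {P : ℝ[X]} (hdeg : Even P.natDegree) (hlc : 0 < P.leadingCoeff) :
    ∃ c > 0, ∃ T, ∀ t ≥ T, ∀ x, c ≤ ev P x t := by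
  obtain ⟨k, hk⟩ := hdeg
  induction k generalizing P with
  | zero =>
    refine ⟨P.leadingCoeff, hlc, 0, fun t _ x => ?_⟩
    rw [eq_C_of_natDegree_eq_zero (p := P) (by omega), ev_C]; simp
  | succ k ih =>
    have hd1 : P.derivative.natDegree = 2 * k + 1 := by rw [natDegree_derivative]; omega
    have hd2 : P.derivative.derivative.natDegree = 2 * k := by rw [natDegree_derivative]; omega
    obtain ⟨c, hc, T, hT⟩ := ih (P := derivative (derivative P)) (by
      rw [leadingCoeff, hd2, coeff_derivative, coeff_derivative]
      have : P.coeff (2 * k + 1 + 1) = P.leadingCoeff := by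
        rw [leadingCoeff, hk]; congr 1; omega
      rw [this]; positivity) (by omega)
    -- the evolution at time `T` is bounded below because the degree is even
    have hbelow : ∃ B, ∀ x, B ≤ ev P x T := by
      have hpos : ∀ Q : ℝ[X], 0 < Q.natDegree → 0 ≤ Q.leadingCoeff →
          Tendsto (fun x => Q.eval x) atTop atTop := fun Q h1 h2 =>
        Q.tendsto_atTop_of_leadingCoeff_nonneg (natDegree_pos_iff_degree_pos.1 h1) h2
      have h1 : Tendsto (fun x => ev P x T) atTop atTop :=
        hpos _ (by rw [natDegree_heat]; omega) (by rw [leadingCoeff_heat]; exact hlc.le)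
      have h2 : Tendsto (fun x => ev P x T) atBot atTop := by
        have h3 : Tendsto (fun x => ev (P.comp (-X)) x T) atTop atTop := by
          refine hpos _ ?_ ?_
          · rw [natDegree_heat, natDegree_comp]; simp; omega
          · rw [leadingCoeff_heat, leadingCoeff_comp (by simp)]
            simp [hk, hlc.le]
        refine (h3.comp tendsto_neg_atBot_atTop).congr fun x => ?_
        simp [ev_comp_neg_X]
      obtain ⟨x, hx⟩ := ((continuous_ev P).comp (by fun_prop : Continuous fun x : ℝ =>
        (x, T))).exists_forall_le (by
          rw [cocompact_eq_atBot_atTop]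
          exact Filter.Tendsto.sup h2 h1)
      exact ⟨_, hx⟩
    obtain ⟨B, hB⟩ := hbelow
    refine ⟨1, one_pos, max T (T + 2 * (1 - B) / c), fun t ht x => ?_⟩
    have h1 := (convex_Ici T).mul_sub_le_image_sub_of_le_deriv (f := fun s => ev P x s) (C := c / 2)
      (fun s _ => (hasDerivAt_ev_right P x s).continuousAt.continuousWithinAt)
      (fun s _ => (hasDerivAt_ev_right P x s).differentiableAt.differentiableWithinAt)
      (fun s hs => by
        rw [interior_Ici] at hs
        rw [(hasDerivAt_ev_right P x s).deriv]
        linarith [hT s (le_of_lt hs) x]) T self_mem_Ici t ((le_max_left _ _).trans ht)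
      ((le_max_left _ _).trans ht)
    have h2 := (le_max_right _ _).trans ht
    have h3 : 2 * (1 - B) ≤ c * (t - T) := by
      have : 2 * (1 - B) / c ≤ t - T := by linarith
      rw [div_le_iff₀ hc] at this
      linarith
    have := hB x
    linarith

theorem eventually_ne_zero_of_even {P : ℝ[X]} (hP : P ≠ 0) (hdeg : Even P.natDegree) :
    ∃ T, ∀ t ≥ T, ∀ x, ev P x t ≠ 0 := by
  rcases lt_or_gt_of_ne (leadingCoeff_ne_zero.2 hP) with h | h
  · obtain ⟨c, hc, T, hT⟩ := eventually_pos_of_even (P := -P) (by rwa [natDegree_neg])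
      (by rw [leadingCoeff_neg]; linarith)
    refine ⟨T, fun t ht x h0 => ?_⟩
    have := hT t ht x
    rw [ev_neg, h0] at this
    linarith
  · obtain ⟨c, hc, T, hT⟩ := eventually_pos_of_even hdeg h
    refine ⟨T, fun t ht x h0 => ?_⟩
    have := hT t ht x
    rw [h0] at this
    linarith

/-! ### Reflection -/

theorem derivative_comp_neg_X (P : ℝ[X]) :
    derivative (P.comp (-X)) = -(derivative P).comp (-X) := by
  rw [derivative_comp]; simp

theorem comp_neg_X_comp_neg_X (P : ℝ[X]) : (P.comp (-X)).comp (-X) = P := by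
  rw [comp_assoc]; simp

theorem derivative_derivative_comp_neg_X (P : ℝ[X]) :
    derivative (derivative (P.comp (-X))) = (derivative (derivative P)).comp (-X) := by
  rw [derivative_comp_neg_X, derivative_neg, derivative_comp_neg_X, neg_neg]

theorem derivative_derivative_comp_neg_X_ne_zero {p : ℝ[X]} (hp : derivative (derivative p) ≠ 0) :
    derivative (derivative (p.comp (-X))) ≠ 0 := by
  rw [derivative_derivative_comp_neg_X]
  intro h
  apply hp
  rw [← comp_neg_X_comp_neg_X (derivative (derivative p)), h, zero_comp]

theorem Joins.reflect {p : ℝ[X]} {h y T : ℝ} (hj : Joins (derivative p) h y T) :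
    Joins (derivative (p.comp (-X))) (-h) (-y) T := by
  obtain ⟨x, hx, rfl, rfl⟩ := hj
  refine ⟨fun t => -x t, ⟨hx.cont.neg, fun t ht => ?_⟩, rfl, rfl⟩
  rw [ev_level, derivative_comp_neg_X, ev_neg, ev_comp_neg_X, neg_neg, hx.ev_eq ht]
  simp

/-- The feet of the reflected polynomial are the reflected feet. -/
theorem feet_reflect {p : ℝ[X]} (hp : derivative (derivative p) ≠ 0) (x t : ℝ) :
    feet (p.comp (-X)) (-x, t) = Neg.neg '' feet p (x, t) := by
  have hp' := derivative_derivative_comp_neg_X_ne_zero hp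
  ext h
  simp only [feet, mem_image, mem_ofPred_eq, reaches_iff hp, reaches_iff hp']
  constructor
  · rintro ⟨h0, hj⟩
    refine ⟨-h, ⟨h0, ?_⟩, neg_neg h⟩
    have := hj.reflect
    rwa [comp_neg_X_comp_neg_X, neg_neg] at this
  · rintro ⟨h', ⟨h0, hj⟩, rfl⟩
    exact ⟨h0, hj.reflect⟩

/-- `FP₂` of the reflected polynomial, at positive times. -/
theorem mem_fingerprint_reflect {p : ℝ[X]} (hp : derivative (derivative p) ≠ 0) (x : ℝ) {t : ℝ}
    (ht : 0 < t) : (x, t) ∈ fingerprint (p.comp (-X)) 2 ↔ (-x, t) ∈ fingerprint p 2 := by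
  rw [mem_fingerprint_iff (k := 2) (derivative_derivative_comp_neg_X_ne_zero hp) ht,
    mem_fingerprint_iff (k := 2) hp ht, ← ev_comp_neg_X]
  exact Iff.of_eq (congrArg (fun Q => ev Q x t = 0) (derivative_derivative_comp_neg_X p))

theorem IsLeftEnd.reflect {p : ℝ[X]} (hp : derivative (derivative p) ≠ 0) {x₀ t₀ X₀ : ℝ}
    (ht₀ : 0 < t₀) (h : IsLeftEnd p (x₀, t₀) X₀) :
    IsRightEnd (p.comp (-X)) (-x₀, t₀) (-X₀) := by
  obtain ⟨γ, xLL, xLR, ⟨hγ, δ, hδ, hleast⟩, hfeet, hlim⟩ := h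
  refine ⟨fun t => -γ t, fun t => -xLR t, fun t => -xLL t, ⟨hγ.neg, δ, hδ, ?_⟩, ?_, hlim.neg⟩
  · filter_upwards [hleast, Ioo_mem_nhdsLT ht₀] with t ht ht0
    refine ⟨⟨⟨by linarith [ht.1.1.2], by linarith [ht.1.1.1]⟩, ?_⟩, fun x hx => ?_⟩
    · rw [mem_fingerprint_reflect hp _ ht0.1, neg_neg]; exact ht.1.2
    · have := ht.2 ⟨⟨by linarith [hx.1.2], by linarith [hx.1.1]⟩,
        (mem_fingerprint_reflect hp _ ht0.1).1 hx.2⟩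
      linarith
  · filter_upwards [hfeet] with t ht
    refine ⟨by linarith [ht.1], ?_⟩
    rw [feet_reflect hp, ht.2, image_pair, pair_comm]

theorem IsRightEnd.reflect {p : ℝ[X]} (hp : derivative (derivative p) ≠ 0) {x₀ t₀ X₀ : ℝ}
    (ht₀ : 0 < t₀) (h : IsRightEnd p (x₀, t₀) X₀) :
    IsLeftEnd (p.comp (-X)) (-x₀, t₀) (-X₀) := by
  obtain ⟨γ, xRL, xRR, ⟨hγ, δ, hδ, hgreatest⟩, hfeet, hlim⟩ := h
  refine ⟨fun t => -γ t, fun t => -xRR t, fun t => -xRL t, ⟨hγ.neg, δ, hδ, ?_⟩, ?_, hlim.neg⟩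
  · filter_upwards [hgreatest, Ioo_mem_nhdsLT ht₀] with t ht ht0
    refine ⟨⟨⟨by linarith [ht.1.1.2], by linarith [ht.1.1.1]⟩, ?_⟩, fun x hx => ?_⟩
    · rw [mem_fingerprint_reflect hp _ ht0.1, neg_neg]; exact ht.1.2
    · have := ht.2 ⟨⟨by linarith [hx.1.2], by linarith [hx.1.1]⟩,
        (mem_fingerprint_reflect hp _ ht0.1).1 hx.2⟩
      linarith
  · filter_upwards [hfeet] with t ht
    refine ⟨by linarith [ht.1], ?_⟩
    rw [feet_reflect hp, ht.2, image_pair, pair_comm]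

theorem exists_isRightEnd {p : ℝ[X]} (hp : derivative (derivative p) ≠ 0) {z : ℝ × ℝ}
    (hz : 0 < z.2) (h0 : ev (derivative (derivative p)) z.1 z.2 = 0) : ∃ X, IsRightEnd p z X := by
  have hp' := derivative_derivative_comp_neg_X_ne_zero hp
  obtain ⟨X₀, hX⟩ := exists_isLeftEnd hp' (z := (-z.1, z.2)) hz (by
    rw [derivative_derivative_comp_neg_X, ev_comp_neg_X, neg_neg]; exact h0)
  have := hX.reflect hp' hz
  rw [comp_neg_X_comp_neg_X, neg_neg] at this
  exact ⟨_, this⟩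

/-! ### Position of the outer feet -/

/-- A level curve that passes to the left of a multiple zero starts to the left of its left end. -/
theorem IsLeftEnd.lt_of_lt {p : ℝ[X]} (hp : derivative (derivative p) ≠ 0) {x₀ t₀ X₀ c y : ℝ}
    (ht₀ : 0 < t₀) (h : IsLeftEnd p (x₀, t₀) X₀) (hj : Joins (derivative p) c y t₀)
    (hy : y < x₀) : c < X₀ := by
  obtain ⟨γ, xLL, xLR, ⟨hγ, -⟩, hfeet, hlim⟩ := h
  obtain ⟨y', hy1, hy2⟩ := exists_between hy
  obtain ⟨c', hj'⟩ := exists_joins hp y' ht₀.le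
  refine (hj.lt hp ht₀.le hj' hy1).trans_le (ge_of_tendsto hlim ?_)
  obtain ⟨ω, hω, hω0, hωt⟩ := id hj'
  have h1 := tendsto_left_of_continuousOn_Icc hω.cont (right_mem_Ioc.2 ht₀)
  rw [hωt] at h1
  filter_upwards [h1.eventually_lt hγ hy2, hfeet, Ioo_mem_nhdsLT ht₀] with t h2 h3 h4
  have h5 : xLL t ∈ feet p (γ t, t) := by rw [h3.2]; exact mem_insert _ _
  have h6 := (hω.mono le_rfl h4.2.le).joins h4.1.le
  rw [hω0] at h6
  exact (h6.lt hp h4.1.le ((reaches_iff hp).1 h5).2 h2).le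

theorem IsRightEnd.lt_of_lt {p : ℝ[X]} (hp : derivative (derivative p) ≠ 0) {x₀ t₀ X₀ c y : ℝ}
    (ht₀ : 0 < t₀) (h : IsRightEnd p (x₀, t₀) X₀) (hj : Joins (derivative p) c y t₀)
    (hy : x₀ < y) : X₀ < c := by
  have := (h.reflect hp ht₀).lt_of_lt (derivative_derivative_comp_neg_X_ne_zero hp) ht₀ hj.reflect
    (neg_lt_neg hy)
  linarith

/-- The outer foot on the left branch is the leftmost among all feet of the points of `FP₂` close
to the multiple zero. -/
theorem IsLeftEnd.le_of_tendsto {p : ℝ[X]} (hp : derivative (derivative p) ≠ 0) {x₀ t₀ X₀ Y : ℝ}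
    (ht₀ : 0 < t₀) (h : IsLeftEnd p (x₀, t₀) X₀) {η m : ℝ → ℝ}
    (hη : Tendsto η (𝓝[<] t₀) (𝓝 x₀)) (hm : Tendsto m (𝓝[<] t₀) (𝓝 Y))
    (hηm : ∀ᶠ t in 𝓝[<] t₀, ev (derivative (derivative p)) (η t) t = 0 ∧
      ∃ k ≤ m t, Joins (derivative p) k (η t) t) : X₀ ≤ Y := by
  obtain ⟨γ, xLL, xLR, ⟨-, δ, hδ, hleast⟩, hfeet, hlim⟩ := h
  refine le_of_tendsto_of_tendsto hlim hm ?_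
  filter_upwards [hηm, hleast, hfeet, eventually_mem_box hη hδ, Ioo_mem_nhdsLT ht₀] with
    t ⟨h1, k, hk, hj⟩ h2 h3 h4 h5
  refine le_trans ?_ hk
  have h6 : γ t ≤ η t := h2.2 ⟨h4, (mem_fingerprint_iff (k := 2) hp h5.1).2 h1⟩
  have h7 : xLL t ∈ feet p (γ t, t) := by rw [h3.2]; exact mem_insert _ _
  rcases eq_or_lt_of_le h6 with h8 | h8
  · have h9 : k ∈ feet p (γ t, t) := (reaches_iff hp).2 ⟨h5.1.le, by rwa [h8]⟩
    rw [h3.2] at h9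
    rcases h9 with h9 | h9
    · exact h9.ge
    · exact h3.1.le.trans (mem_singleton_iff.1 h9).ge
  · exact (((reaches_iff hp).1 h7).2.lt hp h5.1.le hj h8).le

theorem IsRightEnd.ge_of_tendsto {p : ℝ[X]} (hp : derivative (derivative p) ≠ 0) {x₀ t₀ X₀ Y : ℝ}
    (ht₀ : 0 < t₀) (h : IsRightEnd p (x₀, t₀) X₀) {η m : ℝ → ℝ}
    (hη : Tendsto η (𝓝[<] t₀) (𝓝 x₀)) (hm : Tendsto m (𝓝[<] t₀) (𝓝 Y))
    (hηm : ∀ᶠ t in 𝓝[<] t₀, ev (derivative (derivative p)) (η t) t = 0 ∧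
      ∃ k, m t ≤ k ∧ Joins (derivative p) k (η t) t) : Y ≤ X₀ := by
  have := (h.reflect hp ht₀).le_of_tendsto (derivative_derivative_comp_neg_X_ne_zero hp) ht₀
    hη.neg hm.neg (by
      filter_upwards [hηm] with t ⟨h1, k, hk, hj⟩
      rw [derivative_derivative_comp_neg_X, ev_comp_neg_X, neg_neg]
      exact ⟨h1, -k, neg_le_neg hk, hj.reflect⟩)
  linarith

theorem IsLeftEnd.le_isRightEnd {p : ℝ[X]} (hp : derivative (derivative p) ≠ 0) {x₀ t₀ X₀ Y₀ : ℝ}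
    (ht₀ : 0 < t₀) (h : IsLeftEnd p (x₀, t₀) X₀) (h' : IsRightEnd p (x₀, t₀) Y₀) : X₀ ≤ Y₀ := by
  obtain ⟨γ, xRL, xRR, ⟨hγ, δ, hδ, hgreatest⟩, hfeet, hlim⟩ := h'
  refine h.le_of_tendsto hp ht₀ hγ hlim ?_
  filter_upwards [hgreatest, hfeet, Ioo_mem_nhdsLT ht₀] with t h1 h2 h3
  refine ⟨(mem_fingerprint_iff (k := 2) hp h3.1).1 h1.1.2, xRR t, le_rfl, ?_⟩
  have : xRR t ∈ feet p (γ t, t) := by rw [h2.2]; simp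
  exact ((reaches_iff hp).1 this).2

/-- If the level curve from `(c, 0)` ends at a zero `(w, s)` of odd multiplicity of `∂ₓ² p`, then
`c` lies in the confinement interval of some multiple zero of `∂ₓ² p`: the curve of zeros of `∂ₓ² p`
that leaves `(w, s)` has to run into one, since no zeros are left at large times, and by `nested`
the two level curves that meet in a point of it enclose the curve from `(c, 0)`. -/
theorem exists_crit_of_merge {p : ℝ[X]} (hp : derivative (derivative p) ≠ 0)
    (heven : Even (derivative (derivative p)).natDegree) {c w s : ℝ} (hs : 0 ≤ s)
    (hj : Joins (derivative p) c w s) (hodd : Odd (mult (derivative (derivative p)) w s)) :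
    ∃ z : ℝ × ℝ, 0 < z.2 ∧ IsCrit (derivative (derivative p)) z.1 z.2 ∧
      (∀ X, IsLeftEnd p z X → X ≤ c) ∧ ∀ X, IsRightEnd p z X → c ≤ X := by
  set q := derivative p with hq
  have hw : ev (derivative q) w s = 0 := (mult_pos_iff hp).1 hodd.pos
  obtain ⟨T, hT⟩ := eventually_ne_zero_of_even hp heven
  rcases exists_forward hp (le_max_left s T) hw with ⟨η, hη, -⟩ | ⟨s₁, hs₁, η, hη, hηs, hη1⟩
  · exact absurd (hη.root _ (right_mem_Icc.2 (le_max_left s T))) (hT _ (le_max_right s T) _)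
  have hss₁ : s < s₁ := by
    refine lt_of_le_of_ne hs₁.1 fun h => ?_
    rw [← h, hηs] at hη1
    exact Nat.not_even_iff_odd.2 hodd hη1
  have hcrit₁ : IsCrit (derivative q) (η s₁) s₁ := by
    rw [isCrit_iff hp]
    have h1 := (mult_pos_iff hp).2 (hη.root s₁ (right_mem_Icc.2 hs₁.1))
    obtain ⟨k, hk⟩ := hη1
    omega
  -- the first multiple zero on the curve `η`
  obtain ⟨r₀, ⟨hr₀, hr₀c⟩, hmin⟩ : ∃ r₀, (r₀ ∈ Ioc s s₁ ∧ IsCrit (derivative q) (η r₀) r₀) ∧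
      ∀ r ∈ Ioo s r₀, ¬ IsCrit (derivative q) (η r) r := by
    have hfin : {r | r ∈ Ioc s s₁ ∧ IsCrit (derivative q) (η r) r}.Finite := by
      refine Set.Finite.of_finite_image (f := fun t => (η t, t))
        ((finite_crit hp 0).subset ?_) fun t _ s _ h => (Prod.ext_iff.1 h).2
      rintro _ ⟨r, ⟨hr, hrc⟩, rfl⟩
      exact ⟨hrc, hs.trans hr.1.le⟩
    obtain ⟨r₀, hr₀, hmin⟩ := Set.exists_min_image _ id hfin ⟨s₁, right_mem_Ioc.2 hss₁, hcrit₁⟩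
    exact ⟨r₀, hr₀, fun r hr hrc => absurd (hmin r ⟨⟨hr.1, hr.2.le.trans hr₀.1.2⟩, hrc⟩)
      (not_le.2 hr.2)⟩
  have hr₀0 : 0 < r₀ := hs.trans_lt hr₀.1
  have hη' : IsRootCurve (derivative q) s r₀ η := hη.mono le_rfl hr₀.2
  have hsimple : ∀ r ∈ Ioo s r₀, ev (derivative (derivative q)) (η r) r ≠ 0 := fun r hr h =>
    hmin r hr ⟨hη'.root r (Ioo_subset_Icc_self hr), h⟩
  have hinj := hη'.injOn_ev hsimple
  obtain ⟨ξ, hξ, hξ0, hξs⟩ := hj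
  have key : ∀ t ∈ Ioo s r₀, ∃ a b, Joins q a (η t) t ∧ Joins q b (η t) t ∧ a < c ∧ c < b := by
    intro t ht
    have ht0 : 0 < t := hs.trans_lt ht.1
    obtain ⟨α, β, hα, hβ, hαt, hβt, hαβ⟩ := exists_two_level_curves (q := q) hp ht0
      (hη'.root t (Ioo_subset_Icc_self ht))
    have h1 := nested hp ht.1 (hη'.mono le_rfl ht.2.le) (hsimple t ht)
      (hinj.mono (Icc_subset_Icc_right ht.2.le)) (hα.mono hs le_rfl) (hβ.mono hs le_rfl) hαt hβt
      (fun r hr => hαβ r ⟨hs.trans hr.1, hr.2⟩) s (left_mem_Ico.2 ht.1)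
    rw [hηs, ← hξs] at h1
    refine ⟨α 0, β 0, hαt ▸ hα.joins ht0.le, hβt ▸ hβ.joins ht0.le, ?_, ?_⟩
    · rw [← hξ0]
      exact levelCurve_lt hp (hα.mono le_rfl ht.1.le) hξ h1.1 0 (left_mem_Icc.2 hs)
    · rw [← hξ0]
      exact levelCurve_lt hp hξ (hβ.mono le_rfl ht.1.le) h1.2 0 (left_mem_Icc.2 hs)
  have hlim := tendsto_left_of_continuousOn_Icc hη'.cont (right_mem_Ioc.2 hr₀.1)
  refine ⟨(η r₀, r₀), hr₀0, hr₀c, fun X₀ hX => ?_, fun X₀ hX => ?_⟩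
  · refine hX.le_of_tendsto hp hr₀0 hlim tendsto_const_nhds ?_
    filter_upwards [Ioo_mem_nhdsLT hr₀.1] with t ht
    obtain ⟨a, b, ha, -, hac, -⟩ := key t ht
    exact ⟨hη'.root t (Ioo_subset_Icc_self ht), a, hac.le, ha⟩
  · refine hX.ge_of_tendsto hp hr₀0 hlim tendsto_const_nhds ?_
    filter_upwards [Ioo_mem_nhdsLT hr₀.1] with t ht
    obtain ⟨a, b, -, hb, -, hbc⟩ := key t ht
    exact ⟨hη'.root t (Ioo_subset_Icc_self ht), b, hbc.le, hb⟩

/-! ### The confinement zone -/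

/-- A level curve either runs up to time `T`, or it stops before that at a zero of odd multiplicity
of `∂ₓ q`. -/
theorem exists_joins_or_dies {q : ℝ[X]} (hq : derivative q ≠ 0) (c : ℝ) {T : ℝ} (hT : 0 ≤ T) :
    (∃ y, Joins q c y T) ∨ ∃ y, ∃ s ∈ Ico 0 T, Joins q c y s ∧ Odd (mult (derivative q) y s) ∧
      Even (mult (level q (q.eval c)) y s) := by
  rcases exists_forward (level_ne_zero hq (q.eval c)) hT (x₀ := c)
    (by rw [ev_level, ev_zero_time, sub_self]) with ⟨x, hx, hx0⟩ | ⟨s, hs, x, hx, hx0, hev⟩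
  · exact Or.inl ⟨x T, x, hx, hx0, rfl⟩
  · refine Or.inr ⟨x s, s, hs, ⟨x, hx, hx0, rfl⟩, ?_, hev⟩
    have h0 := hx.root s (right_mem_Icc.2 hs.1)
    have h1 := (mult_pos_iff (level_ne_zero hq _)).2 h0
    rw [← derivative_level q (q.eval c), mult_derivative h0]
    obtain ⟨k, hk⟩ := hev
    exact ⟨k - 1, by omega⟩

/-- The level curve from a point of the escape zone avoids the zeros of `∂ₓ² p`. -/
theorem ne_zero_of_mem_escapeZone {p : ℝ[X]} (hp : derivative (derivative p) ≠ 0) {c y T : ℝ}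
    (hc : c ∈ escapeZone p) (hT : 0 < T) (hj : Joins (derivative p) c y T) :
    ev (derivative (derivative p)) y T ≠ 0 := by
  intro h0
  obtain ⟨α, β, hα, hβ, hαT, hβT, hαβ⟩ := exists_two_level_curves hp hT h0
  have hR : ∀ h, Joins (derivative p) h y T → Reaches p h (y, T) := fun h hj =>
    (reaches_iff hp).2 ⟨hT.le, hj⟩
  have h1 : ∀ h, Joins (derivative p) h y T → h = c := by
    intro h hh
    by_contra hne
    exact hc.2 h hne (y, T) ⟨hR c hj, hR h hh⟩
  have h2 := h1 _ (hαT ▸ hα.joins hT.le)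
  have h3 := h1 _ (hβT ▸ hβ.joins hT.le)
  have h4 := hαβ 0 ⟨le_rfl, hT⟩
  rw [h2, h3] at h4
  exact lt_irrefl _ h4

/-- The level curve from a point of the escape zone never stops. -/
theorem exists_joins_of_mem_escapeZone {p : ℝ[X]} (hp : derivative (derivative p) ≠ 0) {c T : ℝ}
    (hc : c ∈ escapeZone p) (hT : 0 ≤ T) : ∃ y, Joins (derivative p) c y T := by
  rcases exists_joins_or_dies hp c hT with h | ⟨y, s, hs, hj, hodd, hev⟩
  · exact h
  exfalso
  rcases eq_or_lt_of_le hs.1 with rfl | hs0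
  · obtain ⟨⟨T', hT', x, hx⟩, -⟩ := hc
    have hcurve := hx.isRootCurve
    have hyc : y = c := by
      obtain ⟨x', -, rfl, rfl⟩ := hj
      rfl
    rw [hyc] at hev
    obtain ⟨δ, -, ε, hB⟩ := exists_isBox (level_ne_zero hp ((derivative p).eval c)) c 0 one_pos
    have h1 := tendsto_right_of_continuousOn_Icc hcurve.cont (left_mem_Ico.2 hT')
    rw [hx.init] at h1
    have h2 : ∀ᶠ r : ℝ in 𝓝[>] 0, r ∈ Ioo 0 T' := Ioo_mem_nhdsGT hT'
    have h3 : ∀ᶠ r : ℝ in 𝓝[>] 0, r ∈ Ioc 0 (0 + ε) := Ioc_mem_nhdsGT (by linarith [hB.ε_pos])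
    obtain ⟨r, r1, r2, r3⟩ := ((eventually_mem_box h1 hB.δ_pos).and (h2.and h3)).exists
    exact hB.fwd_even hev r r3 _ (Ioo_subset_Icc_self r1)
      (hcurve.root r (Ioo_subset_Icc_self r2))
  · exact ne_zero_of_mem_escapeZone hp hc hs0 hj ((mult_pos_iff hp).1 hodd.pos)

/-- Confinement intervals are contained in the confinement zone: an escaping level curve that starts
between the ends would have to pass through the multiple zero itself. -/
theorem mem_confinementZone_of_mem_Icc {p : ℝ[X]} (hp : derivative (derivative p) ≠ 0)
    {x₀ t₀ X₀ Y₀ c : ℝ} (ht₀ : 0 < t₀) (h0 : ev (derivative (derivative p)) x₀ t₀ = 0)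
    (hX : IsLeftEnd p (x₀, t₀) X₀) (hY : IsRightEnd p (x₀, t₀) Y₀) (hc : c ∈ Icc X₀ Y₀) :
    c ∈ confinementZone p := by
  intro hesc
  obtain ⟨y, hj⟩ := exists_joins_of_mem_escapeZone hp hesc ht₀.le
  rcases lt_trichotomy y x₀ with h | h | h
  · exact absurd (hX.lt_of_lt hp ht₀ hj h) (not_lt.2 hc.1)
  · rw [h] at hj
    exact ne_zero_of_mem_escapeZone hp hesc ht₀ hj h0
  · exact absurd (hY.lt_of_lt hp ht₀ hj h) (not_lt.2 hc.2)

theorem finite_level_set {q : ℝ[X]} (hq : derivative q ≠ 0) (l : ℝ) :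
    {c | q.eval c = l}.Finite := by
  have : {c | q.eval c = l} = {c | (level q l).eval c = 0} := by
    ext c; simp [level, sub_eq_zero]
  rw [this]
  exact (level q l).finite_setOfPred_isRoot (level_ne_zero hq l)

/-- The confinement zone is contained in any closed set that contains the confinement intervals of
all multiple zeros. If the level curves from `c` and `c'` merge, then between `c` and `c'` there are
only finitely many points on the same level of `∂ₓ p`, and the level curve from any other point
between them is trapped and has to stop, at a zero of odd multiplicity of `∂ₓ² p`; such points
accumulate at `c`. -/
theorem confinementZone_subset {p : ℝ[X]} (hp : derivative (derivative p) ≠ 0)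
    (heven : Even (derivative (derivative p)).natDegree) {U : Set ℝ} (hU : IsClosed U)
    (hcover : ∀ z : ℝ × ℝ, 0 < z.2 → IsCrit (derivative (derivative p)) z.1 z.2 → ∀ c,
      (∀ X, IsLeftEnd p z X → X ≤ c) → (∀ X, IsRightEnd p z X → c ≤ X) → c ∈ U) :
    confinementZone p ⊆ U := by
  set q := derivative p with hq
  have hdies : ∀ c y s, 0 ≤ s → Joins q c y s → Odd (mult (derivative q) y s) → c ∈ U := by
    intro c y s hs hj hodd
    obtain ⟨z, hz, hzc, h1, h2⟩ := exists_crit_of_merge hp heven hs hj hodd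
    exact hcover z hz hzc c h1 h2
  intro c hc
  rw [confinementZone, mem_compl_iff, escapeZone, mem_ofPred_eq, not_and_or] at hc
  rcases hc with hc | hc
  · rcases exists_joins_or_dies hp c zero_le_one with ⟨y, x, hx, hx0, -⟩ | ⟨y, s, hs, hj, hodd, -⟩
    · refine absurd ⟨1, one_pos, x, ?_⟩ hc
      rw [← hx0]; exact hx.isYPCurve hp zero_le_one
    · rcases eq_or_lt_of_le hs.1 with rfl | hs0
      · exact hdies c y 0 le_rfl hj hodd
      · obtain ⟨x, hx, hx0, -⟩ := hj
        refine absurd ⟨s, hs0, x, ?_⟩ hc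
        rw [← hx0]; exact hx.isYPCurve hp hs0.le
  · push Not at hc
    obtain ⟨c', hne, ⟨x₀, T⟩, h1, h2⟩ := hc
    obtain ⟨hT, hj⟩ := (reaches_iff hp).1 h1
    obtain ⟨-, hj'⟩ := (reaches_iff hp).1 h2
    dsimp only at hT hj hj'
    have hF : {d | q.eval d = ev q x₀ T}.Finite := finite_level_set hp _
    have hbetween : ∀ d, q.eval d ≠ ev q x₀ T → (c < d ∧ d < c' ∨ c' < d ∧ d < c) → d ∈ U := by
      intro d hd hdc
      rcases exists_joins_or_dies hp d hT with ⟨y, hy⟩ | ⟨y, s, hs, hy, hodd, -⟩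
      · have : y = x₀ := by
          rcases hdc with h | h
          · exact le_antisymm (hy.le_of_lt hp hT hj' h.2) (hj.le_of_lt hp hT hy h.1)
          · exact le_antisymm (hy.le_of_lt hp hT hj h.2) (hj'.le_of_lt hp hT hy h.1)
        exact absurd (by rw [hy.eval_eq hT, this]) hd
      · exact hdies d y s hs.1 hy hodd
    have havoid : ∀ᶠ d in 𝓝[≠] c, q.eval d ≠ ev q x₀ T := by
      have h3 : ({d | q.eval d = ev q x₀ T} \ {c})ᶜ ∈ 𝓝 c :=
        (hF.subset sdiff_subset).isClosed.isOpen_compl.mem_nhds fun h => h.2 rfl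
      filter_upwards [nhdsWithin_le_nhds h3, self_mem_nhdsWithin] with d h4 h5 h6
      exact h4 ⟨h6, h5⟩
    rcases lt_or_gt_of_ne hne with hlt | hlt
    · refine hU.mem_of_tendsto (b := 𝓝[<] c) (f := id) nhdsWithin_le_nhds ?_
      filter_upwards [nhdsWithin_mono c (fun x (hx : x < c) => ne_of_lt hx) havoid,
        Ioo_mem_nhdsLT hlt] with d h3 h4
      exact hbetween d h3 (Or.inr h4)
    · refine hU.mem_of_tendsto (b := 𝓝[>] c) (f := id) nhdsWithin_le_nhds ?_
      filter_upwards [nhdsWithin_mono c (fun x (hx : c < x) => ne_of_gt hx) havoid,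
        Ioo_mem_nhdsGT hlt] with d h3 h4
      exact hbetween d h3 (Or.inl h4)

end YuillePoggio

theorem mainTheorem2 (p : Polynomial ℝ) (n : ℕ) (hdeg : p.natDegree = n) (hpos : 0 < n)
    (heven : Even n) :
    ∃ (k : ℕ) (z : Fin k → ℝ × ℝ) (XLL XRR : Fin k → ℝ),
      k ≤ n / 2 - 1 ∧
      Function.Injective z ∧
      Set.range z = YuillePoggio.fingerprint p 2 ∩ YuillePoggio.fingerprint p 3 ∧
      (∀ i, YuillePoggio.IsLeftEnd p (z i) (XLL i)) ∧
      (∀ i, YuillePoggio.IsRightEnd p (z i) (XRR i)) ∧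
      (∀ i, XLL i ≤ XRR i) ∧
      YuillePoggio.confinementZone p = ⋃ i, Set.Icc (XLL i) (XRR i) := by
  open YuillePoggio in
  obtain ⟨m, hm⟩ := heven
  have hd : (derivative (derivative p)).natDegree = n - 2 := by
    rw [natDegree_derivative, natDegree_derivative, hdeg]; omega
  have hp : derivative (derivative p) ≠ 0 := by
    intro h
    have h1 := derivative_eq_zero.1 h
    rw [natDegree_derivative] at h1
    omega
  have hev : Even (derivative (derivative p)).natDegree := by
    rw [hd]; exact ⟨m - 1, by omega⟩
  have hfin : (fingerprint p 2 ∩ fingerprint p 3).Finite := by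
    rw [fingerprint_inter hp]
    exact (finite_crit hp 0).subset fun z hz => ⟨hz.2, hz.1.le⟩
  have hmem : ∀ w, w ∈ hfin.toFinset ↔ 0 < w.2 ∧ IsCrit (derivative (derivative p)) w.1 w.2 := by
    intro w; rw [Set.Finite.mem_toFinset, fingerprint_inter hp]; rfl
  set z : Fin hfin.toFinset.card → ℝ × ℝ := fun i => (hfin.toFinset.equivFin.symm i : ℝ × ℝ) with hz
  have hzi : ∀ i, 0 < (z i).2 ∧ IsCrit (derivative (derivative p)) (z i).1 (z i).2 := fun i =>
    (hmem _).1 (hfin.toFinset.equivFin.symm i).2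
  choose XLL hXLL using fun i => exists_isLeftEnd hp (hzi i).1 (hzi i).2.1
  choose XRR hXRR using fun i => exists_isRightEnd hp (hzi i).1 (hzi i).2.1
  refine ⟨_, z, XLL, XRR, ?_, ?_, ?_, hXLL, hXRR, fun i =>
    (hXLL i).le_isRightEnd hp (hzi i).1 (hXRR i), ?_⟩
  · have := two_mul_card_crit_le hp 0 hfin.toFinset fun w hw =>
      ⟨((hmem w).1 hw).2, ((hmem w).1 hw).1.le⟩
    omega
  · exact Subtype.val_injective.comp hfin.toFinset.equivFin.symm.injective
  · ext w
    rw [← hfin.mem_toFinset]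
    constructor
    · rintro ⟨i, rfl⟩
      exact (hfin.toFinset.equivFin.symm i).2
    · intro hw
      exact ⟨hfin.toFinset.equivFin ⟨w, hw⟩, by simp [hz]⟩
  · apply Set.Subset.antisymm
    · refine confinementZone_subset hp hev (isClosed_iUnion_of_finite fun i => isClosed_Icc) ?_
      intro w hw0 hwc c h1 h2
      have hw : w ∈ hfin.toFinset := (hmem w).2 ⟨hw0, hwc⟩
      have hi : z (hfin.toFinset.equivFin ⟨w, hw⟩) = w := by simp [hz]
      refine Set.mem_iUnion.2 ⟨hfin.toFinset.equivFin ⟨w, hw⟩, h1 _ ?_, h2 _ ?_⟩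
      · have := hXLL (hfin.toFinset.equivFin ⟨w, hw⟩); rwa [hi] at this
      · have := hXRR (hfin.toFinset.equivFin ⟨w, hw⟩); rwa [hi] at this
    · intro c hc
      obtain ⟨i, hi⟩ := Set.mem_iUnion.1 hc
      exact mem_confinementZone_of_mem_Icc hp (hzi i).1 (hzi i).2.1 (hXLL i) (hXRR i) hi
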